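/- **Setting.** Let $I$ be a set with a countably incomplete ultrafilter $\mathcal U$ (there are $A_0,A_1,\dots\in\mathcal U$ with $\bigcap_n A_n=\varnothing$), and for a set $S$ let ${}^*S=S^I/\mathcal U$ be its ultrapower; functions, relations and operations on $S$ are extended to ${}^*S$ componentwise. Fix $d\in\mathbb N_0$. For an open set $\Omega\subseteq\mathbb R^d$ let $\mathcal E(\Omega)=C^\infty(\Omega,\mathbb C)$, let $\mathcal D(\Omega)$ be the space of test functions and $\mathcal D'(\Omega)$ the space of Schwartz distributions on $\Omega$; for $f\in\mathcal E(\Omega)$ let $T_f\in\mathcal D'(\Omega)$, $\langle T_f,\varphi\rangle=\int_\Omega f\varphi\,dx$. Elements of ${}^*\mathcal E(\Omega)$ and ${}^*\mathcal D(\Omega)$ are regarded as functions ${}^*\Omega\to{}^*\mathbb C$, and ${}^*f\in{}^*\mathcal E(\Omega)$ is the class of the constant family $f$. Let $\mu(\Omega)\subseteq{}^*\Omega$ be the set of points that are infinitely close to a (standard) point of $\Omega$. Let $\rho\in{}^*\mathbb R$ be a positive infinitesimal. A number $z\in{}^*\mathbb C$ is *$\rho$-moderate* if $|z|\le\rho^{-n}$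 for some $n\in\mathbb N$, and *$\rho$-negligible* if $|z|\le\rho^n$ for all $n\in\mathbb N$. A function $f\in{}^*\mathcal E(\Omega)$ is $\rho$-moderate (resp. $\rho$-negligible) if for all $\alpha\in\mathbb N_0^d$ and all $x\in\mu(\Omega)$ the number $\partial^\alpha f(x)$ is $\rho$-moderate (resp. $\rho$-negligible). The $\rho$-moderate functions form a subalgebra of ${}^*\mathcal E(\Omega)$ in which the $\rho$-negligible ones form an ideal; the quotient algebra ${}^\rho\mathcal E(\Omega)$ is the algebra of *$\rho$-asymptotic functions*, and $\widehat f$ denotes the class of $f$. Partial derivatives and restrictions to open subsets are defined on representatives. A function $D\in{}^*\mathcal E(\mathbb R^d)$ is a *$\rho$-delta function* if $D(x)=0$ for $\|x\|\ge\rho$; $\int_{\|x\|\le\rho}D(x)\,dx-1$ is $\rho$-negligible; $\int_{\|x\|\le\rho}D(x)\,x^\alpha dx$ is $\rho$-negligible for all $\alpha\in\mathbb N_0^d$, $\alpha\ne0$; and $D$ is $\rho$-moderate. A function $\Pi\in{}^*\mathcal D(\Omega)$ is a *$\rho$-cut-off function* for $\Omega$ if $\Pi(x)=1$ for all $x\in\mu(\Omega)$,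 and $\|x-y\|\ge\rho$ for all $x$ in the (internal) support of $\Pi$ and all $y\in{}^*(\partial\Omega)$. **Theorem (Existence of an Embedding).** For every positive infinitesimal $\rho$ there are a $\rho$-delta function $D$, for each open $\Omega\subseteq\mathbb R^d$ a $\rho$-cut-off function $\Pi_\Omega$ for $\Omega$, and for each open $\Omega\subseteq\mathbb R^d$ a $\mathbb C$-linear map $\Sigma_\Omega:\mathcal D'(\Omega)\to{}^\rho\mathcal E(\Omega)$, such that for all open $\Omega\subseteq\mathbb R^d$: 1. for every $T\in\mathcal D'(\Omega)$, $\Sigma_\Omega(T)$ is the class of the convolution $({}^*T\,\Pi_\Omega)\star D$, i.e. of the $\rho$-moderate function in ${}^*\mathcal E(\Omega)$ given by $x\mapsto\langle{}^*T,\ \xi\mapsto\Pi_\Omega(\xi)D(x-\xi)\rangle$ for $x\in{}^*\Omega$; 2. $f\mapsto T_f$, $\mathcal E(\Omega)\to\mathcal D'(\Omega)$, and $\Sigma_\Omega$ are injective; 3. $\Sigma_\Omega(\partial^\alpha T)=\partial^\alpha\Sigma_\Omega(T)$ for all $T\in\mathcal D'(\Omega)$ and $\alpha\in\mathbb N_0^d$;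 4. $\Sigma$ preserves the sheaf structure: for every open $O\subseteq\Omega$ and $T\in\mathcal D'(\Omega)$, $\Sigma_O(T|_O)=\Sigma_\Omega(T)|_O$, and $\Sigma_\Omega(T)|_O=0$ if and only if $T|_O=0$; 5. $\Sigma_\Omega(T_f)=\widehat{{}^*f}$ for every $f\in\mathcal E(\Omega)$; 6. consequently $\Sigma_\Omega(T_f)\,\Sigma_\Omega(T_g)=\Sigma_\Omega(T_{fg})$ for all $f,g\in\mathcal E(\Omega)$: the multiplication of ${}^\rho\mathcal E(\Omega)$ extends the pointwise multiplication of $\mathcal E(\Omega)$. In short, $\mathcal E(\Omega)\hookrightarrow\mathcal D'(\Omega)\hookrightarrow{}^\rho\mathcal E(\Omega)$. -/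

import Mathlib

open scoped ContDiff Distributions
open TopologicalSpace Filter

namespace RhoAsymptotic

noncomputable section

/-! ### Iterated partial derivatives -/

/-- `∂^α = ∂₁^{α₁} ⋯ ∂_d^{α_d}` for a family `∂₁, …, ∂_d` of linear operators on a space `X`
(in all uses below, the operators of the family commute). -/
def multiDeriv {d : ℕ} {X : Type*} [AddCommGroup X] [Module ℂ X]
    (D : Fin d → Module.End ℂ X) (α : Fin d → ℕ) : Module.End ℂ X :=
  ((List.finRange d).map fun j => D j ^ α j).prod

theorem multiDeriv_zero {d : ℕ} {X : Type*} [AddCommGroup X] [Module ℂ X]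
    (D : Fin d → Module.End ℂ X) : multiDeriv D 0 = 1 := by
  simp [multiDeriv]

theorem list_prod_add_single {d : ℕ} {X : Type*} [AddCommGroup X] [Module ℂ X]
    (D : Fin d → Module.End ℂ X) (hD : ∀ i j, Commute (D i) (D j)) (α : Fin d → ℕ) (j : Fin d)
    (l : List (Fin d)) (hl : l.Nodup) :
    (l.map fun i => D i ^ (α + Pi.single j 1 : Fin d → ℕ) i).prod =
      if j ∈ l then D j * (l.map fun i => D i ^ α i).prod
      else (l.map fun i => D i ^ α i).prod := by
  induction l with
  | nil => simp
  | cons i l ih =>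
    have hn := List.nodup_cons.1 hl
    rw [List.map_cons, List.prod_cons, ih hn.2, List.map_cons, List.prod_cons]
    by_cases hij : i = j
    · subst hij
      simp [hn.1, pow_succ', mul_assoc]
    · have hji : ¬ j = i := fun h => hij h.symm
      have h0 : (α + Pi.single j 1 : Fin d → ℕ) i = α i := by simp [hij]
      rw [h0]
      by_cases hjl : j ∈ l
      · simp only [hjl, if_true, List.mem_cons, or_true]
        rw [← mul_assoc, ((hD i j).pow_left (α i)).eq, mul_assoc]
      · simp [hjl, hji]

theorem multiDeriv_add_single {d : ℕ} {X : Type*} [AddCommGroup X] [Module ℂ X]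
    (D : Fin d → Module.End ℂ X) (hD : ∀ i j, Commute (D i) (D j)) (α : Fin d → ℕ) (j : Fin d) :
    multiDeriv D (α + Pi.single j 1) = D j * multiDeriv D α := by
  unfold multiDeriv
  rw [list_prod_add_single D hD α j _ (List.nodup_finRange d)]
  simp

theorem commute_multiDeriv {d : ℕ} {X : Type*} [AddCommGroup X] [Module ℂ X]
    (D : Fin d → Module.End ℂ X) (hD : ∀ i j, Commute (D i) (D j)) (α : Fin d → ℕ) (j : Fin d) :
    Commute (D j) (multiDeriv D α) := by
  refine Commute.list_prod_right _ _ fun x hx => ?_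
  obtain ⟨i, -, rfl⟩ := List.mem_map.1 hx
  exact (hD j i).pow_right _

theorem map_multiDeriv {d : ℕ} {X Y : Type*} [AddCommGroup X] [Module ℂ X]
    [AddCommGroup Y] [Module ℂ Y] (D : Fin d → Module.End ℂ X) (D' : Fin d → Module.End ℂ Y)
    (φ : X →ₗ[ℂ] Y) (h : ∀ j f, φ (D j f) = D' j (φ f)) (α : Fin d → ℕ) (f : X) :
    φ (multiDeriv D α f) = multiDeriv D' α (φ f) := by
  have hp : ∀ j (n : ℕ) (f : X), φ ((D j ^ n) f) = (D' j ^ n) (φ f) := by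
    intro j n
    induction n with
    | zero => simp
    | succ n ih => intro f; rw [pow_succ, pow_succ, Module.End.mul_apply, ih, h]; rfl
  unfold multiDeriv
  induction List.finRange d generalizing f with
  | nil => simp
  | cons i l ih => simp [hp, ih]

/-- Every multi-index is reached from `0` by adding unit multi-indices. -/
theorem multiIndex_induction {d : ℕ} {P : (Fin d → ℕ) → Prop} (h0 : P 0)
    (hs : ∀ α j, P α → P (α + Pi.single j 1)) (α : Fin d → ℕ) : P α := by
  induction hn : ∑ i, α i generalizing α with
  | zero =>
    have : α = 0 := by
      ext i
      simpa using (Finset.sum_eq_zero_iff.1 hn) i (Finset.mem_univ i)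
    exact this ▸ h0
  | succ n ih =>
    obtain ⟨j, -, hj⟩ : ∃ j ∈ Finset.univ, α j ≠ 0 := by
      by_contra! hc
      rw [Finset.sum_eq_zero hc] at hn
      omega
    have hα : (α - Pi.single j 1) + Pi.single j 1 = α := by
      ext i
      by_cases hij : i = j
      · subst hij
        simp only [Pi.add_apply, Pi.sub_apply, Pi.single_eq_same]
        omega
      · simp [hij]
    rw [← hα]
    refine hs _ j (ih _ ?_)
    have h1 : ∑ i, ((α - Pi.single j 1) + Pi.single j 1 : Fin d → ℕ) i = n + 1 := by
      rw [hα]; exact hn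
    simp only [Pi.add_apply] at h1
    rw [Finset.sum_add_distrib] at h1
    simp only [Finset.sum_pi_single', Finset.mem_univ, if_true] at h1
    exact Nat.succ_injective h1

/-! ### Smooth functions on an open set -/

/-- The Euclidean space `ℝ^d`. -/
abbrev Vec (d : ℕ) := EuclideanSpace ℝ (Fin d)

/-- The `j`-th standard unit vector of `ℝ^d`. -/
def unitVec {d : ℕ} (j : Fin d) : Vec d := EuclideanSpace.single j 1

/-- Extension by `0` of a function on `Ω` to all of `ℝ^d`. -/
def extZero {d : ℕ} {Ω : Opens (Vec d)} (f : Ω → ℂ) : Vec d → ℂ :=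
  Function.extend Subtype.val f 0

theorem extZero_coe {d : ℕ} {Ω : Opens (Vec d)} (f : Ω → ℂ) (x : Ω) : extZero f x = f x :=
  Subtype.val_injective.extend_apply f 0 x

theorem extZero_mem {d : ℕ} {Ω : Opens (Vec d)} (f : Ω → ℂ) {x : Vec d} (hx : x ∈ Ω) :
    extZero f x = f ⟨x, hx⟩ := extZero_coe f ⟨x, hx⟩

/-- The algebra `E(Ω) = C^∞(Ω)` of the smooth functions `Ω → ℂ`. -/
def Smooth {d : ℕ} (Ω : Opens (Vec d)) : Subalgebra ℂ (Ω → ℂ) where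
  carrier := {f | ContDiffOn ℝ ∞ (extZero f) Ω}
  mul_mem' {f g} hf hg := by
    refine (ContDiffOn.mul hf hg).congr fun x hx => ?_
    simp [extZero_mem _ hx]
  add_mem' {f g} hf hg := by
    refine (ContDiffOn.add hf hg).congr fun x hx => ?_
    simp [extZero_mem _ hx]
  algebraMap_mem' c := by
    refine (contDiffOn_const (c := c)).congr fun x hx => ?_
    simp [extZero_mem _ hx]

theorem Smooth.contDiffAt {d : ℕ} {Ω : Opens (Vec d)} (f : Smooth Ω) {x : Vec d} (hx : x ∈ Ω) :
    ContDiffAt ℝ ∞ (extZero f.1) x :=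
  (f.2 : ContDiffOn ℝ ∞ (extZero f.1) Ω).contDiffAt (Ω.isOpen.mem_nhds hx)

theorem Smooth.differentiableAt {d : ℕ} {Ω : Opens (Vec d)} (f : Smooth Ω) {x : Vec d}
    (hx : x ∈ Ω) : DifferentiableAt ℝ (extZero f.1) x :=
  (Smooth.contDiffAt f hx).differentiableAt (by simp)

theorem extZero_eventuallyEq {d : ℕ} {Ω : Opens (Vec d)} (f : Ω → ℂ) (g : Vec d → ℂ)
    (h : ∀ x : Ω, f x = g x) {x : Vec d} (hx : x ∈ Ω) : extZero f =ᶠ[nhds x] g := by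
  filter_upwards [Ω.isOpen.mem_nhds hx] with y hy
  rw [extZero_mem f hy, h]

/-- The partial derivative `∂_j` on `E(Ω)`. -/
def Smooth.pderiv {d : ℕ} {Ω : Opens (Vec d)} (j : Fin d) : Module.End ℂ (Smooth Ω) where
  toFun f := ⟨fun x => fderiv ℝ (extZero f.1) x (unitVec j), by
    have h1 : ContDiffOn ℝ ∞ (fun x => fderiv ℝ (extZero f.1) x (unitVec j)) Ω :=
      (ContDiffOn.fderiv_of_isOpen f.2 Ω.isOpen (by simp)).clm_apply contDiffOn_const
    refine h1.congr fun x hx => ?_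
    rw [extZero_mem _ hx]⟩
  map_add' f g := by
    ext x
    have h : extZero (f + g).1 =ᶠ[nhds x.1] extZero f.1 + extZero g.1 :=
      extZero_eventuallyEq _ _ (fun y => by simp [extZero_coe]) x.2
    simp only [h.fderiv_eq]
    rw [fderiv_add (Smooth.differentiableAt f x.2) (Smooth.differentiableAt g x.2)]
    rfl
  map_smul' c f := by
    ext x
    have h : extZero (c • f).1 =ᶠ[nhds x.1] c • extZero f.1 :=
      extZero_eventuallyEq _ _ (fun y => by simp [extZero_coe]) x.2
    simp only [h.fderiv_eq]
    rw [fderiv_const_smul (Smooth.differentiableAt f x.2)]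
    rfl

theorem Smooth.pderiv_apply {d : ℕ} {Ω : Opens (Vec d)} (j : Fin d) (f : Smooth Ω) (x : Ω) :
    (Smooth.pderiv j f).1 x = fderiv ℝ (extZero f.1) x (unitVec j) := rfl

theorem Smooth.pderiv_mul {d : ℕ} {Ω : Opens (Vec d)} (j : Fin d) (f g : Smooth Ω) :
    Smooth.pderiv j (f * g) = Smooth.pderiv j f * g + f * Smooth.pderiv j g := by
  ext x
  have h : extZero (f * g).1 =ᶠ[nhds x.1] extZero f.1 * extZero g.1 :=
    extZero_eventuallyEq _ _ (fun y => by simp [extZero_coe]) x.2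
  simp only [Smooth.pderiv_apply, h.fderiv_eq]
  rw [fderiv_mul (Smooth.differentiableAt f x.2) (Smooth.differentiableAt g x.2)]
  simp [extZero_coe, Smooth.pderiv_apply]
  ring

theorem Smooth.pderiv_algebraMap {d : ℕ} {Ω : Opens (Vec d)} (j : Fin d) (c : ℂ) :
    Smooth.pderiv j (algebraMap ℂ (Smooth Ω) c) = 0 := by
  ext x
  have h : extZero (algebraMap ℂ (Smooth Ω) c).1 =ᶠ[nhds x.1] fun _ => c :=
    extZero_eventuallyEq (algebraMap ℂ (Smooth Ω) c).1 _ (fun y => rfl) x.2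
  rw [Smooth.pderiv_apply, h.fderiv_eq]
  simp

theorem Smooth.pderiv_commute {d : ℕ} {Ω : Opens (Vec d)} (i j : Fin d) :
    Commute (Smooth.pderiv (Ω := Ω) i) (Smooth.pderiv j) := by
  have key : ∀ (i j : Fin d) (f : Smooth Ω) (x : Ω),
      (Smooth.pderiv i (Smooth.pderiv j f)).1 x =
        fderiv ℝ (fderiv ℝ (extZero f.1)) x (unitVec i) (unitVec j) := by
    intro i j f x
    have h : extZero (Smooth.pderiv j f).1 =ᶠ[nhds x.1] fun y => fderiv ℝ (extZero f.1) y (unitVec j) :=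
      extZero_eventuallyEq (Smooth.pderiv j f).1 _ (fun y => rfl) x.2
    rw [Smooth.pderiv_apply, Filter.EventuallyEq.fderiv_eq h]
    have hd : DifferentiableAt ℝ (fderiv ℝ (extZero f.1)) x :=
      ((Smooth.contDiffAt f x.2).fderiv_right (m := 1) (by norm_cast)).differentiableAt (by simp)
    rw [fderiv_clm_apply hd (differentiableAt_const _)]
    simp
  refine LinearMap.ext fun f => Subtype.ext (funext fun x => ?_)
  rw [Module.End.mul_apply, Module.End.mul_apply, key, key]
  have hs : IsSymmSndFDerivAt ℝ (extZero f.1) x :=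
    (Smooth.contDiffAt f x.2).isSymmSndFDerivAt (by simp; norm_cast)
  exact hs _ _

/-- The restriction `E(Ω) → E(O)` for open sets `O ⊆ Ω`. -/
def Smooth.restrict {d : ℕ} {O Ω : Opens (Vec d)} (h : O ≤ Ω) : Smooth Ω →ₐ[ℂ] Smooth O where
  toFun f := ⟨fun x => f.1 ⟨x.1, h x.2⟩, by
    refine ContDiffOn.congr ((f.2 : ContDiffOn ℝ ∞ (extZero f.1) Ω).mono h) fun x hx => ?_
    rw [extZero_mem _ hx, extZero_mem _ (h hx)]⟩
  map_one' := rfl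
  map_mul' _ _ := rfl
  map_zero' := rfl
  map_add' _ _ := rfl
  commutes' _ := rfl

theorem Smooth.extZero_restrict {d : ℕ} {O Ω : Opens (Vec d)} (h : O ≤ Ω) (f : Smooth Ω)
    {x : Vec d} (hx : x ∈ O) : extZero (Smooth.restrict h f).1 x = extZero f.1 x := by
  rw [extZero_mem _ hx, extZero_mem _ (h hx)]
  rfl

theorem Smooth.restrict_pderiv {d : ℕ} {O Ω : Opens (Vec d)} (h : O ≤ Ω) (j : Fin d)
    (f : Smooth Ω) :
    Smooth.restrict h (Smooth.pderiv j f) = Smooth.pderiv j (Smooth.restrict h f) := by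
  refine Subtype.ext (funext fun x => ?_)
  have he : extZero (Smooth.restrict h f).1 =ᶠ[nhds x.1] extZero f.1 :=
    extZero_eventuallyEq _ _ (fun y => (extZero_mem f.1 (h y.2)).symm) x.2
  rw [Smooth.pderiv_apply, he.fderiv_eq]
  rfl

/-! ### Schwartz distributions -/

/-- The space `D'(Ω)` of Schwartz distributions: the continuous `ℂ`-linear functionals on the
space `D(Ω)` of the complex-valued test functions. -/
abbrev Distr {d : ℕ} (Ω : Opens (Vec d)) := 𝓓(Ω, ℂ) →L[ℂ] ℂ

/-- `⟨∂_j T, φ⟩ = - ⟨T, ∂_j φ⟩`. -/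
def Distr.pderiv {d : ℕ} {Ω : Opens (Vec d)} (j : Fin d) : Module.End ℂ (Distr Ω) where
  toFun T := -(T ∘L (TestFunction.lineDerivCLM ℂ (unitVec j) : 𝓓(Ω, ℂ) →L[ℂ] 𝓓(Ω, ℂ)))
  map_add' S T := by ext φ; simp; ring
  map_smul' c T := by ext φ; simp

/-- The restriction `D'(Ω) → D'(O)` for open sets `O ⊆ Ω`: a test function on `O` is a test
function on `Ω`. -/
def Distr.restrict {d : ℕ} {O Ω : Opens (Vec d)} (_h : O ≤ Ω) (T : Distr Ω) : Distr O :=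
  T ∘L (TestFunction.monoCLM ℂ : 𝓓(O, ℂ) →L[ℂ] 𝓓(Ω, ℂ))

theorem Smooth.locallyIntegrableOn {d : ℕ} {Ω : Opens (Vec d)} (f : Smooth Ω) :
    MeasureTheory.LocallyIntegrableOn (extZero f.1) Ω MeasureTheory.volume :=
  ContinuousOn.locallyIntegrableOn (ContDiffOn.continuousOn f.2) Ω.isOpen.measurableSet

/-- `f ↦ T_f`, where `⟨T_f, φ⟩ = ∫_Ω f(x) φ(x) dx`. -/
def Distr.ofSmooth {d : ℕ} {Ω : Opens (Vec d)} : Smooth Ω →ₗ[ℂ] Distr Ω where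
  toFun f := TestFunction.integralAgainstBilinCLM (ContinuousLinearMap.mul ℂ ℂ)
    MeasureTheory.volume (extZero f.1)
  map_add' f g := by
    ext φ
    have h : (extZero (f + g).1) = extZero f.1 + extZero g.1 := by
      funext x
      by_cases hx : x ∈ Ω
      · simp [extZero_mem _ hx]
      · have h0 : ∀ u : Ω → ℂ, extZero u x = 0 := fun u =>
          Function.extend_apply' _ _ _ (by rintro ⟨y, rfl⟩; exact hx y.2)
        simp [h0]
    rw [add_apply, TestFunction.integralAgainstBilinCLM_eq_integral (Smooth.locallyIntegrableOn f),
      TestFunction.integralAgainstBilinCLM_eq_integral (Smooth.locallyIntegrableOn g),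
      TestFunction.integralAgainstBilinCLM_eq_integral (Smooth.locallyIntegrableOn (f + g)), h,
      ← MeasureTheory.integral_add
        (TestFunction.integrable_bilin _ (Smooth.locallyIntegrableOn f) φ)
        (TestFunction.integrable_bilin _ (Smooth.locallyIntegrableOn g) φ)]
    simp [mul_add]
  map_smul' c f := by
    ext φ
    have h : (extZero (c • f).1) = c • extZero f.1 := by
      funext x
      by_cases hx : x ∈ Ω
      · simp [extZero_mem _ hx]
      · have h0 : ∀ u : Ω → ℂ, extZero u x = 0 := fun u =>
          Function.extend_apply' _ _ _ (by rintro ⟨y, rfl⟩; exact hx y.2)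
        simp [h0]
    rw [smul_apply, TestFunction.integralAgainstBilinCLM_eq_integral (Smooth.locallyIntegrableOn f),
      TestFunction.integralAgainstBilinCLM_eq_integral (Smooth.locallyIntegrableOn (c • f)), h,
      RingHom.id_apply, ← MeasureTheory.integral_smul]
    simp only [ContinuousLinearMap.mul_apply', Pi.smul_apply, smul_eq_mul]
    congr 1
    funext x
    ring

theorem Distr.ofSmooth_apply {d : ℕ} {Ω : Opens (Vec d)} (f : Smooth Ω) (φ : 𝓓(Ω, ℂ)) :
    Distr.ofSmooth f φ = ∫ x in (Ω : Set (Vec d)), extZero f.1 x * φ x := by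
  have h : Distr.ofSmooth f φ = ∫ x, φ x * extZero f.1 x := by
    change TestFunction.integralAgainstBilinCLM _ _ _ φ = _
    rw [TestFunction.integralAgainstBilinCLM_eq_integral (Smooth.locallyIntegrableOn f)]
    rfl
  rw [h, MeasureTheory.setIntegral_eq_integral_of_forall_compl_eq_zero]
  · simp_rw [mul_comm]
  · intro x hx
    rw [show φ x = 0 from image_eq_zero_of_notMem_tsupport fun hm => hx (φ.tsupport_subset hm),
      mul_zero]

/-! ### The non-standard extension -/

/-- An ultrafilter is countably incomplete if some sequence of its members has an empty
intersection. -/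
def CountablyIncomplete {I : Type*} (U : Ultrafilter I) : Prop :=
  ∃ S : ℕ → Set I, (∀ n, S n ∈ U) ∧ ⋂ n, S n = ∅

/-- The non-standard extension `*S`: the ultrapower of `S` modulo the ultrafilter `U`. In particular
`*ℝ`, `*ℂ`, `*(ℝ^d) = (*ℝ)^d` and `*E(Ω)`. The coercion `↑s` of `s : S` is `*s`. -/
abbrev Star {I : Type*} (U : Ultrafilter I) (S : Type*) := Germ (U : Filter I) S

section NonStandard

variable {I : Type*} {U : Ultrafilter I} {d : ℕ}

/-- The algebra `*E(Ω)` of the non-standard smooth functions on `Ω`: the ultrapower of `E(Ω)`. -/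
def StarE (U : Ultrafilter I) (Ω : Opens (Vec d)) := Star U (Smooth Ω)

/-- The element `⟨f_i⟩` of `*E(Ω)`. -/
def StarE.of (U : Ultrafilter I) {Ω : Opens (Vec d)} (f : I → Smooth Ω) : StarE U Ω :=
  (f : Star U (Smooth Ω))

/-- The non-standard extension `*f` of `f ∈ E(Ω)`. -/
def StarE.standard (U : Ultrafilter I) {Ω : Opens (Vec d)} (f : Smooth Ω) : StarE U Ω :=
  StarE.of U fun _ => f

theorem StarE.of_surjective {Ω : Opens (Vec d)} (f : StarE U Ω) : ∃ g, StarE.of U g = f :=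
  Quotient.exists_rep f

theorem StarE.of_eq {Ω : Opens (Vec d)} {f g : I → Smooth Ω} :
    StarE.of U f = StarE.of U g ↔ ∀ᶠ i in (U : Filter I), f i = g i :=
  Germ.coe_eq

instance (U : Ultrafilter I) (Ω : Opens (Vec d)) : CommRing (StarE U Ω) :=
  inferInstanceAs (CommRing (Germ (U : Filter I) (Smooth Ω)))

instance (U : Ultrafilter I) (Ω : Opens (Vec d)) : Algebra ℂ (StarE U Ω) where
  smul c f := Germ.map (fun g : Smooth Ω => c • g) f
  algebraMap :=
    { toFun := fun c => StarE.standard U (algebraMap ℂ (Smooth Ω) c)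
      map_one' := StarE.of_eq.2 (.of_forall fun _ => map_one _)
      map_mul' := fun _ _ => StarE.of_eq.2 (.of_forall fun _ => map_mul _ _ _)
      map_zero' := StarE.of_eq.2 (.of_forall fun _ => map_zero _)
      map_add' := fun _ _ => StarE.of_eq.2 (.of_forall fun _ => map_add _ _ _) }
  commutes' _ _ := mul_comm _ _
  smul_def' c f := by
    obtain ⟨f, rfl⟩ := StarE.of_surjective f
    exact StarE.of_eq.2 (.of_forall fun i => Algebra.smul_def c (f i))

theorem StarE.of_add {Ω : Opens (Vec d)} (f g : I → Smooth Ω) :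
    StarE.of U f + StarE.of U g = StarE.of U (fun i => f i + g i) := rfl

theorem StarE.of_mul {Ω : Opens (Vec d)} (f g : I → Smooth Ω) :
    StarE.of U f * StarE.of U g = StarE.of U (fun i => f i * g i) := rfl

theorem StarE.smul_of {Ω : Opens (Vec d)} (c : ℂ) (f : I → Smooth Ω) :
    c • StarE.of U f = StarE.of U (fun i => c • f i) := rfl

theorem StarE.algebraMap_eq {Ω : Opens (Vec d)} (c : ℂ) :
    algebraMap ℂ (StarE U Ω) c = StarE.standard U (algebraMap ℂ (Smooth Ω) c) := rfl

/-- The norm (absolute value) `‖⟨x_i⟩‖ = ⟨‖x_i‖⟩` in `*ℝ`. -/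
def starNorm {E : Type*} [NormedAddCommGroup E] (x : Star U E) : Star U ℝ :=
  Germ.map (fun v : E => ‖v‖) x

/-- `‖x‖ < 1 / n` for all positive integers `n`. -/
def IsInfinitesimal {E : Type*} [NormedAddCommGroup E] (x : Star U E) : Prop :=
  ∀ n : ℕ, starNorm x < ((1 / ((n : ℝ) + 1) : ℝ) : Star U ℝ)

/-- The monad `μ(X) = {r + h : r ∈ X, h ≈ 0}` of a set `X ⊆ ℝ^d`. -/
def monad (U : Ultrafilter I) (X : Set (Vec d)) : Set (Star U (Vec d)) :=
  {x | ∃ r ∈ X, IsInfinitesimal (x - (r : Star U (Vec d)))}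

/-- The non-standard extension `*X` of a set `X ⊆ S`. -/
def starSet (U : Ultrafilter I) {S : Type*} (X : Set S) : Set (Star U S) :=
  {x | Germ.LiftPred (fun s => s ∈ X) x}

/-- The value `⟨f_i⟩(⟨x_i⟩) = ⟨f_i(x_i)⟩` of `f ∈ *E(Ω)` at `x ∈ *Ω`. -/
def eval {Ω : Opens (Vec d)} (f : StarE U Ω) (x : Star U (Vec d)) : Star U ℂ :=
  Germ.map₂ (fun (g : Smooth Ω) y => extZero g.1 y) f x

theorem mem_starSet_of_infinitesimal {x : Star U (Vec d)} {r : Vec d}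
    (hx : IsInfinitesimal (x - (r : Star U (Vec d)))) {W : Set (Vec d)} (hW : W ∈ nhds r) :
    x ∈ starSet U W := by
  obtain ⟨ε, hε, hb⟩ := Metric.mem_nhds_iff.1 hW
  obtain ⟨n, hn⟩ := exists_nat_one_div_lt hε
  have h := hx n
  induction x using Germ.inductionOn with | _ x =>
  have h' : ∀ᶠ i in (U : Filter I), ‖x i - r‖ < 1 / ((n : ℝ) + 1) := Germ.coe_lt.1 h
  refine Filter.Eventually.mono h' fun i hi => hb ?_
  rw [Metric.mem_ball, dist_eq_norm]
  exact hi.trans hn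

theorem monad_subset_starSet (Ω : Opens (Vec d)) : monad U (Ω : Set (Vec d)) ⊆ starSet U Ω :=
  fun _ ⟨_, hr, hx⟩ => mem_starSet_of_infinitesimal hx (Ω.isOpen.mem_nhds hr)

theorem monad_mono {X Y : Set (Vec d)} (h : X ⊆ Y) : monad U X ⊆ monad U Y :=
  fun _ ⟨r, hr, hx⟩ => ⟨r, h hr, hx⟩

theorem starNorm_add_le {E : Type*} [NormedAddCommGroup E] (x y : Star U E) :
    starNorm (x + y) ≤ starNorm x + starNorm y := by
  induction x using Germ.inductionOn with | _ x =>
  induction y using Germ.inductionOn with | _ y =>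
  exact Filter.Eventually.of_forall fun i => norm_add_le (x i) (y i)

theorem starNorm_mul (x y : Star U ℂ) : starNorm (x * y) = starNorm x * starNorm y := by
  induction x using Germ.inductionOn with | _ x =>
  induction y using Germ.inductionOn with | _ y =>
  exact Germ.coe_eq.2 (Filter.Eventually.of_forall fun i => norm_mul (x i) (y i))

theorem starNorm_nonneg {E : Type*} [NormedAddCommGroup E] (x : Star U E) :
    0 ≤ starNorm x := by
  induction x using Germ.inductionOn with | _ x =>
  exact Filter.Eventually.of_forall fun i => norm_nonneg (x i)

theorem eval_add {Ω : Opens (Vec d)} (f g : StarE U Ω) {x : Star U (Vec d)}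
    (hx : x ∈ starSet U Ω) : eval (f + g) x = eval f x + eval g x := by
  obtain ⟨f, rfl⟩ := StarE.of_surjective f
  obtain ⟨g, rfl⟩ := StarE.of_surjective g
  induction x using Germ.inductionOn with | _ x =>
  refine Germ.coe_eq.2 (Filter.Eventually.mono hx fun i hi => ?_)
  change extZero (f i + g i).1 (x i) = extZero (f i).1 (x i) + extZero (g i).1 (x i)
  simp [extZero_mem _ (show x i ∈ Ω from hi)]

theorem eval_mul {Ω : Opens (Vec d)} (f g : StarE U Ω) {x : Star U (Vec d)}
    (hx : x ∈ starSet U Ω) : eval (f * g) x = eval f x * eval g x := by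
  obtain ⟨f, rfl⟩ := StarE.of_surjective f
  obtain ⟨g, rfl⟩ := StarE.of_surjective g
  induction x using Germ.inductionOn with | _ x =>
  refine Germ.coe_eq.2 (Filter.Eventually.mono hx fun i hi => ?_)
  change extZero (f i * g i).1 (x i) = extZero (f i).1 (x i) * extZero (g i).1 (x i)
  simp [extZero_mem _ (show x i ∈ Ω from hi)]

theorem eval_const {Ω : Opens (Vec d)} (c : ℂ) {x : Star U (Vec d)}
    (hx : x ∈ starSet U Ω) :
    eval (StarE.standard U (algebraMap ℂ (Smooth Ω) c)) x = (c : Star U ℂ) := by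
  induction x using Germ.inductionOn with | _ x =>
  refine Germ.coe_eq.2 (Filter.Eventually.mono hx fun i hi => ?_)
  exact extZero_mem (algebraMap ℂ (Smooth Ω) c).1 (show x i ∈ Ω from hi)

theorem eval_zero {Ω : Opens (Vec d)} {x : Star U (Vec d)} (hx : x ∈ starSet U Ω) :
    eval (U := U) (0 : StarE U Ω) x = 0 := by
  have h := eval_add (0 : StarE U Ω) 0 hx
  rw [add_zero] at h
  exact left_eq_add.1 h

/-- The partial derivative `∂_j ⟨f_i⟩ = ⟨∂_j f_i⟩` on `*E(Ω)`. -/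
def starPderiv {Ω : Opens (Vec d)} (j : Fin d) : Module.End ℂ (StarE U Ω) where
  toFun := Germ.map (Smooth.pderiv j)
  map_add' f g := by
    obtain ⟨f, rfl⟩ := StarE.of_surjective f
    obtain ⟨g, rfl⟩ := StarE.of_surjective g
    exact Germ.coe_eq.2 (Filter.Eventually.of_forall fun i => map_add _ (f i) (g i))
  map_smul' c f := by
    obtain ⟨f, rfl⟩ := StarE.of_surjective f
    exact Germ.coe_eq.2 (Filter.Eventually.of_forall fun i => map_smul _ c (f i))

theorem starPderiv_commute {Ω : Opens (Vec d)} (i j : Fin d) :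
    Commute (starPderiv (U := U) (Ω := Ω) i) (starPderiv j) := by
  refine LinearMap.ext fun f => ?_
  obtain ⟨f, rfl⟩ := StarE.of_surjective f
  exact Germ.coe_eq.2 (Filter.Eventually.of_forall fun k =>
    LinearMap.congr_fun (Smooth.pderiv_commute i j).eq (f k))

theorem starPderiv_mul {Ω : Opens (Vec d)} (j : Fin d) (f g : StarE U Ω) :
    starPderiv j (f * g) = starPderiv j f * g + f * starPderiv j g := by
  obtain ⟨f, rfl⟩ := StarE.of_surjective f
  obtain ⟨g, rfl⟩ := StarE.of_surjective g
  exact Germ.coe_eq.2 (Filter.Eventually.of_forall fun i => Smooth.pderiv_mul j (f i) (g i))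

theorem starPderiv_algebraMap {Ω : Opens (Vec d)} (j : Fin d) (c : ℂ) :
    starPderiv j (algebraMap ℂ (StarE U Ω) c) = 0 := by
  rw [StarE.algebraMap_eq]
  exact Germ.coe_eq.2 (Filter.Eventually.of_forall fun _ => Smooth.pderiv_algebraMap j c)

/-- The restriction `*E(Ω) → *E(O)`, `⟨f_i⟩ ↦ ⟨f_i|O⟩`, for open sets `O ⊆ Ω`. -/
def starRestrict (U : Ultrafilter I) {O Ω : Opens (Vec d)} (h : O ≤ Ω) :
    StarE U Ω →ₐ[ℂ] StarE U O where
  toFun := Germ.map (Smooth.restrict h)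
  map_one' := rfl
  map_zero' := rfl
  map_mul' f g := by
    obtain ⟨f, rfl⟩ := StarE.of_surjective f
    obtain ⟨g, rfl⟩ := StarE.of_surjective g
    rfl
  map_add' f g := by
    obtain ⟨f, rfl⟩ := StarE.of_surjective f
    obtain ⟨g, rfl⟩ := StarE.of_surjective g
    rfl
  commutes' c := by
    rw [StarE.algebraMap_eq, StarE.algebraMap_eq]
    rfl

theorem eval_starRestrict {O Ω : Opens (Vec d)} (h : O ≤ Ω) (f : StarE U Ω)
    {x : Star U (Vec d)} (hx : x ∈ starSet U O) : eval (starRestrict U h f) x = eval f x := by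
  obtain ⟨f, rfl⟩ := StarE.of_surjective f
  induction x using Germ.inductionOn with | _ x =>
  exact Germ.coe_eq.2 (Filter.Eventually.mono hx fun i hi => Smooth.extZero_restrict h (f i) hi)

theorem starRestrict_starPderiv {O Ω : Opens (Vec d)} (h : O ≤ Ω) (j : Fin d)
    (f : StarE U Ω) :
    starRestrict U h (starPderiv j f) = starPderiv j (starRestrict U h f) := by
  obtain ⟨f, rfl⟩ := StarE.of_surjective f
  exact Germ.coe_eq.2 (Filter.Eventually.of_forall fun i => Smooth.restrict_pderiv h j (f i))

/-! ### Moderate and negligible numbers -/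

/-- The type of the positive infinitesimals of `*ℝ`. -/
def PosInfinitesimal (U : Ultrafilter I) : Type _ :=
  {ρ : Star U ℝ // 0 < ρ ∧ IsInfinitesimal ρ}

/-- The `ρ`-moderate numbers: `|z| ≤ ρ⁻ⁿ` for some `n`. -/
def ModerateNum (ρ : PosInfinitesimal U) : Set (Star U ℂ) :=
  {z | ∃ n : ℕ, starNorm z ≤ (ρ.1⁻¹) ^ n}

/-- The `ρ`-negligible numbers: `|z| ≤ ρⁿ` for all `n`. -/
def NegligibleNum (ρ : PosInfinitesimal U) : Set (Star U ℂ) :=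
  {z | ∀ n : ℕ, starNorm z ≤ ρ.1 ^ n}

theorem PosInfinitesimal.two_mul_le (ρ : PosInfinitesimal U) : 2 * ρ.1 ≤ 1 := by
  obtain ⟨ρ, h0, h⟩ := ρ
  have h1 := h 1
  change 2 * ρ ≤ 1
  clear h
  induction ρ using Germ.inductionOn with | _ r =>
  have h2 : ∀ᶠ i in (U : Filter I), ‖r i‖ < 1 / (((1 : ℕ) : ℝ) + 1) := Germ.coe_lt.1 h1
  refine Filter.Eventually.mono h2 fun i hi => ?_
  have := (le_abs_self (r i)).trans_lt hi
  change 2 * r i ≤ 1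
  norm_num at this
  linarith

theorem PosInfinitesimal.le_one (ρ : PosInfinitesimal U) : ρ.1 ≤ 1 := by
  have h1 := ρ.two_mul_le
  have h2 := ρ.2.1
  linarith

theorem PosInfinitesimal.two_le_inv (ρ : PosInfinitesimal U) : 2 ≤ ρ.1⁻¹ := by
  rw [← one_div, le_div_iff₀ ρ.2.1]
  exact ρ.two_mul_le

theorem ModerateNum.add {ρ : PosInfinitesimal U} {z w : Star U ℂ} (hz : z ∈ ModerateNum ρ)
    (hw : w ∈ ModerateNum ρ) : z + w ∈ ModerateNum ρ := by
  obtain ⟨n, hn⟩ := hz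
  obtain ⟨m, hm⟩ := hw
  have h2 := ρ.two_le_inv
  have h1 : 1 ≤ ρ.1⁻¹ := by linarith
  refine ⟨n + m + 1, (starNorm_add_le z w).trans ?_⟩
  have ha : ρ.1⁻¹ ^ n ≤ ρ.1⁻¹ ^ (n + m) := pow_le_pow_right₀ h1 (by omega)
  have hb : ρ.1⁻¹ ^ m ≤ ρ.1⁻¹ ^ (n + m) := pow_le_pow_right₀ h1 (by omega)
  have hc : 0 ≤ ρ.1⁻¹ ^ (n + m) := by positivity
  rw [pow_succ]
  nlinarith

theorem ModerateNum.mul {ρ : PosInfinitesimal U} {z w : Star U ℂ} (hz : z ∈ ModerateNum ρ)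
    (hw : w ∈ ModerateNum ρ) : z * w ∈ ModerateNum ρ := by
  obtain ⟨n, hn⟩ := hz
  obtain ⟨m, hm⟩ := hw
  refine ⟨n + m, ?_⟩
  rw [starNorm_mul, pow_add]
  exact mul_le_mul hn hm (starNorm_nonneg w) ((starNorm_nonneg z).trans hn)

theorem ModerateNum.const (ρ : PosInfinitesimal U) (c : ℂ) : (c : Star U ℂ) ∈ ModerateNum ρ := by
  obtain ⟨n, hn⟩ := pow_unbounded_of_one_lt ‖c‖ (one_lt_two (α := ℝ))
  refine ⟨n, le_trans ?_ (pow_le_pow_left₀ zero_le_two ρ.two_le_inv n)⟩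
  exact Filter.Eventually.of_forall fun _ => hn.le

theorem NegligibleNum.zero (ρ : PosInfinitesimal U) : (0 : Star U ℂ) ∈ NegligibleNum ρ := by
  intro n
  have h : starNorm (0 : Star U ℂ) = 0 :=
    Germ.coe_eq.2 (Filter.Eventually.of_forall fun _ => norm_zero)
  rw [h]
  exact pow_nonneg ρ.2.1.le n

theorem NegligibleNum.add {ρ : PosInfinitesimal U} {z w : Star U ℂ} (hz : z ∈ NegligibleNum ρ)
    (hw : w ∈ NegligibleNum ρ) : z + w ∈ NegligibleNum ρ := by
  intro n
  refine (starNorm_add_le z w).trans ?_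
  have h1 := hz (n + 1)
  have h2 := hw (n + 1)
  have h3 := ρ.two_mul_le
  have h4 : 0 ≤ ρ.1 ^ n := pow_nonneg ρ.2.1.le n
  rw [pow_succ] at h1 h2
  nlinarith

theorem NegligibleNum.mul {ρ : PosInfinitesimal U} {z w : Star U ℂ} (hz : z ∈ ModerateNum ρ)
    (hw : w ∈ NegligibleNum ρ) : z * w ∈ NegligibleNum ρ := by
  obtain ⟨m, hm⟩ := hz
  intro n
  rw [starNorm_mul]
  refine (mul_le_mul hm (hw (m + n)) (starNorm_nonneg w)
    ((starNorm_nonneg z).trans hm)).trans (le_of_eq ?_)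
  rw [pow_add, ← mul_assoc, ← mul_pow, inv_mul_cancel₀ ρ.2.1.ne', one_pow, one_mul]

theorem NegligibleNum.moderate {ρ : PosInfinitesimal U} {z : Star U ℂ}
    (hz : z ∈ NegligibleNum ρ) : z ∈ ModerateNum ρ :=
  ⟨0, by simpa using hz 0⟩

/-! ### The algebra of `ρ`-asymptotic functions -/

/-- The `ρ`-moderate functions: `f ∈ *E(Ω)` such that `∂^α f(x)` is a `ρ`-moderate number for all
multi-indices `α` and all `x ∈ μ(Ω)`. -/
def IsModerate (ρ : PosInfinitesimal U) {Ω : Opens (Vec d)} (f : StarE U Ω) : Prop :=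
  ∀ (α : Fin d → ℕ), ∀ x ∈ monad U (Ω : Set (Vec d)),
    eval (multiDeriv starPderiv α f) x ∈ ModerateNum ρ

/-- The `ρ`-negligible functions: `f ∈ *E(Ω)` such that `∂^α f(x)` is a `ρ`-negligible number for
all multi-indices `α` and all `x ∈ μ(Ω)`. -/
def IsNegligible (ρ : PosInfinitesimal U) {Ω : Opens (Vec d)} (f : StarE U Ω) : Prop :=
  ∀ (α : Fin d → ℕ), ∀ x ∈ monad U (Ω : Set (Vec d)),
    eval (multiDeriv starPderiv α f) x ∈ NegligibleNum ρ

theorem multiDeriv_starPderiv {Ω : Opens (Vec d)} (α : Fin d → ℕ) (j : Fin d)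
    (f : StarE U Ω) :
    multiDeriv starPderiv (α + Pi.single j 1) f = multiDeriv starPderiv α (starPderiv j f) := by
  rw [multiDeriv_add_single _ starPderiv_commute,
    (commute_multiDeriv _ starPderiv_commute α j).eq]
  rfl

theorem IsModerate.pderiv {ρ : PosInfinitesimal U} {Ω : Opens (Vec d)} {f : StarE U Ω}
    (hf : IsModerate ρ f) (j : Fin d) : IsModerate ρ (starPderiv j f) := by
  intro α x hx
  rw [← multiDeriv_starPderiv]
  exact hf _ x hx

theorem IsNegligible.pderiv {ρ : PosInfinitesimal U} {Ω : Opens (Vec d)} {f : StarE U Ω}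
    (hf : IsNegligible ρ f) (j : Fin d) : IsNegligible ρ (starPderiv j f) := by
  intro α x hx
  rw [← multiDeriv_starPderiv]
  exact hf _ x hx

theorem IsModerate.add {ρ : PosInfinitesimal U} {Ω : Opens (Vec d)} {f g : StarE U Ω}
    (hf : IsModerate ρ f) (hg : IsModerate ρ g) : IsModerate ρ (f + g) := by
  intro α x hx
  rw [map_add, eval_add _ _ (monad_subset_starSet Ω hx)]
  exact ModerateNum.add (hf α x hx) (hg α x hx)

theorem IsModerate.mul {ρ : PosInfinitesimal U} {Ω : Opens (Vec d)} {f g : StarE U Ω}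
    (hf : IsModerate ρ f) (hg : IsModerate ρ g) : IsModerate ρ (f * g) := by
  intro α x hx
  have hx' := monad_subset_starSet Ω hx
  induction α using multiIndex_induction generalizing f g with
  | h0 =>
    have h1 := hf 0 x hx
    have h2 := hg 0 x hx
    rw [multiDeriv_zero, Module.End.one_apply] at h1 h2 ⊢
    rw [eval_mul _ _ hx']
    exact ModerateNum.mul h1 h2
  | hs α j ih =>
    rw [multiDeriv_starPderiv, starPderiv_mul, map_add, eval_add _ _ hx']
    exact ModerateNum.add (ih (hf.pderiv j) hg) (ih hf (hg.pderiv j))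

theorem IsModerate.mul_negligible {ρ : PosInfinitesimal U} {Ω : Opens (Vec d)}
    {f g : StarE U Ω} (hf : IsModerate ρ f) (hg : IsNegligible ρ g) :
    IsNegligible ρ (f * g) := by
  intro α x hx
  have hx' := monad_subset_starSet Ω hx
  induction α using multiIndex_induction generalizing f g with
  | h0 =>
    have h1 := hf 0 x hx
    have h2 := hg 0 x hx
    rw [multiDeriv_zero, Module.End.one_apply] at h1 h2 ⊢
    rw [eval_mul _ _ hx']
    exact NegligibleNum.mul h1 h2
  | hs α j ih =>
    rw [multiDeriv_starPderiv, starPderiv_mul, map_add, eval_add _ _ hx']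
    exact NegligibleNum.add (ih (hf.pderiv j) hg) (ih hf (hg.pderiv j))

theorem isModerate_const (ρ : PosInfinitesimal U) {Ω : Opens (Vec d)} (c : ℂ) :
    IsModerate ρ (algebraMap ℂ (StarE U Ω) c) := by
  intro α x hx
  have hx' := monad_subset_starSet Ω hx
  induction α using multiIndex_induction with
  | h0 =>
    rw [multiDeriv_zero, Module.End.one_apply, StarE.algebraMap_eq, eval_const c hx']
    exact ModerateNum.const ρ c
  | hs α j ih =>
    rw [multiDeriv_starPderiv, starPderiv_algebraMap, map_zero, eval_zero hx']
    exact NegligibleNum.moderate (NegligibleNum.zero ρ)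

theorem IsModerate.restrict {ρ : PosInfinitesimal U} {O Ω : Opens (Vec d)} (h : O ≤ Ω)
    {f : StarE U Ω} (hf : IsModerate ρ f) : IsModerate ρ (starRestrict U h f) := by
  intro α x hx
  have e := map_multiDeriv starPderiv starPderiv (starRestrict U h).toLinearMap
    (starRestrict_starPderiv h) α f
  rw [AlgHom.toLinearMap_apply, AlgHom.toLinearMap_apply] at e
  rw [← e, eval_starRestrict h _ (monad_subset_starSet O hx)]
  exact hf α x (monad_mono h hx)

theorem IsNegligible.restrict {ρ : PosInfinitesimal U} {O Ω : Opens (Vec d)} (h : O ≤ Ω)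
    {f : StarE U Ω} (hf : IsNegligible ρ f) : IsNegligible ρ (starRestrict U h f) := by
  intro α x hx
  have e := map_multiDeriv starPderiv starPderiv (starRestrict U h).toLinearMap
    (starRestrict_starPderiv h) α f
  rw [AlgHom.toLinearMap_apply, AlgHom.toLinearMap_apply] at e
  rw [← e, eval_starRestrict h _ (monad_subset_starSet O hx)]
  exact hf α x (monad_mono h hx)

/-- The algebra `M_ρ(*E(Ω))` of the `ρ`-moderate functions. -/
def Moderate (ρ : PosInfinitesimal U) (Ω : Opens (Vec d)) :
    Subalgebra ℂ (StarE U Ω) where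
  carrier := {f | IsModerate ρ f}
  mul_mem' hf hg := IsModerate.mul hf hg
  add_mem' hf hg := IsModerate.add hf hg
  algebraMap_mem' c := isModerate_const ρ c

/-- The ideal `N_ρ(*E(Ω))` of the `ρ`-negligible functions in `M_ρ(*E(Ω))`. -/
def Negligible (ρ : PosInfinitesimal U) (Ω : Opens (Vec d)) : Ideal (Moderate ρ Ω) where
  carrier := {f | IsNegligible ρ f.1}
  add_mem' {f g} hf hg := by
    intro α x hx
    change eval (multiDeriv starPderiv α (f.1 + g.1)) x ∈ _
    rw [map_add, eval_add _ _ (monad_subset_starSet Ω hx)]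
    exact NegligibleNum.add (hf α x hx) (hg α x hx)
  zero_mem' := by
    intro α x hx
    change eval (multiDeriv starPderiv α 0) x ∈ _
    rw [map_zero, eval_zero (monad_subset_starSet Ω hx)]
    exact NegligibleNum.zero ρ
  smul_mem' f _ hg := IsModerate.mul_negligible f.2 hg

/-- The algebra `^ρE(Ω) = M_ρ(*E(Ω)) / N_ρ(*E(Ω))` of the `ρ`-asymptotic functions on `Ω`. -/
def RhoE (ρ : PosInfinitesimal U) (Ω : Opens (Vec d)) := Moderate ρ Ω ⧸ Negligible ρ Ω

instance (ρ : PosInfinitesimal U) (Ω : Opens (Vec d)) : CommRing (RhoE ρ Ω) :=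
  inferInstanceAs (CommRing (Moderate ρ Ω ⧸ Negligible ρ Ω))

instance (ρ : PosInfinitesimal U) (Ω : Opens (Vec d)) : Algebra ℂ (RhoE ρ Ω) :=
  inferInstanceAs (Algebra ℂ (Moderate ρ Ω ⧸ Negligible ρ Ω))

/-- The class `Q_Ω(f) ∈ ^ρE(Ω)` of a `ρ`-moderate function `f`. -/
def RhoE.mk (ρ : PosInfinitesimal U) {Ω : Opens (Vec d)} (f : StarE U Ω)
    (hf : IsModerate ρ f) : RhoE ρ Ω :=
  Ideal.Quotient.mk (Negligible ρ Ω) ⟨f, hf⟩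

theorem RhoE.mk_surjective {ρ : PosInfinitesimal U} {Ω : Opens (Vec d)} (q : RhoE ρ Ω) :
    ∃ (f : StarE U Ω) (hf : IsModerate ρ f), RhoE.mk ρ f hf = q := by
  obtain ⟨f, rfl⟩ := Ideal.Quotient.mk_surjective (I := Negligible ρ Ω) q
  exact ⟨f.1, f.2, rfl⟩

theorem RhoE.mk_eq_mk {ρ : PosInfinitesimal U} {Ω : Opens (Vec d)} {f g : StarE U Ω}
    {hf : IsModerate ρ f} {hg : IsModerate ρ g} :
    RhoE.mk ρ f hf = RhoE.mk ρ g hg ↔ IsNegligible ρ (f - g) :=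
  Ideal.Quotient.eq (I := Negligible ρ Ω)

theorem RhoE.mk_add {ρ : PosInfinitesimal U} {Ω : Opens (Vec d)} {f g : StarE U Ω}
    (hf : IsModerate ρ f) (hg : IsModerate ρ g) :
    RhoE.mk ρ f hf + RhoE.mk ρ g hg = RhoE.mk ρ (f + g) (hf.add hg) := rfl

theorem RhoE.mk_mul {ρ : PosInfinitesimal U} {Ω : Opens (Vec d)} {f g : StarE U Ω}
    (hf : IsModerate ρ f) (hg : IsModerate ρ g) :
    RhoE.mk ρ f hf * RhoE.mk ρ g hg = RhoE.mk ρ (f * g) (hf.mul hg) := rfl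

theorem RhoE.smul_mk {ρ : PosInfinitesimal U} {Ω : Opens (Vec d)} (c : ℂ) {f : StarE U Ω}
    (hf : IsModerate ρ f) :
    c • RhoE.mk ρ f hf = RhoE.mk ρ (c • f) ((Moderate ρ Ω).smul_mem hf c) := rfl

/-- The partial derivative `∂_j` on `^ρE(Ω)`, induced by the partial derivative on `*E(Ω)`. -/
def RhoE.pderiv {ρ : PosInfinitesimal U} {Ω : Opens (Vec d)} (j : Fin d) :
    Module.End ℂ (RhoE ρ Ω) where
  toFun := Quotient.lift
    (fun f : Moderate ρ Ω => RhoE.mk ρ (starPderiv j f.1) (IsModerate.pderiv f.2 j))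
    fun f g hfg => by
      have h : IsNegligible ρ (f.1 - g.1) := (Submodule.quotientRel_def _).1 hfg
      refine RhoE.mk_eq_mk.2 ?_
      rw [← map_sub]
      exact h.pderiv j
  map_add' p q := by
    obtain ⟨f, hf, rfl⟩ := RhoE.mk_surjective p
    obtain ⟨g, hg, rfl⟩ := RhoE.mk_surjective q
    refine (RhoE.mk_eq_mk (g := starPderiv j f + starPderiv j g)
      (hg := (hf.pderiv j).add (hg.pderiv j))).2 ?_
    change IsNegligible ρ (starPderiv j (f + g) - _)
    rw [map_add, sub_self]
    exact (Negligible ρ Ω).zero_mem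
  map_smul' c p := by
    obtain ⟨f, hf, rfl⟩ := RhoE.mk_surjective p
    refine (RhoE.mk_eq_mk (g := c • starPderiv j f)
      (hg := (Moderate ρ Ω).smul_mem (hf.pderiv j) c)).2 ?_
    change IsNegligible ρ (starPderiv j (c • f) - _)
    rw [map_smul, sub_self]
    exact (Negligible ρ Ω).zero_mem

/-- The restriction `^ρE(Ω) → ^ρE(O)` for open sets `O ⊆ Ω`, induced by the restriction of
non-standard smooth functions. -/
def RhoE.restrict (ρ : PosInfinitesimal U) {O Ω : Opens (Vec d)} (h : O ≤ Ω) :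
    RhoE ρ Ω →ₐ[ℂ] RhoE ρ O :=
  Ideal.quotientMapₐ (I := Negligible ρ Ω) (Negligible ρ O)
    (((starRestrict U h).comp (Moderate ρ Ω).val).codRestrict (Moderate ρ O)
      fun f => IsModerate.restrict h f.2)
    fun _ hf => IsNegligible.restrict h hf

theorem RhoE.pderiv_mk {ρ : PosInfinitesimal U} {Ω : Opens (Vec d)} (j : Fin d)
    (f : StarE U Ω) (hf : IsModerate ρ f) :
    RhoE.pderiv j (RhoE.mk ρ f hf) = RhoE.mk ρ (starPderiv j f) (hf.pderiv j) := rfl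

theorem RhoE.restrict_mk {ρ : PosInfinitesimal U} {O Ω : Opens (Vec d)} (h : O ≤ Ω)
    (f : StarE U Ω) (hf : IsModerate ρ f) :
    RhoE.restrict ρ h (RhoE.mk ρ f hf) = RhoE.mk ρ (starRestrict U h f) (hf.restrict h) := rfl

theorem isModerate_standard (ρ : PosInfinitesimal U) {Ω : Opens (Vec d)} (f : Smooth Ω) :
    IsModerate ρ (StarE.standard U f) := by
  intro α
  have e : multiDeriv starPderiv α (StarE.standard U f) =
      StarE.standard U (multiDeriv Smooth.pderiv α f) := by
    induction α using multiIndex_induction with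
    | h0 => simp only [multiDeriv_zero, Module.End.one_apply]
    | hs α j ih =>
      rw [multiDeriv_add_single _ starPderiv_commute,
        multiDeriv_add_single _ Smooth.pderiv_commute, Module.End.mul_apply, ih]
      rfl
  rw [e]
  generalize multiDeriv Smooth.pderiv α f = g
  rintro x ⟨r, hr, hx⟩
  obtain ⟨n, hn⟩ := pow_unbounded_of_one_lt ‖extZero g.1 r‖ (one_lt_two (α := ℝ))
  have hc : ContinuousAt (fun y => ‖extZero g.1 y‖) r :=
    (Smooth.differentiableAt g hr).continuousAt.norm
  have hm := mem_starSet_of_infinitesimal hx (hc.preimage_mem_nhds (Iio_mem_nhds hn))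
  refine ⟨n, le_trans ?_ (pow_le_pow_left₀ zero_le_two ρ.two_le_inv n)⟩
  induction x using Germ.inductionOn with | _ x =>
  exact Filter.Eventually.mono hm fun i hi => le_of_lt hi

/-- The embedding `E(Ω) → ^ρE(Ω)` which maps `f` to the class of `*f`. -/
def RhoE.ofSmooth (ρ : PosInfinitesimal U) {Ω : Opens (Vec d)} : Smooth Ω →ₐ[ℂ] RhoE ρ Ω where
  toFun f := RhoE.mk ρ (StarE.standard U f) (isModerate_standard ρ f)
  map_one' := rfl
  map_mul' _ _ := rfl
  map_zero' := rfl
  map_add' _ _ := rfl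
  commutes' c := congrArg (Ideal.Quotient.mk (Negligible ρ Ω))
    (Subtype.ext (StarE.algebraMap_eq (U := U) c).symm)

/-! ### `ρ`-delta functions, `ρ`-cut-off functions and regularization -/

/-- `D ∈ *E(ℝ^d)` is a `ρ`-delta function: `D(x) = 0` for `‖x‖ ≥ ρ`, the integral of `D` over
`‖x‖ ≤ ρ` is `1` up to a `ρ`-negligible number, the moments of `D` of all orders `α ≠ 0` are
`ρ`-negligible numbers, and `D` is a `ρ`-moderate function. -/
structure IsRhoDelta (ρ : PosInfinitesimal U)
    (D : StarE U (⊤ : Opens (Vec d))) : Prop where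
  eq_zero : ∀ x : Star U (Vec d), ρ.1 ≤ starNorm x → eval D x = 0
  integral : Germ.map₂ (fun (f : Smooth (⊤ : Opens (Vec d))) (r : ℝ) =>
      ∫ x in Metric.closedBall (0 : Vec d) r, extZero f.1 x) D ρ.1 - 1 ∈ NegligibleNum ρ
  moment : ∀ α : Fin d → ℕ, α ≠ 0 → Germ.map₂ (fun (f : Smooth (⊤ : Opens (Vec d))) (r : ℝ) =>
      ∫ x in Metric.closedBall (0 : Vec d) r, extZero f.1 x * ∏ i, (x i : ℂ) ^ α i) D ρ.1
        ∈ NegligibleNum ρ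
  moderate : IsModerate ρ D

/-- `Π ∈ *D(Ω)` is a `ρ`-cut-off function for `Ω`: `Π(x) = 1` for all `x ∈ μ(Ω)`, and every point
of the (internal) support of `Π` has a distance of at least `ρ` to the boundary of `Ω`. -/
structure IsRhoCutoff (ρ : PosInfinitesimal U) {Ω : Opens (Vec d)}
    (P : Star U 𝓓(Ω, ℂ)) : Prop where
  eq_one : ∀ x ∈ monad U (Ω : Set (Vec d)),
    Germ.map₂ (fun (p : 𝓓(Ω, ℂ)) y => p y) P x = 1
  support : ∀ x : Star U (Vec d), Germ.LiftRel (fun (p : 𝓓(Ω, ℂ)) y => y ∈ tsupport p) P x →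
    ∀ y ∈ starSet U (frontier (Ω : Set (Vec d))), ρ.1 ≤ starNorm (x - y)

/-- The test function `ξ ↦ p(ξ) f(x - ξ)` on `Ω`. -/
def cutTranslate {Ω : Opens (Vec d)} (p : 𝓓(Ω, ℂ)) (f : Smooth (⊤ : Opens (Vec d)))
    (x : Vec d) : 𝓓(Ω, ℂ) where
  toFun ξ := p ξ * extZero f.1 (x - ξ)
  contDiff' := by
    have hf : ContDiff ℝ ∞ (extZero f.1) := by
      have h : ContDiffOn ℝ ∞ (extZero f.1) (⊤ : Opens (Vec d)) := f.2
      exact contDiffOn_univ.1 h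
    exact p.contDiff.mul (hf.comp (contDiff_const.sub contDiff_id))
  hasCompactSupport' := p.hasCompactSupport.mul_right
  tsupport_subset' := (tsupport_mul_subset_left).trans p.tsupport_subset

/-- `F ∈ *E(Ω)` is the convolution `(*T Π) ⋆ D`: for every `x ∈ *Ω`, the value `F(x)` is
`⟨*T, ξ ↦ Π(ξ) D(x - ξ)⟩`. Here `⟨*T, ⟨φ_i⟩⟩ = ⟨⟨T, φ_i⟩⟩`. -/
def IsConvolution {Ω : Opens (Vec d)} (T : Distr Ω) (P : Star U 𝓓(Ω, ℂ))
    (D : StarE U (⊤ : Opens (Vec d))) (F : StarE U Ω) : Prop :=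
  ∀ x ∈ starSet U (Ω : Set (Vec d)),
    eval F x = Germ.map T
      (Germ.map₂ (fun g y => g y) (Germ.map₂ (fun p f => cutTranslate p f) P D) x)

end NonStandard

end

end RhoAsymptotic

namespace RhoAsymptotic

noncomputable section

open MeasureTheory
open scoped BoundedContinuousFunction

/-! Represent ρ by radii `r` tending to 0 along `U` and construct everything radius by radius. A
mollifier of radius `r` with vanishing moments of orders 1, …, m is a linear combination of rescaled
copies of one bump, with the weights that extrapolate polynomials from the scales 1, 1/2, …, 1/(m+1)
to 0. If m = `order r` tends to infinity so slowly that the absolute weights sum to at most 1/r, the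
derivatives stay below powers of 1/r and every fixed moment is eventually exact. This gives the
ρ-delta function. By Taylor's formula, convolution with it reproduces smooth functions up to O(r^n)
for every n (`norm_integral_delta_mul_sub_le`).

On the test functions supported in one compact set, a distribution is a bounded functional of
finitely many derivatives (`exists_factor_jet`). In that Banach space it can be differentiated with
respect to parameters, exchanged with integrals and estimated. Hence the convolution (TΠ) ⋆ D is
smooth and its values are moderate.

Around a point of Ω the cut-off is eventually 1 on the relevant balls and so drops out of the
formulas: regularization commutes with ∂_j and with restriction, exactly and on neighbourhoods
independent of the index (`LocEq`). Derivatives of the regularization of T are therefore values of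
the regularizations of derivatives of T. Both moderateness and the comparison with *f thus need
estimates of values only, followed by induction on the multi-index.

For injectivity, a negligible net is uniformly small on compact sets
(`IsNegligible.eventually_norm_le`), while the regularizations converge weakly to T
(`exists_norm_integral_mul_regularize_sub_le`). So negligibility forces T = 0. The equivalence of
vanishing on an open subset is injectivity there combined with compatibility with restriction. -/

section

/-! ### Distributions on a compact set as functionals of finitely many derivatives -/

/-- A linear form bounded by the norm of a linear map `J` factors through `J`. -/
theorem exists_factor_of_norm_le {M B : Type*} [AddCommGroup M] [Module ℂ M]
    [NormedAddCommGroup B] [NormedSpace ℂ B] (J : M →ₗ[ℂ] B) (t : M →ₗ[ℂ] ℂ) (C : ℝ)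
    (hb : ∀ φ, ‖t φ‖ ≤ C * ‖J φ‖) : ∃ L : B →L[ℂ] ℂ, ∀ φ, t φ = L (J φ) := by
  have hker : LinearMap.ker J ≤ LinearMap.ker t := by
    intro φ hφ
    have h := hb φ
    have h0 : ‖J φ‖ = 0 := by rw [LinearMap.mem_ker.1 hφ, norm_zero]
    rw [h0, mul_zero] at h
    exact norm_le_zero_iff.1 h
  -- Since `J φ = 0` forces `t φ = 0`, the form `t` descends to the range of `J`. It is bounded
  -- there by `C`, and Hahn–Banach extends it to `B`.
  let f₀ : LinearMap.range J →ₗ[ℂ] ℂ :=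
    ((LinearMap.ker J).liftQ t hker) ∘ₗ J.quotKerEquivRange.symm.toLinearMap
  have hf₀ : ∀ φ, f₀ ⟨J φ, φ, rfl⟩ = t φ := by
    intro φ
    have : J.quotKerEquivRange.symm ⟨J φ, φ, rfl⟩ = (LinearMap.ker J).mkQ φ := by
      rw [LinearEquiv.symm_apply_eq]
      rfl
    simp only [f₀, LinearMap.comp_apply, LinearEquiv.coe_coe, this]
    rfl
  let f : LinearMap.range J →L[ℂ] ℂ := f₀.mkContinuous C (by
    rintro ⟨_, φ, rfl⟩
    rw [hf₀]
    exact hb φ)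
  obtain ⟨L, hL, -⟩ := exists_extension_norm_eq (LinearMap.range J) f
  exact ⟨L, fun φ => ((hL ⟨J φ, φ, rfl⟩).trans (hf₀ φ)).symm⟩

/-- The bounded continuous functions with values in the `k`-linear forms on `E`. -/
def JetSpace (E : Type*) [NormedAddCommGroup E] [NormedSpace ℝ E] (k : ℕ) :=
  E →ᵇ (E [×k]→L[ℝ] ℂ)

section Jet

open ContDiffMapSupportedIn

variable {E : Type*} [NormedAddCommGroup E] [NormedSpace ℝ E] {k : ℕ}

instance : NormedAddCommGroup (JetSpace E k) :=
  inferInstanceAs (NormedAddCommGroup (E →ᵇ (E [×k]→L[ℝ] ℂ)))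

instance : NormedSpace ℂ (JetSpace E k) :=
  inferInstanceAs (NormedSpace ℂ (E →ᵇ (E [×k]→L[ℝ] ℂ)))

instance : CompleteSpace (JetSpace E k) :=
  inferInstanceAs (CompleteSpace (E →ᵇ (E [×k]→L[ℝ] ℂ)))

/-- The `k`-th derivative of a test function. -/
def jet (K : Compacts E) (k : ℕ) : 𝓓_{K}(E, ℂ) →ₗ[ℂ] JetSpace E k where
  toFun φ := structureMapLM ℂ ⊤ k φ
  map_add' φ ψ := map_add (structureMapLM ℂ ⊤ k) φ ψ
  map_smul' c φ := map_smul (structureMapLM ℂ ⊤ k) c φ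

/-- The value of an element of the jet space at a point. -/
def JetSpace.eval (k : ℕ) (ξ : E) : JetSpace E k →L[ℝ] (E [×k]→L[ℝ] ℂ) :=
  LinearMap.mkContinuous
    { toFun := fun f => (show E →ᵇ (E [×k]→L[ℝ] ℂ) from f) ξ
      map_add' := fun _ _ => rfl
      map_smul' := fun _ _ => rfl } 1
    fun f => (BoundedContinuousFunction.norm_coe_le_norm (show E →ᵇ (E [×k]→L[ℝ] ℂ) from f)
      ξ).trans (one_mul ‖f‖).ge

theorem JetSpace.ext {f g : JetSpace E k} (h : ∀ ξ, eval k ξ f = eval k ξ g) : f = g :=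
  BoundedContinuousFunction.ext h

theorem JetSpace.norm_le {f : JetSpace E k} {C : ℝ} (hC : 0 ≤ C) (h : ∀ ξ, ‖eval k ξ f‖ ≤ C) :
    ‖f‖ ≤ C :=
  (BoundedContinuousFunction.norm_le hC).2 h

theorem eval_jet (K : Compacts E) (φ : 𝓓_{K}(E, ℂ)) (ξ : E) :
    JetSpace.eval k ξ (jet K k φ) = iteratedFDeriv ℝ k φ ξ :=
  congrFun (structureMapLM_top_apply ℂ φ) ξ

/-- On the test functions with support in a compact set, a distribution factors through finitely
many derivatives. -/
theorem exists_factor_jet {Ω : Opens E} (T : 𝓓(Ω, ℂ) →L[ℂ] ℂ) (K : Compacts E)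
    (hK : (K : Set E) ⊆ Ω) :
    ∃ (s : Finset ℕ) (L : ((k : s) → JetSpace E k) →L[ℂ] ℂ), ∀ φ : 𝓓_{K}(E, ℂ),
      T (TestFunction.ofSupportedIn hK φ) = L fun k => jet K k φ := by
  let T' : 𝓓_{K}(E, ℂ) →L[ℂ] ℂ := T ∘L TestFunction.ofSupportedInCLM ℂ hK
  let q : Seminorm ℂ 𝓓_{K}(E, ℂ) := (normSeminorm ℂ ℂ).comp T'.toLinearMap
  have hq : Continuous q := T'.continuous.norm
  -- The topology of `𝓓_{K}` is generated by the sup norms of the derivatives, so finitely many of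
  -- them dominate the continuous seminorm `|T|`.
  obtain ⟨s, C, -, hC⟩ := Seminorm.bound_of_continuous
    (ContDiffMapSupportedIn.withSeminorms ℂ E ℂ ⊤ K) q hq
  let J : 𝓓_{K}(E, ℂ) →ₗ[ℂ] ((k : s) → JetSpace E k) := LinearMap.pi fun k => jet K k
  obtain ⟨L, hL⟩ := exists_factor_of_norm_le J T'.toLinearMap C (by
    intro φ
    have h : s.sup (ContDiffMapSupportedIn.seminorm ℂ E ℂ ⊤ K) φ ≤ ‖J φ‖ :=
      Seminorm.finset_sup_apply_le (norm_nonneg (J φ)) fun k hk => norm_le_pi_norm (J φ) ⟨k, hk⟩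
    exact (hC φ).trans (mul_le_mul_of_nonneg_left h C.2))
  exact ⟨s, L, hL⟩

end Jet

/-! ### Integrals depending smoothly on a parameter -/

section Parametric

universe u

variable {X : Type*} {E V : Type u} [NormedAddCommGroup X] [NormedSpace ℝ X] [NormedAddCommGroup E]
  [NormedSpace ℝ E] [NormedAddCommGroup V] [NormedSpace ℝ V]

theorem contDiff_iteratedFDeriv_param {u : X → E → V} (hu : ContDiff ℝ ∞ (Function.uncurry u))
    (k : ℕ) : ContDiff ℝ ∞ fun z : X × E => iteratedFDeriv ℝ k (u z.1) z.2 := by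
  induction k with
  | zero =>
    simp only [iteratedFDeriv_zero_eq_comp]
    exact (LinearIsometryEquiv.contDiff (continuousMultilinearCurryFin0 ℝ E V).symm).comp hu
  | succ k ih =>
    simp only [iteratedFDeriv_succ_eq_comp_left]
    have h : ContDiff ℝ ∞ fun z : X × E => fderiv ℝ (iteratedFDeriv ℝ k (u z.1)) z.2 :=
      ContDiff.fderiv (f := fun (z : X × E) y => iteratedFDeriv ℝ k (u z.1) y) (m := ∞)
        (ih.comp ((contDiff_fst.comp contDiff_fst).prodMk contDiff_snd)) contDiff_snd (by simp)
    exact h.continuousLinearMap_comp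
      ((continuousMultilinearCurryLeftEquiv ℝ (fun _ : Fin (k + 1) => E) V).symm :
        _ →L[ℝ] E [×(k + 1)]→L[ℝ] V)

variable [MeasurableSpace X] [OpensMeasurableSpace X] [SecondCountableTopology X]
  [FiniteDimensional ℝ E] {μ : MeasureTheory.Measure X} [MeasureTheory.IsLocallyFiniteMeasure μ]


theorem hasFDerivAt_setIntegral_of_contDiff {u : X → E → V}
    (hu : ContDiff ℝ ∞ (Function.uncurry u)) {L : Set X} (hL : IsCompact L) (ξ : E) :
    HasFDerivAt (fun ξ => ∫ x in L, u x ξ ∂μ) (∫ x in L, fderiv ℝ (u x) ξ ∂μ) ξ := by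
  have hc : Continuous fun z : X × E => fderiv ℝ (u z.1) z.2 :=
    (ContDiff.fderiv (f := fun (z : X × E) y => u z.1 y) (m := ∞) (n := 0)
      (hu.comp ((contDiff_fst.comp contDiff_fst).prodMk contDiff_snd)) contDiff_snd
      (by simp)).continuous
  have huc : Continuous fun z : X × E => u z.1 z.2 := hu.continuous
  have : ProperSpace E := FiniteDimensional.proper ℝ E
  -- Compactness of `L` times the closed unit ball around `ξ` gives a constant dominating the
  -- derivative. Constants are integrable over `L`.
  obtain ⟨M, hM⟩ := (hL.prod (isCompact_closedBall ξ 1)).bddAbove_image hc.norm.continuousOn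
  refine hasFDerivAt_integral_of_dominated_of_fderiv_le (bound := fun _ => M)
    (F' := fun ξ x => fderiv ℝ (u x) ξ) (Metric.closedBall_mem_nhds ξ one_pos) ?_ ?_ ?_ ?_ ?_ ?_
  · exact .of_forall fun ξ => Continuous.aestronglyMeasurable (by fun_prop)
  · exact ContinuousOn.integrableOn_compact' hL hL.isClosed.measurableSet
      (Continuous.continuousOn (by fun_prop))
  · exact (hc.comp (Continuous.prodMk_left ξ)).aestronglyMeasurable
  · refine (ae_restrict_iff' hL.isClosed.measurableSet).2 (.of_forall fun x hx ξ hξ => ?_)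
    exact hM (Set.mem_image_of_mem _ (Set.mk_mem_prod hx hξ))
  · exact integrableOn_const hL.measure_ne_top
  · refine .of_forall fun x y _ => DifferentiableAt.hasFDerivAt ?_
    have : ContDiff ℝ ∞ (u x) := hu.comp (contDiff_prodMk_right x)
    exact (this.differentiable (by simp)).differentiableAt

/-- The derivative is an integral of the same kind with values in `E →L[ℝ] V`. The induction
therefore varies `V`, which is why `E` and `V` share a universe. -/
theorem contDiff_setIntegral {u : X → E → V} (hu : ContDiff ℝ ∞ (Function.uncurry u))
    {L : Set X} (hL : IsCompact L) : ContDiff ℝ ∞ fun ξ => ∫ x in L, u x ξ ∂μ := by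
  refine contDiff_infty.2 fun n => ?_
  induction n generalizing V with
  | zero =>
    exact contDiff_zero.2 (continuous_iff_continuousAt.2 fun ξ =>
      (hasFDerivAt_setIntegral_of_contDiff hu hL ξ).continuousAt)
  | succ n ih =>
    refine contDiff_succ_iff_hasFDerivAt.2 ⟨_, ?_, hasFDerivAt_setIntegral_of_contDiff hu hL⟩
    exact ih (u := fun x => fderiv ℝ (u x)) (ContDiff.fderiv (f := fun (z : X × E) y => u z.1 y)
      (m := ∞) (hu.comp ((contDiff_fst.comp contDiff_fst).prodMk contDiff_snd)) contDiff_snd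
      (by simp))

theorem iteratedFDeriv_setIntegral [CompleteSpace V] {u : X → E → V} (hu : ContDiff ℝ ∞ (Function.uncurry u))
    {L : Set X} (hL : IsCompact L) (k : ℕ) (ξ : E) :
    iteratedFDeriv ℝ k (fun ξ => ∫ x in L, u x ξ ∂μ) ξ =
      ∫ x in L, iteratedFDeriv ℝ k (u x) ξ ∂μ := by
  induction k generalizing ξ with
  | zero =>
    simp only [iteratedFDeriv_zero_eq_comp, Function.comp_apply]
    exact (LinearIsometry.integral_comp_comm
      (continuousMultilinearCurryFin0 ℝ E V).symm.toLinearIsometry _).symm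
  | succ k ih =>
    simp only [iteratedFDeriv_succ_eq_comp_left, Function.comp_apply]
    rw [funext ih, (hasFDerivAt_setIntegral_of_contDiff
      (contDiff_iteratedFDeriv_param hu k) hL ξ).fderiv]
    exact (ContinuousLinearEquiv.integral_comp_comm (𝕜 := ℝ) (μ := μ.restrict L)
      (E := E →L[ℝ] E [×k]→L[ℝ] V) (F := E [×(k + 1)]→L[ℝ] V)
      ((continuousMultilinearCurryLeftEquiv ℝ (fun _ : Fin (k + 1) => E) V).symm :
        _ ≃L[ℝ] E [×(k + 1)]→L[ℝ] V) fun x => fderiv ℝ (iteratedFDeriv ℝ k (u x)) ξ).symm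

end Parametric

end

/-! ### Distributions applied to smooth families of test functions -/

section

open MeasureTheory ContDiffMapSupportedIn

section Support

variable {E V : Type*} [TopologicalSpace E] [Zero V]

theorem tsupport_subset_of_forall_eq_zero {f : E → V} {K : Set E}
    (hK : IsClosed K) (h : ∀ ξ ∉ K, f ξ = 0) : tsupport f ⊆ K :=
  closure_minimal (fun ξ hξ => by_contra fun hn => hξ (h ξ hn)) hK

theorem eq_zero_of_tsupport_subset {f : E → V} {K : Set E}
    (h : tsupport f ⊆ K) {ξ : E} (hξ : ξ ∉ K) : f ξ = 0 :=
  image_eq_zero_of_notMem_tsupport fun hm => hξ (h hm)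

end Support

/-- Joint continuity and compactness of `K` give closeness uniformly on `K` (tube lemma), and off
`K` all the functions vanish. This upgrades pointwise to norm continuity. -/
theorem continuous_boundedContinuousFunction {X E V : Type*} [TopologicalSpace X]
    [TopologicalSpace E] [NormedAddCommGroup V] {v : X → E →ᵇ V}
    (hv : Continuous fun z : X × E => v z.1 z.2) {K : Set E} (hK : IsCompact K) (hs : ∀ x, ∀ ξ ∉ K, v x ξ = 0) : Continuous v := by
  refine continuous_iff_continuousAt.2 fun x₀ => Metric.tendsto_nhds.2 fun ε hε => ?_
  have h : ∀ᶠ x in nhds x₀, ∀ ξ ∈ K, dist (v x ξ) (v x₀ ξ) < ε / 2 := by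
    refine hK.eventually_forall_of_forall_eventually fun ξ _ => ?_
    have hc : Continuous fun z : X × E => dist (v z.1 z.2) (v x₀ z.2) :=
      hv.dist ((v x₀).continuous.comp continuous_snd)
    refine hc.continuousAt.eventually_lt continuousAt_const ?_
    simpa using half_pos hε
  filter_upwards [h] with x hx
  refine lt_of_le_of_lt ((BoundedContinuousFunction.dist_le (half_pos hε).le).2 fun ξ => ?_)
    (half_lt_self hε)
  by_cases hξ : ξ ∈ K
  · exact (hx ξ hξ).le
  · rw [hs x ξ hξ, hs x₀ ξ hξ, dist_self]
    exact (half_pos hε).le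


section Family

variable {X : Type*} {E : Type} [NormedAddCommGroup X] [NormedSpace ℝ X]
  [NormedAddCommGroup E] [NormedSpace ℝ E]

variable {Ω : Opens E}

/-- A test function with support in `K` as an element of `𝓓_{K}`. -/
def toSupportedIn (K : Compacts E) (φ : 𝓓(Ω, ℂ)) (h : tsupport φ ⊆ K) : 𝓓_{K}(E, ℂ) :=
  .of_support_subset φ.contDiff ((subset_tsupport φ).trans h)

theorem continuous_jet_family {u : X → 𝓓(Ω, ℂ)}
    (hu : ContDiff ℝ ∞ fun z : X × E => u z.1 z.2) {K : Compacts E}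
    (hs : ∀ x, tsupport (u x) ⊆ K) (k : ℕ) :
    Continuous fun x => jet K k (toSupportedIn K (u x) (hs x)) := by
  refine continuous_boundedContinuousFunction (E := E) (V := E [×k]→L[ℝ] ℂ) (K := K) ?_
    K.isCompact fun x ξ hξ => ?_
  · refine (contDiff_iteratedFDeriv_param (u := fun (x : X) (ξ : E) => u x ξ) hu
      k).continuous.congr fun z => ?_
    exact (eval_jet K (toSupportedIn K (u z.1) (hs z.1)) z.2).symm
  · exact (eval_jet K _ _).trans (ContDiffMapSupportedIn.iteratedFDeriv_zero_on_compl _ hξ)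

theorem continuous_distribution_family (T : 𝓓(Ω, ℂ) →L[ℂ] ℂ) {u : X → 𝓓(Ω, ℂ)}
    (hu : ContDiff ℝ ∞ fun z : X × E => u z.1 z.2) {K : Compacts E} (hK : (K : Set E) ⊆ Ω)
    (hs : ∀ x, tsupport (u x) ⊆ K) : Continuous fun x => T (u x) := by
  obtain ⟨s, L, hL⟩ := exists_factor_jet T K hK
  have e : (fun x => T (u x)) = fun x => L fun k : s => jet K k (toSupportedIn K (u x) (hs x)) :=
    funext fun x => hL (toSupportedIn K (u x) (hs x))
  rw [e]
  exact L.continuous.comp (continuous_pi fun k => continuous_jet_family hu hs k)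

/-- `N` is the highest order among the finitely many derivatives through which `T` factors on `K`,
and `C` is the norm of the factoring functional. -/
theorem exists_distribution_bound (T : 𝓓(Ω, ℂ) →L[ℂ] ℂ) {K : Compacts E}
    (hK : (K : Set E) ⊆ Ω) : ∃ (N : ℕ) (C : ℝ), 0 ≤ C ∧ ∀ φ : 𝓓(Ω, ℂ), tsupport φ ⊆ K →
      ∀ M : ℝ, 0 ≤ M → (∀ k ≤ N, ∀ ξ, ‖iteratedFDeriv ℝ k φ ξ‖ ≤ M) → ‖T φ‖ ≤ C * M := by
  obtain ⟨s, L, hL⟩ := exists_factor_jet T K hK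
  refine ⟨s.sup id, ‖L‖, norm_nonneg L, fun φ hφ M hM h => ?_⟩
  have e : T φ = L fun k : s => jet K k (toSupportedIn K φ hφ) := hL (toSupportedIn K φ hφ)
  rw [e]
  refine (L.le_opNorm _).trans ?_
  gcongr
  refine (pi_norm_le_iff_of_nonneg hM).2 fun k => JetSpace.norm_le hM fun ξ => ?_
  rw [eval_jet]
  exact h k (Finset.le_sup (f := id) k.2) ξ

/-- A distribution commutes with the integral of a smooth family of test functions. -/
theorem distribution_setIntegral [MeasurableSpace X] [OpensMeasurableSpace X]
    [SecondCountableTopology X] [FiniteDimensional ℝ E] {μ : Measure X}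
    [IsLocallyFiniteMeasure μ] (T : 𝓓(Ω, ℂ) →L[ℂ] ℂ) {u : X → 𝓓(Ω, ℂ)}
    (hu : ContDiff ℝ ∞ fun z : X × E => u z.1 z.2) {K : Compacts E} (hK : (K : Set E) ⊆ Ω)
    (hs : ∀ x, tsupport (u x) ⊆ K) {L : Set X} (hL : IsCompact L) {w : 𝓓(Ω, ℂ)}
    (hw : ∀ ξ, w ξ = ∫ x in L, u x ξ ∂μ) : T w = ∫ x in L, T (u x) ∂μ := by
  have hws : tsupport w ⊆ K := by
    refine tsupport_subset_of_forall_eq_zero K.isCompact.isClosed fun ξ hξ => ?_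
    rw [hw]
    simp [eq_zero_of_tsupport_subset (hs _) hξ]
  obtain ⟨s, Λ, hΛ⟩ := exists_factor_jet T K hK
  let J : X → (k : s) → JetSpace E k := fun x k => jet K k (toSupportedIn K (u x) (hs x))
  have hJ : Continuous J := continuous_pi fun k => continuous_jet_family hu hs k
  have hJi : Integrable J (μ.restrict L) :=
    ContinuousOn.integrableOn_compact' hL hL.isClosed.measurableSet hJ.continuousOn
  have e : ∀ x, T (u x) = Λ (J x) := fun x => hΛ (toSupportedIn K (u x) (hs x))
  have ew : T w = Λ fun k => jet K k (toSupportedIn K w hws) := hΛ (toSupportedIn K w hws)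
  simp_rw [e]
  -- `Λ` passes through the Bochner integral, so the jets of `w` have to be identified with the
  -- integral of the jets. This is tested by evaluation at each point, where it becomes
  -- differentiation under the integral sign.
  rw [ew, Λ.integral_comp_comm hJi]
  congr 1
  ext1 k
  refine JetSpace.ext fun ξ => ?_
  have h1 : JetSpace.eval k.1 ξ ((∫ x in L, J x ∂μ) k) =
      ∫ x in L, JetSpace.eval k.1 ξ (J x k) ∂μ := by
    let ev : ((k : s) → JetSpace E k) →L[ℝ] (E [×k.1]→L[ℝ] ℂ) :=
      (JetSpace.eval k.1 ξ).comp (ContinuousLinearMap.proj k)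
    exact (ContinuousLinearMap.integral_comp_comm ev hJi).symm
  rw [h1, eval_jet]
  have h2 : ⇑(toSupportedIn K w hws) = fun ξ => ∫ x in L, u x ξ ∂μ := funext hw
  rw [h2, iteratedFDeriv_setIntegral (u := fun x ξ => u x ξ) hu hL]
  simp only [J, eval_jet]
  rfl

/-- The derivative of a smooth family of test functions in a direction of the parameter space. -/
def paramDeriv {u : X → 𝓓(Ω, ℂ)} (hu : ContDiff ℝ ∞ fun z : X × E => u z.1 z.2)
    {K : Compacts E} (hK : (K : Set E) ⊆ Ω) (hs : ∀ x, tsupport (u x) ⊆ K) (h x : X) :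
    𝓓(Ω, ℂ) :=
  have hts : tsupport (fun ξ => fderiv ℝ (fun y => u y ξ) x h) ⊆ K :=
    tsupport_subset_of_forall_eq_zero K.isCompact.isClosed fun ξ hξ => by
      simp [eq_zero_of_tsupport_subset (hs _) hξ]
  { toFun := fun ξ => fderiv ℝ (fun y => u y ξ) x h
    contDiff' := (ContDiff.fderiv (f := fun ξ y => u y ξ) (m := ∞)
      (hu.comp (contDiff_snd.prodMk contDiff_fst)) contDiff_const (by simp)).clm_apply
        contDiff_const
    hasCompactSupport' := K.isCompact.of_isClosed_subset (isClosed_tsupport _) hts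
    tsupport_subset' := hts.trans hK }

section

variable {u : X → 𝓓(Ω, ℂ)} (hu : ContDiff ℝ ∞ fun z : X × E => u z.1 z.2)
    {K : Compacts E} (hK : (K : Set E) ⊆ Ω) (hs : ∀ x, tsupport (u x) ⊆ K)

theorem paramDeriv_apply (h x : X) (ξ : E) :
    paramDeriv hu hK hs h x ξ = fderiv ℝ (fun y => u y ξ) x h := rfl

theorem tsupport_paramDeriv (h x : X) : tsupport (paramDeriv hu hK hs h x) ⊆ K :=
  tsupport_subset_of_forall_eq_zero K.isCompact.isClosed fun ξ hξ => by
    simp [paramDeriv_apply, eq_zero_of_tsupport_subset (hs _) hξ]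

theorem contDiff_paramDeriv (h : X) :
    ContDiff ℝ ∞ fun z : X × E => paramDeriv hu hK hs h z.1 z.2 :=
  (ContDiff.fderiv (f := fun (z : X × E) y => u y z.2) (m := ∞)
    (hu.comp (contDiff_snd.prodMk (contDiff_snd.comp contDiff_fst))) contDiff_fst
      (by simp)).clm_apply contDiff_const

/-- The fundamental theorem of calculus along the segment from `x` to `y`, at each fixed `ξ`,
followed by moving `T` under the integral over `t`. -/
theorem distribution_sub_eq_integral [FiniteDimensional ℝ E] (T : 𝓓(Ω, ℂ) →L[ℂ] ℂ) (x y : X) :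
    T (u y) - T (u x) =
      ∫ t in Set.Icc (0 : ℝ) 1, T (paramDeriv hu hK hs (y - x) (x + t • (y - x))) := by
  rw [← map_sub]
  refine distribution_setIntegral (X := ℝ) T (u := fun t => paramDeriv hu hK hs (y - x)
    (x + t • (y - x))) ?_ hK (fun t => tsupport_paramDeriv hu hK hs _ _) isCompact_Icc ?_
  · exact (contDiff_paramDeriv hu hK hs (y - x)).comp
      ((contDiff_const.add (contDiff_fst.smul contDiff_const)).prodMk contDiff_snd)
  · intro ξ
    have hd : ContDiff ℝ ∞ fun y => u y ξ := hu.comp (contDiff_prodMk_left ξ)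
    rw [integral_Icc_eq_integral_Ioc, ← intervalIntegral.integral_of_le zero_le_one]
    rw [intervalIntegral.integral_eq_sub_of_hasDerivAt (f := fun t : ℝ => u (x + t • (y - x)) ξ)]
    · simp
    · intro t _
      have h1 : HasDerivAt (fun t : ℝ => x + t • (y - x)) (y - x) t := by
        simpa using ((hasDerivAt_id t).smul_const (y - x)).const_add x
      exact ((hd.differentiable (by simp)).differentiableAt.hasFDerivAt).comp_hasDerivAt t h1
    · refine Continuous.intervalIntegrable ?_ _ _
      exact ((contDiff_paramDeriv hu hK hs (y - x)).continuous).comp (f := fun t : ℝ =>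
        (x + t • (y - x), ξ)) (by fun_prop)

variable [FiniteDimensional ℝ X]

/-- The candidate for the derivative of `x ↦ T (u x)`. -/
def distributionParamDeriv (T : 𝓓(Ω, ℂ) →L[ℂ] ℂ) (x : X) : X →L[ℝ] ℂ :=
  LinearMap.toContinuousLinearMap
    { toFun := fun h => T (paramDeriv hu hK hs h x)
      map_add' := fun h h' => by
        rw [← map_add]
        congr 1
        ext ξ
        simp [paramDeriv_apply]
      map_smul' := fun c h => by
        have e : paramDeriv hu hK hs (c • h) x = (c : ℂ) • paramDeriv hu hK hs h x := by
          ext ξ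
          simp [paramDeriv_apply]
        rw [e, map_smul]
        simp }

theorem distributionParamDeriv_apply (T : 𝓓(Ω, ℂ) →L[ℂ] ℂ) (x h : X) :
    distributionParamDeriv hu hK hs T x h = T (paramDeriv hu hK hs h x) := rfl

variable [FiniteDimensional ℝ E]

/-- The candidate is continuous in `x`: as `X` is finite-dimensional, this can be checked direction
by direction. The integral form of the mean value theorem then makes the remainder at most `ε‖y -
x‖` near `x`. -/
theorem hasFDerivAt_distribution (T : 𝓓(Ω, ℂ) →L[ℂ] ℂ) (x : X) :
    HasFDerivAt (fun x => T (u x)) (distributionParamDeriv hu hK hs T x) x := by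
  have hc : Continuous (distributionParamDeriv hu hK hs T) := by
    refine continuous_clm_apply.2 fun h => ?_
    exact continuous_distribution_family T (contDiff_paramDeriv hu hK hs h) hK
      fun x => tsupport_paramDeriv hu hK hs h x
  refine HasFDerivAt.of_isLittleO (Asymptotics.isLittleO_iff.2 fun ε hε => ?_)
  obtain ⟨δ, hδ, hb⟩ := Metric.continuousAt_iff.1 (hc.continuousAt (x := x)) ε hε
  filter_upwards [Metric.ball_mem_nhds x hδ] with y hy
  have hcy : Continuous fun t : ℝ => T (paramDeriv hu hK hs (y - x) (x + t • (y - x))) :=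
    (hc.comp (f := fun t : ℝ => x + t • (y - x)) (by fun_prop)).clm_apply continuous_const
  have h1 : T (u y) - T (u x) - distributionParamDeriv hu hK hs T x (y - x) =
      ∫ t in Set.Icc (0 : ℝ) 1, (T (paramDeriv hu hK hs (y - x) (x + t • (y - x))) -
        distributionParamDeriv hu hK hs T x (y - x)) := by
    rw [integral_sub (hcy.integrableOn_Icc) (by simp), distribution_sub_eq_integral hu hK hs]
    simp
  rw [h1]
  refine (norm_setIntegral_le_of_norm_le_const (C := ε * ‖y - x‖) (by simp)
    fun t ht => ?_).trans (by simp)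
  rw [← distributionParamDeriv_apply, ← sub_apply]
  refine (ContinuousLinearMap.le_opNorm _ _).trans ?_
  gcongr
  rw [← dist_eq_norm]
  refine (hb ?_).le
  rw [dist_eq_norm, add_sub_cancel_left, norm_smul, Real.norm_of_nonneg ht.1]
  refine lt_of_le_of_lt (mul_le_of_le_one_left (norm_nonneg _) ht.2) ?_
  rwa [← dist_eq_norm]

/-- In each fixed direction the derivative is again `T` applied to a smooth family supported in the
same `K`, so the induction runs over families. -/
theorem contDiff_distribution_family {u : X → 𝓓(Ω, ℂ)}
    (hu : ContDiff ℝ ∞ fun z : X × E => u z.1 z.2) {K : Compacts E} (hK : (K : Set E) ⊆ Ω)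
    (hs : ∀ x, tsupport (u x) ⊆ K) (T : 𝓓(Ω, ℂ) →L[ℂ] ℂ) : ContDiff ℝ ∞ fun x => T (u x) := by
  refine contDiff_infty.2 fun n => ?_
  induction n generalizing u with
  | zero => exact contDiff_zero.2 (continuous_distribution_family T hu hK hs)
  | succ n ih =>
    refine contDiff_succ_iff_hasFDerivAt.2 ⟨_, ?_, hasFDerivAt_distribution hu hK hs T⟩
    refine contDiff_clm_apply_iff.2 fun h => ?_
    exact ih (contDiff_paramDeriv hu hK hs h) fun x => tsupport_paramDeriv hu hK hs h x

end

end Family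

end

section

/-! ### Mollifiers with vanishing moments -/

/-- The scales `1, 1/2, 1/3, …`. -/
def scale (k : ℕ) : ℝ := 1 / ((k : ℝ) + 1)

theorem scale_pos (k : ℕ) : 0 < scale k := Nat.one_div_pos_of_nat

theorem scale_le_one (k : ℕ) : scale k ≤ 1 :=
  (div_le_one (by positivity)).2 (by simp)

theorem scale_injective : Function.Injective scale := by
  intro i j h
  have hij : (i : ℝ) + 1 = j + 1 := by
    simpa [scale] using h
  exact_mod_cast add_right_cancel hij

/-- The weights of the extrapolation to `0` from the values at the first `m + 1` scales. -/
def weight (m k : ℕ) : ℝ :=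
  (Lagrange.basis (Finset.range (m + 1)) scale k).eval 0

/-- Interpolation at `m + 1` nodes reproduces `X ^ j` for `j ≤ m`, and the identity is read at 0. -/
theorem sum_weight_mul_pow {m j : ℕ} (hj : j ≤ m) :
    ∑ k ∈ Finset.range (m + 1), weight m k * scale k ^ j = 0 ^ j := by
  have h := congrArg (Polynomial.eval 0) (Lagrange.eq_interpolate (s := Finset.range (m + 1))
    (v := scale) (f := (Polynomial.X ^ j : Polynomial ℝ)) scale_injective.injOn (by
      rw [Polynomial.degree_X_pow, Finset.card_range]
      exact_mod_cast Nat.lt_succ_of_le hj))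
  simp only [Polynomial.eval_pow, Polynomial.eval_X, Lagrange.interpolate_apply,
    Polynomial.eval_finsetSum, Polynomial.eval_mul, Polynomial.eval_C] at h
  rw [h]
  exact Finset.sum_congr rfl fun k _ => mul_comm _ _

/-- The sum of the absolute values of the weights. -/
def weightNorm (m : ℕ) : ℝ := ∑ k ∈ Finset.range (m + 1), |weight m k|

theorem weightNorm_nonneg (m : ℕ) : 0 ≤ weightNorm m :=
  Finset.sum_nonneg fun _ _ => abs_nonneg _

theorem weightNorm_zero : weightNorm 0 = 1 := by
  simp [weightNorm, weight]

/-- The weights send the Taylor polynomial of degree `n ≤ m` at 0 exactly to its constant term `h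
0`. Each remainder is at most `B`, because the scales are at most 1 and `n! ≥ 1`. Keeping `n`
separate from `m` matters later: `m` grows as the radius shrinks while `n` stays fixed. -/
theorem norm_sum_weight_sub_le {h : ℝ → ℂ} (hh : ContDiff ℝ ∞ h) {m n : ℕ} (hn : n ≤ m) {B : ℝ}
    (hB : ∀ t ∈ Set.Icc (0 : ℝ) 1, ‖iteratedDeriv (n + 1) h t‖ ≤ B) :
    ‖∑ k ∈ Finset.range (m + 1), (weight m k : ℂ) * h (scale k) - h 0‖ ≤ weightNorm m * B := by
  have hB0 : 0 ≤ B := (norm_nonneg _).trans (hB 0 (by simp))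
  let P : ℝ → ℂ := fun t => taylorWithinEval h n (Set.Icc 0 1) 0 t
  have hP : ∑ k ∈ Finset.range (m + 1), (weight m k : ℂ) * P (scale k) = h 0 := by
    simp only [P, taylor_within_apply, Finset.mul_sum]
    rw [Finset.sum_comm]
    have h1 : ∀ j ∈ Finset.range (n + 1), ∑ k ∈ Finset.range (m + 1), (weight m k : ℂ) *
        (((j.factorial : ℝ)⁻¹ * (scale k - 0) ^ j) • iteratedDerivWithin j h (Set.Icc 0 1) 0) =
        ((0 ^ j * (j.factorial : ℝ)⁻¹ : ℝ) : ℂ) * iteratedDerivWithin j h (Set.Icc 0 1) 0 := by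
      intro j hj
      rw [← sum_weight_mul_pow (m := m) (by simp at hj; omega)]
      push_cast
      rw [Finset.sum_mul, Finset.sum_mul]
      refine Finset.sum_congr rfl fun k _ => ?_
      rw [Complex.real_smul]
      push_cast
      ring
    rw [Finset.sum_congr rfl h1, Finset.sum_range_succ']
    simp
  have hk : ∀ k, ‖h (scale k) - P (scale k)‖ ≤ B := by
    intro k
    refine (taylor_mean_remainder_bound zero_le_one (hh.contDiffOn.of_le (by norm_cast; simp))
      ⟨(scale_pos k).le, scale_le_one k⟩ (C := B) fun t ht => ?_).trans ?_
    · rw [iteratedDerivWithin_eq_iteratedDeriv (uniqueDiffOn_Icc zero_lt_one)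
        (hh.contDiffAt.of_le (by norm_cast; simp)) ht]
      exact hB t ht
    · rw [sub_zero]
      refine div_le_of_le_mul₀ (by positivity) hB0 ?_
      refine mul_le_mul_of_nonneg_left ((pow_le_one₀ (scale_pos k).le (scale_le_one k)).trans ?_) hB0
      exact_mod_cast n.factorial_pos
  rw [← hP, ← Finset.sum_sub_distrib, weightNorm, Finset.sum_mul]
  refine norm_sum_le_of_le _ fun k _ => ?_
  rw [← mul_sub, norm_mul, Complex.norm_real, Real.norm_eq_abs]
  exact mul_le_mul_of_nonneg_left (hk k) (abs_nonneg _)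

theorem norm_iteratedFDeriv_comp_le {E F V : Type*} [NormedAddCommGroup E] [NormedSpace ℝ E]
    [NormedAddCommGroup F] [NormedSpace ℝ F] [NormedAddCommGroup V] [NormedSpace ℝ V]
    {g : F → V} (hg : ContDiff ℝ ∞ g) (A : E →L[ℝ] F) (j : ℕ) (x : E) :
    ‖iteratedFDeriv ℝ j (fun x => g (A x)) x‖ ≤ ‖iteratedFDeriv ℝ j g (A x)‖ * ‖A‖ ^ j := by
  have h := A.iteratedFDeriv_comp_right hg x (i := j) (by norm_cast; exact le_top)
  change ‖iteratedFDeriv ℝ j (g ∘ A) x‖ ≤ _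
  rw [h]
  refine (ContinuousMultilinearMap.norm_compContinuousLinearMap_le _ _).trans ?_
  simp

/-- The one-variable estimate along the segment from `x` to `x + v`, where the derivative of order
`n + 1` picks up the factor `‖v‖ ^ (n + 1)`. -/
theorem norm_sum_weight_line_sub_le {E : Type*} [NormedAddCommGroup E] [NormedSpace ℝ E]
    {g : E → ℂ} (hg : ContDiff ℝ ∞ g) {m n : ℕ} (hn : n ≤ m) {C : ℝ} (x v : E)
    (hC : ∀ z ∈ Metric.closedBall x ‖v‖, ‖iteratedFDeriv ℝ (n + 1) g z‖ ≤ C) :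
    ‖∑ k ∈ Finset.range (m + 1), (weight m k : ℂ) * g (x + scale k • v) - g x‖ ≤
      weightNorm m * (C * ‖v‖ ^ (n + 1)) := by
  have h := norm_sum_weight_sub_le (h := fun t : ℝ => g (x + t • v)) (m := m) (n := n)
    (B := C * ‖v‖ ^ (n + 1)) (by fun_prop) hn ?_
  · simpa using h
  intro t ht
  rw [← norm_iteratedFDeriv_eq_norm_iteratedDeriv]
  have hg' : ContDiff ℝ ∞ fun z => g (x + z) := by fun_prop
  refine (norm_iteratedFDeriv_comp_le hg' (ContinuousLinearMap.toSpanSingleton ℝ v) (n + 1)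
    t).trans ?_
  rw [ContinuousLinearMap.norm_toSpanSingleton, iteratedFDeriv_comp_add_left]
  gcongr
  refine hC _ ?_
  rw [Metric.mem_closedBall, dist_eq_norm, add_sub_cancel_left,
    ContinuousLinearMap.toSpanSingleton_apply, norm_smul, Real.norm_of_nonneg ht.1]
  exact mul_le_of_le_one_left (norm_nonneg v) ht.2

variable {d : ℕ}

/-- A smooth bump function with integral `1` and support in the unit ball. -/
def bump (d : ℕ) : Vec d → ℝ :=
  (⟨1 / 2, 1, by norm_num, by norm_num⟩ : ContDiffBump (0 : Vec d)).normed volume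

theorem contDiff_bump : ContDiff ℝ ∞ (bump d) := ContDiffBump.contDiff_normed _

theorem bump_nonneg (x : Vec d) : 0 ≤ bump d x := ContDiffBump.nonneg_normed _ x

theorem integral_bump : ∫ x, bump d x = 1 := ContDiffBump.integral_normed _

theorem bump_eq_zero {x : Vec d} (hx : 1 ≤ ‖x‖) : bump d x = 0 := by
  have h : Function.support (bump d) = Metric.ball 0 1 := ContDiffBump.support_normed_eq _
  by_contra hn
  have h1 : x ∈ Function.support (bump d) := hn
  rw [h, mem_ball_zero_iff] at h1
  linarith

theorem hasCompactSupport_bump : HasCompactSupport (bump d) :=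
  ContDiffBump.hasCompactSupport_normed _

theorem integrable_bump_mul {g : Vec d → ℂ} (hg : Continuous g) :
    Integrable fun y => (bump d y : ℂ) * g y := by
  refine Continuous.integrable_of_hasCompactSupport
    ((Complex.continuous_ofReal.comp contDiff_bump.continuous).mul hg) ?_
  refine HasCompactSupport.mul_right ?_
  exact hasCompactSupport_bump.comp_left (g := fun t : ℝ => (t : ℂ)) Complex.ofReal_zero

/-- A mollifier of radius `r` whose moments of the orders `1, …, m` vanish. -/
def mollifier (d m : ℕ) (r : ℝ) (x : Vec d) : ℂ :=
  ∑ k ∈ Finset.range (m + 1),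
    ((weight m k * ((r * scale k)⁻¹) ^ d : ℝ) : ℂ) * (bump d ((r * scale k)⁻¹ • x) : ℂ)

theorem contDiff_ofReal_bump : ContDiff ℝ ∞ fun x => (bump d x : ℂ) :=
  Complex.ofRealCLM.contDiff.comp contDiff_bump

theorem contDiff_mollifier (m : ℕ) (r : ℝ) : ContDiff ℝ ∞ (mollifier d m r) :=
  ContDiff.sum fun _ _ => contDiff_const.mul
    (contDiff_ofReal_bump.comp (contDiff_const_smul _))

theorem mollifier_eq_zero {m : ℕ} {r : ℝ} (hr : 0 < r) {x : Vec d} (hx : r ≤ ‖x‖) :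
    mollifier d m r x = 0 := by
  refine Finset.sum_eq_zero fun k _ => ?_
  have hk : 0 < r * scale k := mul_pos hr (scale_pos k)
  rw [bump_eq_zero, Complex.ofReal_zero, mul_zero]
  rw [norm_smul, norm_inv, Real.norm_of_nonneg hk.le, ← div_eq_inv_mul, le_div_iff₀ hk, one_mul]
  exact (mul_le_of_le_one_right hr.le (scale_le_one k)).trans hx

/-- Substituting `x = (r * scale k) • y` in each summand turns integration against the mollifier
into a bump average of extrapolations along rays. -/
theorem integral_mollifier_mul (m : ℕ) {r : ℝ} (hr : 0 < r) {g : Vec d → ℂ} (hg : Continuous g) :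
    ∫ x, mollifier d m r x * g x =
      ∫ y, (bump d y : ℂ) *
        ∑ k ∈ Finset.range (m + 1), (weight m k : ℂ) * g ((r * scale k) • y) := by
  have hi : ∀ k, Integrable fun y => (bump d y : ℂ) * g ((r * scale k) • y) := fun k =>
    integrable_bump_mul (hg.comp (continuous_const_smul _))
  have hscale : ∀ k x, (bump d ((r * scale k)⁻¹ • x) : ℂ) * g x =
      (fun y => (bump d y : ℂ) * g ((r * scale k) • y)) ((r * scale k)⁻¹ • x) := by
    intro k x
    simp only [smul_smul]
    rw [mul_inv_cancel₀ (mul_pos hr (scale_pos k)).ne', one_smul]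
  have hl : ∀ x, mollifier d m r x * g x = ∑ k ∈ Finset.range (m + 1),
      ((weight m k * ((r * scale k)⁻¹) ^ d : ℝ) : ℂ) *
        (fun y => (bump d y : ℂ) * g ((r * scale k) • y)) ((r * scale k)⁻¹ • x) := by
    intro x
    rw [mollifier, Finset.sum_mul]
    refine Finset.sum_congr rfl fun k _ => ?_
    rw [mul_assoc, hscale]
  simp_rw [hl]
  rw [integral_finsetSum]
  · simp_rw [Finset.mul_sum]
    rw [integral_finsetSum]
    · refine Finset.sum_congr rfl fun k _ => ?_
      have hk : 0 < r * scale k := mul_pos hr (scale_pos k)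
      have hsub := Measure.integral_comp_smul volume
        (fun y : Vec d => (bump d y : ℂ) * g ((r * scale k) • y)) (r * scale k)⁻¹
      rw [finrank_euclideanSpace_fin] at hsub
      rw [integral_const_mul, hsub,
        abs_of_pos (by positivity), Complex.real_smul, ← mul_assoc, ← integral_const_mul]
      rw [← Complex.ofReal_mul, inv_pow, inv_inv, mul_assoc, inv_mul_cancel₀ (pow_pos hk d).ne',
        mul_one]
      refine integral_congr_ae (.of_forall fun y => ?_)
      change _ * (_ * _) = _ * (_ * _)
      ring
    · intro k _
      refine ((hi k).const_mul (weight m k : ℂ)).congr (.of_forall fun y => ?_)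
      change _ * (_ * _) = _ * (_ * _)
      ring
  · intro k _
    exact ((hi k).comp_smul (inv_ne_zero (mul_pos hr (scale_pos k)).ne')).const_mul _

theorem integral_ofReal_bump : ∫ y, (bump d y : ℂ) = 1 := by
  rw [integral_complex_ofReal, integral_bump, Complex.ofReal_one]

/-- Homogeneity reduces the extrapolation to `sum_weight_mul_pow`. The case `j = 0` yields the total
mass, the cases `0 < j ≤ m` the vanishing moments. -/
theorem integral_mollifier_mul_homogeneous {m j : ℕ} (hj : j ≤ m) {r : ℝ} (hr : 0 < r)
    {g : Vec d → ℂ} (hg : Continuous g) (hh : ∀ (t : ℝ) y, g (t • y) = (t : ℂ) ^ j * g y) :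
    ∫ x, mollifier d m r x * g x = 0 ^ j * ∫ y, (bump d y : ℂ) * g y := by
  rw [integral_mollifier_mul m hr hg, ← integral_const_mul]
  refine integral_congr_ae (.of_forall fun y => ?_)
  have h : ∑ k ∈ Finset.range (m + 1), (weight m k : ℂ) * g ((r * scale k) • y) =
      ((∑ k ∈ Finset.range (m + 1), weight m k * scale k ^ j : ℝ) : ℂ) * (r : ℂ) ^ j * g y := by
    push_cast
    rw [Finset.sum_mul, Finset.sum_mul]
    refine Finset.sum_congr rfl fun k _ => ?_
    rw [hh]
    push_cast
    ring
  simp only [h]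
  rw [sum_weight_mul_pow hj]
  rcases Nat.eq_zero_or_pos j with rfl | hj0
  · simp
  · simp [hj0.ne']

/-- As the bump has mass 1, the error is a bump average of the extrapolation errors along the
segments from `x` to `x - r • y`, whose length is at most `r` on the support of the bump. -/
theorem norm_integral_mollifier_mul_sub_le {m n : ℕ} (hn : n ≤ m) {r : ℝ} (hr : 0 < r)
    {g : Vec d → ℂ} (hg : ContDiff ℝ ∞ g) {C : ℝ} (x : Vec d)
    (hC : ∀ z ∈ Metric.closedBall x r, ‖iteratedFDeriv ℝ (n + 1) g z‖ ≤ C) :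
    ‖(∫ y, mollifier d m r y * g (x - y)) - g x‖ ≤ weightNorm m * (C * r ^ (n + 1)) := by
  have hC0 : 0 ≤ C := (norm_nonneg _).trans (hC x (Metric.mem_closedBall_self hr.le))
  have hgx : Continuous fun y => g (x - y) := hg.continuous.comp (by fun_prop)
  have hgs : Continuous fun y => ∑ k ∈ Finset.range (m + 1),
      (weight m k : ℂ) * g (x - (r * scale k) • y) :=
    continuous_finsetSum _ fun k _ => continuous_const.mul (hg.continuous.comp (by fun_prop))
  have h1 : (∫ y, mollifier d m r y * g (x - y)) - g x = ∫ y, (bump d y : ℂ) *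
      (∑ k ∈ Finset.range (m + 1), (weight m k : ℂ) * g (x - (r * scale k) • y) - g x) := by
    simp_rw [mul_sub]
    rw [integral_sub (integrable_bump_mul hgs) (integrable_bump_mul continuous_const),
      integral_mul_const, integral_ofReal_bump, one_mul, integral_mollifier_mul m hr hgx]
  rw [h1]
  have hb : Integrable fun y => bump d y * (weightNorm m * (C * r ^ (n + 1))) :=
    (contDiff_bump.continuous.integrable_of_hasCompactSupport hasCompactSupport_bump).mul_const _
  refine (norm_integral_le_of_norm_le hb (.of_forall fun y => ?_)).trans_eq ?_
  · rw [norm_mul, Complex.norm_real, Real.norm_of_nonneg (bump_nonneg y)]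
    rcases le_or_gt 1 ‖y‖ with hy | hy
    · rw [bump_eq_zero hy, zero_mul, zero_mul]
    refine mul_le_mul_of_nonneg_left ?_ (bump_nonneg y)
    have hv : ‖-(r • y)‖ ≤ r := by
      rw [norm_neg, norm_smul, Real.norm_of_nonneg hr.le]
      exact mul_le_of_le_one_right hr.le hy.le
    have h := norm_sum_weight_line_sub_le hg hn (C := C) x (-(r • y)) fun z hz =>
      hC z (Metric.closedBall_subset_closedBall hv hz)
    have e : ∀ k, x + scale k • -(r • y) = x - (r * scale k) • y := fun k => by
      rw [smul_neg, smul_smul, mul_comm, sub_eq_add_neg]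
    simp only [e] at h
    refine h.trans (mul_le_mul_of_nonneg_left ?_ (weightNorm_nonneg m))
    gcongr
  · rw [integral_mul_const, integral_bump, one_mul]

theorem exists_bound_iteratedFDeriv_bump (d j : ℕ) :
    ∃ M, 0 ≤ M ∧ ∀ x, ‖iteratedFDeriv ℝ j (fun x => (bump d x : ℂ)) x‖ ≤ M := by
  have hc : Continuous fun x => iteratedFDeriv ℝ j (fun x => (bump d x : ℂ)) x :=
    contDiff_ofReal_bump.continuous_iteratedFDeriv (by norm_cast; exact le_top)
  have hs : HasCompactSupport fun x => (bump d x : ℂ) :=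
    hasCompactSupport_bump.comp_left (g := fun t : ℝ => (t : ℂ)) Complex.ofReal_zero
  obtain ⟨M, hM⟩ := (hs.iteratedFDeriv (𝕜 := ℝ) j).exists_bound_of_continuous hc
  exact ⟨M, (norm_nonneg _).trans (hM 0), hM⟩

theorem norm_iteratedFDeriv_mollifier_le {m j : ℕ} {r M : ℝ} (hr : 0 < r)
    (hm : (m : ℝ) + 1 ≤ r⁻¹)
    (hM : ∀ x, ‖iteratedFDeriv ℝ j (fun x => (bump d x : ℂ)) x‖ ≤ M) (x : Vec d) :
    ‖iteratedFDeriv ℝ j (mollifier d m r) x‖ ≤ weightNorm m * M * (r⁻¹ ^ 2) ^ (d + j) := by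
  have hM0 : 0 ≤ M := (norm_nonneg _).trans (hM 0)
  have hcd : ∀ k, ContDiff ℝ ∞ fun x : Vec d => (bump d ((r * scale k)⁻¹ • x) : ℂ) := fun k =>
    contDiff_ofReal_bump.comp (contDiff_const_smul _)
  have e : mollifier d m r = fun x => ∑ k ∈ Finset.range (m + 1),
      ((weight m k * ((r * scale k)⁻¹) ^ d : ℝ)) • (bump d ((r * scale k)⁻¹ • x) : ℂ) := by
    funext x
    simp only [mollifier, Complex.real_smul]
  rw [e, iteratedFDeriv_fun_sum_apply (fun k _ => (((hcd k).const_smul _).of_le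
    (by norm_cast; exact le_top)).contDiffAt), weightNorm, Finset.sum_mul, Finset.sum_mul]
  refine norm_sum_le_of_le _ fun k hk => ?_
  have hk0 : 0 < r * scale k := mul_pos hr (scale_pos k)
  -- Here `(r * scale k)⁻¹ = r⁻¹ * (k + 1)`, and `k + 1 ≤ m + 1 ≤ r⁻¹`: the smallest scale costs
  -- only one more factor `r⁻¹`.
  have hk1 : (r * scale k)⁻¹ ≤ r⁻¹ ^ 2 := by
    rw [mul_inv, pow_two, scale, one_div, inv_inv]
    refine mul_le_mul_of_nonneg_left (le_trans ?_ hm) (inv_pos.2 hr).le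
    have : k ≤ m := Nat.lt_succ_iff.1 (Finset.mem_range.1 hk)
    gcongr
  rw [iteratedFDeriv_const_smul_apply' (((hcd k).of_le (by norm_cast; exact le_top)).contDiffAt),
    norm_smul, Real.norm_eq_abs, abs_mul, abs_of_pos (pow_pos (inv_pos.2 hk0) d)]
  have h1 := norm_iteratedFDeriv_comp_le contDiff_ofReal_bump
    ((r * scale k)⁻¹ • ContinuousLinearMap.id ℝ (Vec d)) j x
  have h2 : ‖(r * scale k)⁻¹ • ContinuousLinearMap.id ℝ (Vec d)‖ ≤ (r * scale k)⁻¹ := by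
    rw [norm_smul, Real.norm_of_nonneg (inv_pos.2 hk0).le]
    exact mul_le_of_le_one_right (inv_pos.2 hk0).le ContinuousLinearMap.norm_id_le
  have h3 : ‖iteratedFDeriv ℝ j (fun x : Vec d => (bump d ((r * scale k)⁻¹ • x) : ℂ)) x‖ ≤
      M * (r * scale k)⁻¹ ^ j := by
    refine h1.trans ?_
    gcongr
    exact hM _
  calc |weight m k| * (r * scale k)⁻¹ ^ d *
        ‖iteratedFDeriv ℝ j (fun x : Vec d => (bump d ((r * scale k)⁻¹ • x) : ℂ)) x‖
      ≤ |weight m k| * (r * scale k)⁻¹ ^ d * (M * (r * scale k)⁻¹ ^ j) := by gcongr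
    _ = |weight m k| * M * (r * scale k)⁻¹ ^ (d + j) := by ring
    _ ≤ |weight m k| * M * (r⁻¹ ^ 2) ^ (d + j) := by gcongr

/-- The order of the mollifier of radius `r`: it tends to infinity for `r → 0`, but slowly. -/
def order (r : ℝ) : ℕ :=
  Nat.findGreatest (fun m => weightNorm m + ((m : ℝ) + 1) ≤ r⁻¹) ⌊r⁻¹⌋₊

theorem order_spec {r : ℝ} (h0 : 0 < r) (hr : r ≤ 1 / 2) :
    weightNorm (order r) + ((order r : ℝ) + 1) ≤ r⁻¹ := by
  -- At `m = 0` the condition reads `1 + 1 ≤ r⁻¹`, which is the hypothesis `r ≤ 1 / 2`.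
  refine Nat.findGreatest_spec (P := fun m : ℕ => weightNorm m + ((m : ℝ) + 1) ≤ r⁻¹) (m := 0)
    (Nat.zero_le _) ?_
  rw [weightNorm_zero, Nat.cast_zero, zero_add, ← one_div, le_div_iff₀ h0]
  linarith

theorem le_order {r : ℝ} {N : ℕ} (h : weightNorm N + ((N : ℝ) + 1) ≤ r⁻¹) : N ≤ order r := by
  -- The search bound `⌊r⁻¹⌋₊` excludes nothing, since the condition itself forces `N + 1 ≤ r⁻¹`.
  refine Nat.le_findGreatest (Nat.le_floor ?_) h
  have := weightNorm_nonneg N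
  linarith

end

section

variable {d : ℕ}

/-! ### Cut-off functions -/

-- The set `K` where the value 1 is required is truncated by the ball of radius `r⁻¹` to be compact.
-- Its points lie at distance at least `3r` from the complement of `Ω`, so its closed
-- `r`-neighbourhood, which contains the support, keeps distance `2r`.
open scoped Manifold in
theorem exists_cutoff (Ω : Opens (Vec d)) {r : ℝ} (hr : 0 < r) : ∃ p : 𝓓(Ω, ℂ),
    (∀ x : Vec d, ‖x‖ ≤ r⁻¹ → (∀ y ∉ Ω, 3 * r ≤ dist x y) → p x = 1) ∧
    ∀ x ∈ tsupport p, ∀ y ∈ frontier (Ω : Set (Vec d)), r ≤ ‖x - y‖ := by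
  let K : Set (Vec d) := Metric.closedBall 0 r⁻¹ ∩ ⋂ y ∈ (Ω : Set (Vec d))ᶜ, {x | 3 * r ≤ dist x y}
  have hKc : IsCompact K := (isCompact_closedBall 0 r⁻¹).inter_right
    (isClosed_biInter fun y _ => isClosed_le continuous_const (continuous_id.dist continuous_const))
  have hK : ∀ x ∈ K, ∀ y ∉ Ω, 3 * r ≤ dist x y := fun x hx y hy => by
    have := hx.2
    simp only [Set.mem_iInter] at this
    exact this y hy
  let t := Metric.cthickening r K
  have ht : ∀ x ∈ t, ∀ y ∉ Ω, 2 * r ≤ dist x y := by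
    intro x hx y hy
    simp only [t, hKc.cthickening_eq_biUnion_closedBall hr.le, Set.mem_iUnion] at hx
    obtain ⟨z, hz, hxz⟩ := hx
    have h1 := hK z hz y hy
    have h2 := dist_triangle_left z y x
    rw [Metric.mem_closedBall] at hxz
    linarith
  have htΩ : t ⊆ Ω := fun x hx => by
    by_contra hn
    have := ht x hx x hn
    rw [dist_self] at this
    linarith
  obtain ⟨f, hf1, hf0, -⟩ := exists_contMDiffMap_one_nhds_of_subset_interior (n := (⊤ : ℕ∞))
    𝓘(ℝ, Vec d) hKc.isClosed ((Metric.self_subset_thickening hr K).trans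
      (interior_maximal (Metric.thickening_subset_cthickening r K) Metric.isOpen_thickening))
  have hts : tsupport (fun x => (f x : ℂ)) ⊆ t :=
    tsupport_subset_of_forall_eq_zero Metric.isClosed_cthickening fun x hx => by
      rw [hf0 x hx, Complex.ofReal_zero]
  refine ⟨⟨fun x => (f x : ℂ), Complex.ofRealCLM.contDiff.comp f.contMDiff.contDiff,
    (hKc.cthickening (r := r)).of_isClosed_subset (isClosed_tsupport _) hts, hts.trans htΩ⟩, ?_, ?_⟩
  · intro x hx hxΩ
    have hxK : x ∈ K := ⟨by simpa using hx, by simpa using hxΩ⟩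
    change ((f x : ℝ) : ℂ) = 1
    rw [hf1.self_of_nhdsSet x hxK, Complex.ofReal_one]
  · intro x hx y hy
    have hyΩ : y ∉ Ω := by
      rw [Ω.isOpen.frontier_eq] at hy
      exact hy.2
    rw [← dist_eq_norm]
    have := ht x (hts hx) y hyΩ
    linarith

/-! ### Regularization by convolution -/

theorem Smooth.contDiff_extZero (f : Smooth (⊤ : Opens (Vec d))) : ContDiff ℝ ∞ (extZero f.1) :=
  contDiffOn_univ.1 (f.2 : ContDiffOn ℝ ∞ (extZero f.1) (⊤ : Opens (Vec d)))

variable {Ω : Opens (Vec d)}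

/-- The support of a test function as a compact set. -/
def suppCompacts (p : 𝓓(Ω, ℂ)) : Compacts (Vec d) := ⟨tsupport p, p.hasCompactSupport⟩

theorem suppCompacts_subset (p : 𝓓(Ω, ℂ)) : (suppCompacts p : Set (Vec d)) ⊆ Ω :=
  p.tsupport_subset

theorem cutTranslate_apply (p : 𝓓(Ω, ℂ)) (f : Smooth (⊤ : Opens (Vec d))) (x ξ : Vec d) :
    cutTranslate p f x ξ = p ξ * extZero f.1 (x - ξ) := rfl

theorem contDiff_cutTranslate (p : 𝓓(Ω, ℂ)) (f : Smooth (⊤ : Opens (Vec d))) :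
    ContDiff ℝ ∞ fun z : Vec d × Vec d => cutTranslate p f z.1 z.2 :=
  (p.contDiff.comp contDiff_snd).mul ((Smooth.contDiff_extZero f).comp (contDiff_fst.sub contDiff_snd))

theorem tsupport_cutTranslate (p : 𝓓(Ω, ℂ)) (f : Smooth (⊤ : Opens (Vec d))) (x : Vec d) :
    tsupport (cutTranslate p f x) ⊆ suppCompacts p :=
  tsupport_mul_subset_left

/-- The regularization `(T p) ⋆ f` of a distribution. -/
def regularize (T : Distr Ω) (p : 𝓓(Ω, ℂ)) (f : Smooth (⊤ : Opens (Vec d))) : Smooth Ω :=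
  ⟨fun x => T (cutTranslate p f x), by
    refine ((contDiff_distribution_family (contDiff_cutTranslate p f)
      (K := suppCompacts p) (suppCompacts_subset p) (tsupport_cutTranslate p f) T).contDiffOn).congr
        fun x hx => ?_
    exact extZero_mem (fun x : Ω => T (cutTranslate p f x)) hx⟩

theorem extZero_regularize (T : Distr Ω) (p : 𝓓(Ω, ℂ)) (f : Smooth (⊤ : Opens (Vec d))) {x : Vec d}
    (hx : x ∈ Ω) : extZero (regularize T p f).1 x = T (cutTranslate p f x) :=
  extZero_mem (regularize T p f).1 hx

theorem Smooth.extZero_pderiv_top (f : Smooth (⊤ : Opens (Vec d))) (j : Fin d) (x : Vec d) :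
    extZero (Smooth.pderiv j f).1 x = fderiv ℝ (extZero f.1) x (unitVec j) :=
  extZero_mem (Smooth.pderiv j f).1 (show x ∈ (⊤ : Opens (Vec d)) from trivial)

/-- Only the factor `f (x - ξ)` depends on `x`, so the derivative falls on `f` alone, whatever `p`
is. -/
theorem pderiv_regularize (T : Distr Ω) (p : 𝓓(Ω, ℂ)) (f : Smooth (⊤ : Opens (Vec d)))
    (j : Fin d) : Smooth.pderiv j (regularize T p f) = regularize T p (Smooth.pderiv j f) := by
  refine Subtype.ext (funext fun x => ?_)
  have h := hasFDerivAt_distribution (contDiff_cutTranslate p f) (K := suppCompacts p)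
    (suppCompacts_subset p) (tsupport_cutTranslate p f) T x.1
  have he : extZero (regularize T p f).1 =ᶠ[nhds x.1] fun x => T (cutTranslate p f x) :=
    extZero_eventuallyEq (regularize T p f).1 (fun x => T (cutTranslate p f x)) (fun _ => rfl) x.2
  rw [Smooth.pderiv_apply, he.fderiv_eq, h.fderiv, distributionParamDeriv_apply]
  change _ = T (cutTranslate p (Smooth.pderiv j f) x)
  congr 1
  ext ξ
  rw [paramDeriv_apply, cutTranslate_apply, Smooth.extZero_pderiv_top]
  have hf : HasFDerivAt (fun y => extZero f.1 (y - ξ)) ((fderiv ℝ (extZero f.1) (x.1 - ξ)).comp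
      (ContinuousLinearMap.id ℝ (Vec d))) x.1 :=
    (((Smooth.contDiff_extZero f).differentiable (by simp)).differentiableAt.hasFDerivAt).comp x.1
      ((hasFDerivAt_id x.1).sub_const ξ)
  simp only [cutTranslate_apply]
  rw [(hf.const_mul (p ξ)).fderiv]
  rfl

/-- `p = 1` on the ball of radius `r` around `x`. -/
def IsOneNear (p : 𝓓(Ω, ℂ)) (x : Vec d) (r : ℝ) : Prop := ∀ ξ ∈ Metric.ball x r, p ξ = 1

/-- `f` vanishes outside of the ball of radius `r` around `0`. -/
def VanishesOff (f : Smooth (⊤ : Opens (Vec d))) (r : ℝ) : Prop :=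
  ∀ y, r ≤ ‖y‖ → extZero f.1 y = 0

theorem VanishesOff.mem_ball {f : Smooth (⊤ : Opens (Vec d))} {r : ℝ} (hf : VanishesOff f r)
    {x ξ : Vec d} (h : extZero f.1 (x - ξ) ≠ 0) : ξ ∈ Metric.ball x r := by
  rw [Metric.mem_ball, dist_comm, dist_eq_norm]
  exact not_le.1 fun hn => h (hf _ hn)

theorem IsOneNear.cutTranslate_apply {p : 𝓓(Ω, ℂ)} {f : Smooth (⊤ : Opens (Vec d))} {x : Vec d}
    {r : ℝ} (hp : IsOneNear p x r) (hf : VanishesOff f r) (ξ : Vec d) :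
    cutTranslate p f x ξ = extZero f.1 (x - ξ) := by
  rw [RhoAsymptotic.cutTranslate_apply]
  by_cases h : extZero f.1 (x - ξ) = 0
  · rw [h, mul_zero]
  · rw [hp ξ (hf.mem_ball h), one_mul]

theorem apply_lineDeriv (T : Distr Ω) (j : Fin d) (φ : 𝓓(Ω, ℂ)) :
    Distr.pderiv j T φ = -T (TestFunction.lineDerivCLM ℂ (unitVec j) φ) := rfl

theorem lineDeriv_testFunction_apply (φ : 𝓓(Ω, ℂ)) (v ξ : Vec d) :
    (TestFunction.lineDerivCLM ℂ v φ : 𝓓(Ω, ℂ)) ξ = fderiv ℝ φ ξ v := by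
  rw [TestFunction.lineDerivCLM_eq_fderivCLM, TestFunction.fderivCLM_apply_of_le _ (by simp)]

theorem VanishesOff.fderiv_eq_zero {f : Smooth (⊤ : Opens (Vec d))} {r : ℝ}
    (hf : VanishesOff f r) {y : Vec d} (hy : r < ‖y‖) : fderiv ℝ (extZero f.1) y = 0 := by
  have h : extZero f.1 =ᶠ[nhds y] fun _ => 0 := by
    filter_upwards [continuous_norm.continuousAt.preimage_mem_nhds (Ioi_mem_nhds hy)] with z hz
    exact hf z (le_of_lt hz)
  rw [h.fderiv_eq, fderiv_fun_const, Pi.zero_apply]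

theorem IsOneNear.mono {p : 𝓓(Ω, ℂ)} {x : Vec d} {r s : ℝ} (hp : IsOneNear p x s) (h : r ≤ s) :
    IsOneNear p x r := fun ξ hξ => hp ξ (Metric.ball_subset_ball h hξ)

/-- The sign in the definition of the distributional derivative cancels the sign from
differentiating `f (x - ξ)` in `ξ`. The margin `r < s` is used outside the larger ball: there `f`
vanishes in a neighbourhood of `x - ξ`, hence so does its derivative. -/
theorem pderiv_apply_cutTranslate (T : Distr Ω) {p : 𝓓(Ω, ℂ)} {f : Smooth (⊤ : Opens (Vec d))}
    {x : Vec d} {r s : ℝ} (hrs : r < s) (hp : IsOneNear p x s) (hf : VanishesOff f r)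
    (j : Fin d) :
    Distr.pderiv j T (cutTranslate p f x) = T (cutTranslate p (Smooth.pderiv j f) x) := by
  rw [apply_lineDeriv, ← map_neg]
  congr 1
  ext ξ
  change -((TestFunction.lineDerivCLM ℂ (unitVec j) (cutTranslate p f x) : 𝓓(Ω, ℂ)) ξ) = _
  rw [lineDeriv_testFunction_apply, cutTranslate_apply, Smooth.extZero_pderiv_top]
  have hfun : ⇑(cutTranslate p f x) = fun ξ => extZero f.1 (x - ξ) :=
    funext fun ξ => (hp.mono hrs.le).cutTranslate_apply hf ξ
  have hd : HasFDerivAt (fun ξ => extZero f.1 (x - ξ))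
      ((fderiv ℝ (extZero f.1) (x - ξ)).comp (-ContinuousLinearMap.id ℝ (Vec d))) ξ :=
    (((Smooth.contDiff_extZero f).differentiable (by simp)).differentiableAt.hasFDerivAt).comp ξ
      ((hasFDerivAt_id ξ).const_sub x)
  rw [hfun, hd.fderiv]
  by_cases hξ : ξ ∈ Metric.ball x s
  · rw [hp ξ hξ]
    simp
  · rw [Metric.mem_ball, dist_comm, dist_eq_norm, not_lt] at hξ
    rw [hf.fderiv_eq_zero (hrs.trans_le hξ)]
    simp

/-- Both cut-offs are 1 wherever `f (x - ξ) ≠ 0`, so the two test functions coincide. -/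
theorem restrict_apply_cutTranslate {O : Opens (Vec d)} (h : O ≤ Ω) (T : Distr Ω) {p : 𝓓(Ω, ℂ)}
    {q : 𝓓(O, ℂ)} {f : Smooth (⊤ : Opens (Vec d))} {x : Vec d} {r : ℝ} (hp : IsOneNear p x r)
    (hq : IsOneNear q x r) (hf : VanishesOff f r) :
    Distr.restrict h T (cutTranslate q f x) = T (cutTranslate p f x) := by
  change T (TestFunction.monoCLM ℂ (cutTranslate q f x)) = _
  congr 1
  ext ξ
  rw [TestFunction.monoCLM_apply, if_pos ⟨le_rfl, h⟩, hp.cutTranslate_apply hf,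
    hq.cutTranslate_apply hf]

/-- For `x` near `x₀` all these test functions are supported in one closed ball, so a single order
and a single constant serve every `p`, `f` and `x`. The reflection `ξ ↦ -ξ` does not increase
derivative norms. -/
theorem norm_apply_cutTranslate_le (T : Distr Ω) {x₀ : Vec d} {ε : ℝ}
    (hε : Metric.closedBall x₀ ε ⊆ Ω) : ∃ (N : ℕ) (C : ℝ), 0 ≤ C ∧
      ∀ (p : 𝓓(Ω, ℂ)) (f : Smooth (⊤ : Opens (Vec d))) (x : Vec d) (r M : ℝ),
        x ∈ Metric.ball x₀ (ε / 2) → r ≤ ε / 2 → IsOneNear p x r → VanishesOff f r → 0 ≤ M →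
        (∀ k ≤ N, ∀ y, ‖iteratedFDeriv ℝ k (extZero f.1) y‖ ≤ M) →
        ‖T (cutTranslate p f x)‖ ≤ C * M := by
  obtain ⟨N, C, hC, h⟩ := exists_distribution_bound T
    (K := ⟨Metric.closedBall x₀ ε, isCompact_closedBall x₀ ε⟩) hε
  refine ⟨N, C, hC, fun p f x r M hx hr hp hf hM hb => h _ ?_ M hM fun k hk ξ => ?_⟩
  · refine tsupport_subset_of_forall_eq_zero Metric.isClosed_closedBall fun ξ hξ => ?_
    rw [hp.cutTranslate_apply hf]
    by_contra hn
    have h1 := hf.mem_ball hn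
    rw [Metric.mem_ball] at h1 hx
    refine hξ (Metric.mem_closedBall.2 ?_)
    have := dist_triangle ξ x x₀
    linarith
  · have hfun : ⇑(cutTranslate p f x) = fun ξ => (fun z => extZero f.1 (x + z))
        ((-ContinuousLinearMap.id ℝ (Vec d)) ξ) := by
      funext ξ
      rw [hp.cutTranslate_apply hf]
      simp [sub_eq_add_neg]
    rw [hfun]
    have hg : ContDiff ℝ ∞ fun z => extZero f.1 (x + z) :=
      (Smooth.contDiff_extZero f).comp (contDiff_const.add contDiff_id)
    refine (norm_iteratedFDeriv_comp_le hg _ k ξ).trans ?_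
    rw [iteratedFDeriv_comp_add_left]
    refine (mul_le_of_le_one_right (norm_nonneg _) (pow_le_one₀ (norm_nonneg _) ?_)).trans
      (hb k hk _)
    rw [norm_neg]
    exact ContinuousLinearMap.norm_id_le

/-- Only values of `f` in the ball of radius `r` around `x` enter. The freedom in `g` allows `f` to
be replaced by a globally smooth function. -/
theorem ofSmooth_apply_cutTranslate (f : Smooth Ω) {p : 𝓓(Ω, ℂ)}
    {m : Smooth (⊤ : Opens (Vec d))} {x : Vec d} {r : ℝ} (hp : IsOneNear p x r)
    (hm : VanishesOff m r) {g : Vec d → ℂ} (hg : ∀ ξ ∈ Metric.ball x r, g ξ = extZero f.1 ξ) :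
    Distr.ofSmooth f (cutTranslate p m x) = ∫ y, extZero m.1 y * g (x - y) := by
  rw [Distr.ofSmooth_apply, setIntegral_eq_integral_of_forall_compl_eq_zero]
  · rw [← integral_sub_left_eq_self (fun y => extZero m.1 y * g (x - y)) volume x]
    refine integral_congr_ae (.of_forall fun ξ => ?_)
    simp only [hp.cutTranslate_apply hm, sub_sub_cancel]
    by_cases h : extZero m.1 (x - ξ) = 0
    · rw [h, mul_zero, zero_mul]
    · rw [hg ξ (hm.mem_ball h), mul_comm]
  · intro ξ hξ
    rw [eq_zero_of_tsupport_subset (cutTranslate p m x).tsupport_subset hξ, mul_zero]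

end

section

variable {d : ℕ} {Ω : Opens (Vec d)}

/-! ### Distributions given by smooth functions -/

/-- The extension by 0 may be discontinuous at the boundary of `Ω`, but off the support of `φ` the
product is locally 0. -/
theorem contDiff_mul_extZero (φ : 𝓓(Ω, ℂ)) (f : Smooth Ω) :
    ContDiff ℝ ∞ fun x => φ x * extZero f.1 x := by
  refine contDiff_iff_contDiffAt.2 fun x => ?_
  by_cases hx : x ∈ tsupport φ
  · exact φ.contDiff.contDiffAt.mul (Smooth.contDiffAt f (φ.tsupport_subset hx))
  · refine contDiffAt_const.congr_of_eventuallyEq (f := fun _ => 0) ?_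
    filter_upwards [(isClosed_tsupport φ).isOpen_compl.mem_nhds hx] with y hy
    rw [image_eq_zero_of_notMem_tsupport hy, zero_mul]

theorem integrable_mul_extZero (φ : 𝓓(Ω, ℂ)) (f : Smooth Ω) :
    Integrable fun x => φ x * extZero f.1 x :=
  (contDiff_mul_extZero φ f).continuous.integrable_of_hasCompactSupport φ.hasCompactSupport.mul_right

theorem ofSmooth_apply_eq_integral (f : Smooth Ω) (φ : 𝓓(Ω, ℂ)) :
    Distr.ofSmooth f φ = ∫ x, extZero f.1 x * φ x := by
  rw [Distr.ofSmooth_apply, setIntegral_eq_integral_of_forall_compl_eq_zero]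
  intro x hx
  rw [eq_zero_of_tsupport_subset φ.tsupport_subset hx, mul_zero]

theorem pderiv_ofSmooth (j : Fin d) (f : Smooth Ω) :
    Distr.pderiv j (Distr.ofSmooth f) = Distr.ofSmooth (Smooth.pderiv j f) := by
  ext φ
  -- Outside `Ω` the derivative of the extension by 0 carries no information; there `φ = 0` makes
  -- both sides vanish.
  have h : ∀ x, fderiv ℝ (extZero f.1) x (unitVec j) * φ x =
      extZero (Smooth.pderiv j f).1 x * φ x := by
    intro x
    by_cases hx : x ∈ Ω
    · rw [extZero_mem _ hx]
      rfl
    · rw [eq_zero_of_tsupport_subset φ.tsupport_subset hx, mul_zero, mul_zero]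
  rw [apply_lineDeriv, ofSmooth_apply_eq_integral, ofSmooth_apply_eq_integral]
  simp_rw [lineDeriv_testFunction_apply, ← h]
  rw [integral_mul_fderiv_eq_neg_fderiv_mul_of_integrable, neg_neg]
  · simp_rw [h, mul_comm _ (φ _)]
    exact integrable_mul_extZero φ _
  · simp_rw [← lineDeriv_testFunction_apply, mul_comm (extZero _ _)]
    exact integrable_mul_extZero _ f
  · simp_rw [mul_comm _ (φ _)]
    exact integrable_mul_extZero φ f
  · exact fun x hx => Smooth.differentiableAt f (φ.tsupport_subset hx)
  · exact fun x _ => (φ.contDiff.differentiable (by simp)).differentiableAt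

/-! ### The delta net -/

/-- The members of the delta net: mollifiers of increasing order. -/
def delta (d : ℕ) (r : ℝ) : Smooth (⊤ : Opens (Vec d)) :=
  ⟨fun x => mollifier d (order r) r x, by
    refine ContDiffOn.congr (contDiff_mollifier (order r) r).contDiffOn fun x hx => ?_
    rw [extZero_mem _ hx]⟩

theorem extZero_delta (d : ℕ) (r : ℝ) : extZero (delta d r).1 = mollifier d (order r) r :=
  funext fun x => extZero_mem (delta d r).1 (show x ∈ (⊤ : Opens (Vec d)) from trivial)

theorem vanishesOff_delta (d : ℕ) {r : ℝ} (hr : 0 < r) : VanishesOff (delta d r) r := fun y hy => by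
  rw [extZero_delta, mollifier_eq_zero hr hy]

theorem weightNorm_order_le {r : ℝ} (h0 : 0 < r) (hr : r ≤ 1 / 2) : weightNorm (order r) ≤ r⁻¹ := by
  have := order_spec h0 hr
  have : (0 : ℝ) ≤ order r := Nat.cast_nonneg _
  linarith

/-- The weights sum in absolute value to at most `r⁻¹`, which costs one of the `n + 1` powers of
`r`. The constant `C` does not depend on the growing order of the mollifier. -/
theorem norm_integral_delta_mul_sub_le {n : ℕ} {r : ℝ} (h0 : 0 < r) (hr : r ≤ 1 / 2)
    (hn : n ≤ order r) {g : Vec d → ℂ} (hg : ContDiff ℝ ∞ g) {C : ℝ} (x : Vec d)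
    (hC : ∀ z ∈ Metric.closedBall x r, ‖iteratedFDeriv ℝ (n + 1) g z‖ ≤ C) :
    ‖(∫ y, extZero (delta d r).1 y * g (x - y)) - g x‖ ≤ C * r ^ n := by
  rw [extZero_delta]
  have hC0 : 0 ≤ C := (norm_nonneg _).trans (hC x (Metric.mem_closedBall_self h0.le))
  refine (norm_integral_mollifier_mul_sub_le hn h0 hg x hC).trans ?_
  refine (mul_le_mul_of_nonneg_right (weightNorm_order_le h0 hr) (by positivity)).trans_eq ?_
  rw [pow_succ]
  field_simp

/-- The exponent collects one `r⁻¹` for the weights and `r⁻²` for each of the `d + j` rescaling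
factors. `M` depends only on the unscaled bump. -/
theorem exists_norm_iteratedFDeriv_delta_le (d j : ℕ) : ∃ M : ℝ, 0 ≤ M ∧ ∀ r : ℝ, 0 < r → r ≤ 1 / 2 →
    ∀ x, ‖iteratedFDeriv ℝ j (extZero (delta d r).1) x‖ ≤ M * r⁻¹ ^ (2 * (d + j) + 1) := by
  obtain ⟨M, hM0, hM⟩ := exists_bound_iteratedFDeriv_bump d j
  refine ⟨M, hM0, fun r h0 hr x => ?_⟩
  have h := order_spec h0 hr
  have h1 := weightNorm_nonneg (order r)
  rw [extZero_delta]
  refine (norm_iteratedFDeriv_mollifier_le h0 (by linarith) hM x).trans ?_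
  calc weightNorm (order r) * M * (r⁻¹ ^ 2) ^ (d + j)
      ≤ r⁻¹ * M * (r⁻¹ ^ 2) ^ (d + j) := by
        gcongr
        exact weightNorm_order_le h0 hr
    _ = M * r⁻¹ ^ (2 * (d + j) + 1) := by
        rw [← pow_mul, pow_succ]
        ring

/-! ### Regularization of smooth functions -/

/-- A smooth bump function as a test function. -/
def bumpTest {c : Vec d} (χ : ContDiffBump c) (h : Metric.closedBall c χ.rOut ⊆ Ω) : 𝓓(Ω, ℂ) where
  toFun x := (χ x : ℂ)
  contDiff' := Complex.ofRealCLM.contDiff.comp χ.contDiff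
  hasCompactSupport' := χ.hasCompactSupport.comp_left (g := fun t : ℝ => (t : ℂ)) Complex.ofReal_zero
  tsupport_subset' := (tsupport_subset_of_forall_eq_zero Metric.isClosed_closedBall fun x hx => by
    rw [χ.zero_of_le_dist (not_le.1 fun hn => hx (Metric.mem_closedBall.2 hn)).le,
      Complex.ofReal_zero]).trans h

theorem exists_bound_iteratedFDeriv_of_hasCompactSupport {g : Vec d → ℂ} (hg : ContDiff ℝ ∞ g)
    (hs : HasCompactSupport g) (j : ℕ) : ∃ C, ∀ x, ‖iteratedFDeriv ℝ j g x‖ ≤ C :=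
  (hs.iteratedFDeriv (𝕜 := ℝ) j).exists_bound_of_continuous
    (hg.continuous_iteratedFDeriv (by norm_cast; exact le_top))

/-- Multiplying `f` by a bump equal to 1 near `x₀` gives a compactly supported smooth `g`, whose
derivative of order `n + 1` is bounded globally and independently of `r`. The radii `ε / 4` keep the
ball around `x` where `g = f`. -/
theorem exists_norm_ofSmooth_sub_le (f : Smooth Ω) {x₀ : Vec d} {ε : ℝ} (hε : 0 < ε)
    (h : Metric.closedBall x₀ ε ⊆ Ω) (n : ℕ) : ∃ C : ℝ, ∀ (r : ℝ) (p : 𝓓(Ω, ℂ)) (x : Vec d),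
      0 < r → r ≤ 1 / 2 → n ≤ order r → r ≤ ε / 4 → x ∈ Metric.ball x₀ (ε / 4) →
      IsOneNear p x r →
      ‖Distr.ofSmooth f (cutTranslate p (delta d r) x) - extZero f.1 x‖ ≤ C * r ^ n := by
  let χ : ContDiffBump x₀ := ⟨ε / 2, ε, by linarith, by linarith⟩
  let g : Vec d → ℂ := fun x => bumpTest χ h x * extZero f.1 x
  have hg : ContDiff ℝ ∞ g := contDiff_mul_extZero (bumpTest χ h) f
  obtain ⟨C, hC⟩ := exists_bound_iteratedFDeriv_of_hasCompactSupport hg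
    (bumpTest χ h).hasCompactSupport.mul_right (n + 1)
  have hgf : ∀ x ∈ Metric.ball x₀ (ε / 2), g x = extZero f.1 x := by
    intro x hx
    have h1 : χ x = 1 := χ.one_of_mem_closedBall (Metric.ball_subset_closedBall hx)
    change (χ x : ℂ) * _ = _
    rw [h1, Complex.ofReal_one, one_mul]
  refine ⟨C, fun r p x h0 hr hn hrε hx hp => ?_⟩
  rw [ofSmooth_apply_cutTranslate f hp (vanishesOff_delta d h0) (g := g),
    ← hgf x (Metric.ball_subset_ball (by linarith) hx)]
  · exact norm_integral_delta_mul_sub_le h0 hr hn hg x fun z _ => hC z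
  · intro ξ hξ
    refine hgf ξ ?_
    rw [Metric.mem_ball] at *
    have := dist_triangle ξ x x₀
    linarith

/-! ### Pairing regularizations with test functions -/

/-- The factor `χ y` keeps the translates of `φ` inside one compact subset of `Ω` for all `y`,
without changing them for small `y`. -/
theorem mul_translate_eq_zero (φ : 𝓓(Ω, ℂ)) (χ : ContDiffBump (0 : Vec d)) (y : Vec d) {ξ : Vec d}
    (hξ : ξ ∉ Metric.cthickening χ.rOut (tsupport φ)) : (χ y : ℂ) * φ (ξ + y) = 0 := by
  by_contra hn
  have h1 : φ (ξ + y) ≠ 0 := right_ne_zero_of_mul hn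
  have h2 : χ y ≠ 0 := fun h => left_ne_zero_of_mul hn (by rw [h, Complex.ofReal_zero])
  have h3 : dist y 0 < χ.rOut := not_le.1 fun h => h2 (χ.zero_of_le_dist h)
  refine hξ (Metric.mem_cthickening_of_dist_le ξ (ξ + y) _ _ (subset_tsupport φ h1) ?_)
  simpa using h3.le

/-- The test function `ξ ↦ χ(y) φ(ξ + y)`. -/
def translateTest (φ : 𝓓(Ω, ℂ)) (χ : ContDiffBump (0 : Vec d))
    (h : Metric.cthickening χ.rOut (tsupport φ) ⊆ Ω) (y : Vec d) : 𝓓(Ω, ℂ) where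
  toFun ξ := (χ y : ℂ) * φ (ξ + y)
  contDiff' := contDiff_const.mul (φ.contDiff.comp (contDiff_id.add contDiff_const))
  hasCompactSupport' := (φ.hasCompactSupport.isCompact.cthickening).of_isClosed_subset
    (isClosed_tsupport _) (tsupport_subset_of_forall_eq_zero Metric.isClosed_cthickening
      fun _ => mul_translate_eq_zero φ χ y)
  tsupport_subset' := (tsupport_subset_of_forall_eq_zero Metric.isClosed_cthickening
    fun _ => mul_translate_eq_zero φ χ y).trans h

section Pairing

variable (φ : 𝓓(Ω, ℂ)) (χ : ContDiffBump (0 : Vec d))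
  (h : Metric.cthickening χ.rOut (tsupport φ) ⊆ Ω)

/-- The closed neighbourhood of the support of a test function as a compact set. -/
def suppThickening : Compacts (Vec d) :=
  ⟨Metric.cthickening χ.rOut (tsupport φ), φ.hasCompactSupport.isCompact.cthickening⟩

theorem tsupport_translateTest (y : Vec d) :
    tsupport (translateTest φ χ h y) ⊆ suppThickening φ χ :=
  tsupport_subset_of_forall_eq_zero Metric.isClosed_cthickening
    fun _ => mul_translate_eq_zero φ χ y

theorem contDiff_translateTest :
    ContDiff ℝ ∞ fun z : Vec d × Vec d => translateTest φ χ h z.1 z.2 :=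
  (Complex.ofRealCLM.contDiff.comp (χ.contDiff.comp contDiff_fst)).mul
    (φ.contDiff.comp (contDiff_snd.add contDiff_fst))

theorem translateTest_zero : translateTest φ χ h 0 = φ := by
  ext ξ
  have h1 : χ 0 = 1 := χ.one_of_mem_closedBall (Metric.mem_closedBall_self χ.rIn_pos.le)
  change (χ 0 : ℂ) * φ (ξ + 0) = φ ξ
  rw [h1, Complex.ofReal_one, one_mul, add_zero]

/-- Substitution `x = y + ξ`. Wherever `f(y) φ(ξ + y) ≠ 0`, both inserted factors `p ξ` and `χ y`
equal 1. -/
theorem integral_mul_extZero_sub (f : Smooth (⊤ : Opens (Vec d))) {p : 𝓓(Ω, ℂ)} {r : ℝ}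
    (hr : r ≤ χ.rIn) (hp : ∀ ξ ∈ Metric.cthickening χ.rOut (tsupport φ), p ξ = 1)
    (hf : VanishesOff f r) (ξ : Vec d) :
    ∫ x in tsupport φ, φ x * (p ξ * extZero f.1 (x - ξ)) =
      ∫ y in Metric.closedBall (0 : Vec d) χ.rOut, extZero f.1 y * translateTest φ χ h y ξ := by
  rw [setIntegral_eq_integral_of_forall_compl_eq_zero, setIntegral_eq_integral_of_forall_compl_eq_zero,
    ← integral_add_right_eq_self _ ξ]
  · refine integral_congr_ae (.of_forall fun y => ?_)
    change φ (y + ξ) * (p ξ * extZero f.1 (y + ξ - ξ)) = extZero f.1 y * ((χ y : ℂ) * φ (ξ + y))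
    rw [add_sub_cancel_right, add_comm y ξ]
    by_cases hy : extZero f.1 y = 0
    · simp [hy]
    · have hyr : ‖y‖ < r := not_le.1 fun hn => hy (hf y hn)
      have h1 : χ y = 1 := χ.one_of_mem_closedBall (by simpa using (hyr.trans_le hr).le)
      by_cases hφ : φ (ξ + y) = 0
      · simp [hφ]
      · rw [hp ξ (Metric.mem_cthickening_of_dist_le ξ (ξ + y) _ _ (subset_tsupport φ hφ) ?_), h1,
          Complex.ofReal_one]
        · ring
        · have := χ.rIn_lt_rOut
          rw [dist_self_add_right]
          linarith
  · intro y hy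
    rw [Metric.mem_closedBall, dist_zero_right, not_le] at hy
    rw [hf y ((hr.trans χ.rIn_lt_rOut.le).trans hy.le), zero_mul]
  · intro x hx
    rw [image_eq_zero_of_notMem_tsupport hx, zero_mul]

/-- Integrating a regularization of `T` against `φ` means to apply `T` to a regularization
of `φ`. -/
theorem integral_mul_regularize (T : Distr Ω) (f : Smooth (⊤ : Opens (Vec d))) {p : 𝓓(Ω, ℂ)} {r : ℝ}
    (hr : r ≤ χ.rIn) (hp : ∀ ξ ∈ Metric.cthickening χ.rOut (tsupport φ), p ξ = 1)
    (hf : VanishesOff f r) :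
    ∫ x in tsupport φ, φ x * T (cutTranslate p f x) =
      ∫ y, extZero f.1 y * T (translateTest φ χ h y) := by
  have hu1 : ContDiff ℝ ∞ fun z : Vec d × Vec d => (φ z.1 • cutTranslate p f z.1) z.2 :=
    (φ.contDiff.comp contDiff_fst).mul (contDiff_cutTranslate p f)
  have hu2 : ContDiff ℝ ∞ fun z : Vec d × Vec d => (extZero f.1 z.1 • translateTest φ χ h z.1) z.2 :=
    ((Smooth.contDiff_extZero f).comp contDiff_fst).mul (contDiff_translateTest φ χ h)
  have hs1 : ∀ x, tsupport (φ x • cutTranslate p f x) ⊆ suppCompacts p := fun x =>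
    tsupport_subset_of_forall_eq_zero (isClosed_tsupport p) fun ξ hξ => by
      change φ x * cutTranslate p f x ξ = 0
      rw [eq_zero_of_tsupport_subset (tsupport_cutTranslate p f x) hξ, mul_zero]
  have hs2 : ∀ y, tsupport (extZero f.1 y • translateTest φ χ h y) ⊆ suppThickening φ χ := fun y =>
    tsupport_subset_of_forall_eq_zero Metric.isClosed_cthickening fun ξ hξ => by
      change extZero f.1 y * translateTest φ χ h y ξ = 0
      rw [eq_zero_of_tsupport_subset (tsupport_translateTest φ χ h y) hξ, mul_zero]
  have hK : IsCompact (tsupport φ) := φ.hasCompactSupport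
  -- `w` is the regularized `φ`. It is an integral of test functions in two ways, over `x` and over
  -- `y`; moving `T` under each integral gives the two sides.
  let w : 𝓓(Ω, ℂ) :=
    { toFun := fun ξ => ∫ x in tsupport φ, (φ x • cutTranslate p f x) ξ
      contDiff' := contDiff_setIntegral (u := fun x ξ => (φ x • cutTranslate p f x) ξ) hu1 hK
      hasCompactSupport' := p.hasCompactSupport.isCompact.of_isClosed_subset (isClosed_tsupport _)
        (tsupport_subset_of_forall_eq_zero (isClosed_tsupport p) fun ξ hξ => by
          simp only [eq_zero_of_tsupport_subset (hs1 _) hξ, integral_zero])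
      tsupport_subset' := (tsupport_subset_of_forall_eq_zero (isClosed_tsupport p) fun ξ hξ => by
          simp only [eq_zero_of_tsupport_subset (hs1 _) hξ, integral_zero]).trans p.tsupport_subset }
  have h1 : T w = ∫ x in tsupport φ, T (φ x • cutTranslate p f x) :=
    distribution_setIntegral T hu1 (suppCompacts_subset p) hs1 hK fun ξ => rfl
  have h2 : T w = ∫ y in Metric.closedBall (0 : Vec d) χ.rOut,
      T (extZero f.1 y • translateTest φ χ h y) :=
    distribution_setIntegral T hu2 h hs2 (isCompact_closedBall _ _)
      fun ξ => integral_mul_extZero_sub φ χ h f hr hp hf ξ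
  simp only [map_smul, smul_eq_mul] at h1 h2
  rw [← h1, h2, setIntegral_eq_integral_of_forall_compl_eq_zero]
  intro y hy
  rw [Metric.mem_closedBall, dist_zero_right, not_le] at hy
  rw [hf y ((hr.trans χ.rIn_lt_rOut.le).trans hy.le), zero_mul]

end Pairing

/-- The regularizations converge weakly. -/
theorem exists_norm_integral_mul_regularize_sub_le (T : Distr Ω) (φ : 𝓓(Ω, ℂ)) {ε : ℝ} (hε : 0 < ε)
    (h : Metric.cthickening ε (tsupport φ) ⊆ Ω) : ∃ C : ℝ, ∀ (r : ℝ) (p : 𝓓(Ω, ℂ)),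
      0 < r → r ≤ 1 / 2 → 1 ≤ order r → r ≤ ε / 2 →
      (∀ ξ ∈ Metric.cthickening ε (tsupport φ), p ξ = 1) →
      ‖(∫ x in tsupport φ, φ x * T (cutTranslate p (delta d r) x)) - T φ‖ ≤ C * r := by
  let χ : ContDiffBump (0 : Vec d) := ⟨ε / 2, ε, by linarith, by linarith⟩
  -- The reflection makes `g (0 - y)` the pairing with the translate by `y`, so the mollifier
  -- estimate for `g` at 0 compares the integral with `g 0 = T φ`.
  let g : Vec d → ℂ := fun z => T (translateTest φ χ h (-z))
  have hg : ContDiff ℝ ∞ g := (contDiff_distribution_family (contDiff_translateTest φ χ h)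
    (K := suppThickening φ χ) h (tsupport_translateTest φ χ h) T).comp contDiff_neg
  obtain ⟨C, hC⟩ := (isCompact_closedBall (0 : Vec d) 1).exists_bound_of_continuousOn
    (hg.continuous_iteratedFDeriv (m := 1 + 1) (by norm_cast)).continuousOn
  refine ⟨C, fun r p h0 hr ho hrε hp => ?_⟩
  rw [integral_mul_regularize φ χ h T (delta d r) hrε hp (vanishesOff_delta d h0)]
  have := norm_integral_delta_mul_sub_le h0 hr ho hg 0 fun z hz =>
    hC z (Metric.closedBall_subset_closedBall (by linarith) hz)
  simpa only [g, zero_sub, neg_neg, neg_zero, translateTest_zero, pow_one] using this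

/-- The cut-off functions are eventually equal to `1` on any given compact set. -/
theorem exists_forall_isCompact_le_dist {L : Set (Vec d)} (hL : IsCompact L) (h : L ⊆ Ω) :
    ∃ δ > 0, ∀ r : ℝ, 0 < r → r ≤ δ → ∀ x ∈ L, ‖x‖ ≤ r⁻¹ ∧ ∀ y ∉ Ω, 3 * r ≤ dist x y := by
  obtain ⟨δ, hδ, hδΩ⟩ := hL.exists_cthickening_subset_open Ω.isOpen h
  obtain ⟨R, hR⟩ := hL.isBounded.exists_norm_le
  -- The first bound gives `3 * r ≤ δ`, the second `|R| + 1 ≤ r⁻¹`, matching the two conditions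
  -- under which the cut-off is 1.
  refine ⟨min (δ / 3) (|R| + 1)⁻¹, by positivity, fun r h0 hr x hx => ⟨?_, fun y hy => ?_⟩⟩
  · refine (hR x hx).trans (((le_abs_self R).trans (le_add_of_nonneg_right zero_le_one)).trans ?_)
    exact (le_inv_comm₀ (by positivity) h0).2 (hr.trans (min_le_right _ _))
  · by_contra hn
    have := hr.trans (min_le_left _ _)
    refine hy (hδΩ (Metric.mem_cthickening_of_dist_le y x δ L hx ?_))
    rw [dist_comm]
    linarith

end

section

variable {I : Type*} {U : Ultrafilter I} {d : ℕ} {Ω : Opens (Vec d)}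

/-! ### Representatives -/

theorem IsInfinitesimal.tendsto {E : Type*} [NormedAddCommGroup E] {x : I → E} {x₀ : E}
    (h : IsInfinitesimal ((x : Star U E) - (x₀ : Star U E))) : Tendsto x U (nhds x₀) := by
  refine Metric.tendsto_nhds.2 fun ε hε => ?_
  obtain ⟨n, hn⟩ := exists_nat_one_div_lt hε
  have h' : ∀ᶠ i in (U : Filter I), ‖x i - x₀‖ < 1 / ((n : ℝ) + 1) := Germ.coe_lt.1 (h n)
  filter_upwards [h'] with i hi
  rw [dist_eq_norm]
  exact hi.trans hn

/-- Infinitesimal closeness to a standard point is convergence of representatives along `U`, which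
turns statements on monads into limits. -/
theorem coe_mem_monad {x : I → Vec d} {X : Set (Vec d)} :
    (x : Star U (Vec d)) ∈ monad U X ↔ ∃ x₀ ∈ X, Tendsto x U (nhds x₀) := by
  refine ⟨fun ⟨x₀, h0, h⟩ => ⟨x₀, h0, h.tendsto⟩, fun ⟨x₀, h0, h⟩ => ⟨x₀, h0, fun n => ?_⟩⟩
  have h' := Metric.tendsto_nhds.1 h (1 / ((n : ℝ) + 1)) (by positivity)
  refine Germ.coe_lt.2 (h'.mono fun i hi => ?_)
  rwa [dist_eq_norm] at hi

/-- Resetting a representative to `1 / 2` at the bad indices does not change the germ. The bounds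
then hold at every index, so the mollifier estimates apply without exceptions. -/
theorem PosInfinitesimal.exists_rep (ρ : PosInfinitesimal U) : ∃ r : I → ℝ,
    ρ.1 = (r : Star U ℝ) ∧ (∀ i, 0 < r i) ∧ (∀ i, r i ≤ 1 / 2) ∧ Tendsto r U (nhds 0) := by
  obtain ⟨s, hs⟩ : ∃ s : I → ℝ, (s : Star U ℝ) = ρ.1 := Quotient.exists_rep ρ.1
  have h0 : ∀ᶠ i in (U : Filter I), 0 < s i := by
    have := ρ.2.1
    rw [← hs] at this
    exact Germ.coe_lt.1 this
  have ht : Tendsto s U (nhds 0) := by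
    have := ρ.2.2
    rw [← hs, ← sub_zero (s : Star U ℝ)] at this
    exact IsInfinitesimal.tendsto this
  have h1 : ∀ᶠ i in (U : Filter I), s i ≤ 1 / 2 :=
    (ht.eventually (Iio_mem_nhds (by norm_num : (0 : ℝ) < 1 / 2))).mono fun i hi => le_of_lt hi
  have he : ∀ᶠ i in (U : Filter I), s i = if 0 < s i ∧ s i ≤ 1 / 2 then s i else 1 / 2 := by
    filter_upwards [h0, h1] with i h0 h1
    rw [if_pos ⟨h0, h1⟩]
  refine ⟨fun i => if 0 < s i ∧ s i ≤ 1 / 2 then s i else 1 / 2, ?_, fun i => ?_, fun i => ?_,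
    ht.congr' he⟩
  · rw [← hs]
    exact Germ.coe_eq.2 he
  · beta_reduce
    split_ifs with h
    · exact h.1
    · norm_num
  · beta_reduce
    split_ifs with h
    · exact h.2
    · norm_num

/-- A representative of a positive infinitesimal. -/
def PosInfinitesimal.rep (ρ : PosInfinitesimal U) : I → ℝ := ρ.exists_rep.choose

section Rep

variable (ρ : PosInfinitesimal U)

theorem PosInfinitesimal.coe_rep : ρ.1 = (ρ.rep : Star U ℝ) := ρ.exists_rep.choose_spec.1

theorem PosInfinitesimal.rep_pos (i : I) : 0 < ρ.rep i := ρ.exists_rep.choose_spec.2.1 i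

theorem PosInfinitesimal.rep_le (i : I) : ρ.rep i ≤ 1 / 2 := ρ.exists_rep.choose_spec.2.2.1 i

theorem PosInfinitesimal.tendsto_rep : Tendsto ρ.rep U (nhds 0) :=
  ρ.exists_rep.choose_spec.2.2.2

theorem PosInfinitesimal.eventually_rep_le {ε : ℝ} (hε : 0 < ε) :
    ∀ᶠ i in (U : Filter I), ρ.rep i ≤ ε :=
  (ρ.tendsto_rep.eventually (Iio_mem_nhds hε)).mono fun _ hi => le_of_lt hi

theorem PosInfinitesimal.eventually_le_inv_rep (C : ℝ) :
    ∀ᶠ i in (U : Filter I), C ≤ (ρ.rep i)⁻¹ := by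
  filter_upwards [ρ.eventually_rep_le (ε := (|C| + 1)⁻¹) (by positivity)] with i hi
  refine ((le_abs_self C).trans (le_add_of_nonneg_right zero_le_one)).trans ?_
  exact (le_inv_comm₀ (by positivity) (ρ.rep_pos i)).2 hi

theorem PosInfinitesimal.eventually_le_order (n : ℕ) :
    ∀ᶠ i in (U : Filter I), n ≤ order (ρ.rep i) :=
  (ρ.eventually_le_inv_rep _).mono fun _ hi => le_order hi

theorem coe_mem_moderateNum {z : I → ℂ} : (z : Star U ℂ) ∈ ModerateNum ρ ↔
    ∃ n : ℕ, ∀ᶠ i in (U : Filter I), ‖z i‖ ≤ (ρ.rep i)⁻¹ ^ n := by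
  unfold ModerateNum
  rw [Set.mem_ofPred_eq, ρ.coe_rep]
  rfl

theorem coe_mem_negligibleNum {z : I → ℂ} : (z : Star U ℂ) ∈ NegligibleNum ρ ↔
    ∀ n : ℕ, ∀ᶠ i in (U : Filter I), ‖z i‖ ≤ ρ.rep i ^ n := by
  unfold NegligibleNum
  rw [Set.mem_ofPred_eq, ρ.coe_rep]
  rfl

/-- A standard constant is absorbed by one extra factor `ρ⁻¹`. -/
theorem coe_mem_moderateNum_of_le {z : I → ℂ} (C : ℝ) (n : ℕ)
    (h : ∀ᶠ i in (U : Filter I), ‖z i‖ ≤ C * (ρ.rep i)⁻¹ ^ n) :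
    (z : Star U ℂ) ∈ ModerateNum ρ := by
  refine (coe_mem_moderateNum ρ).2 ⟨n + 1, ?_⟩
  filter_upwards [h, ρ.eventually_le_inv_rep C] with i h1 h2
  have := ρ.rep_pos i
  rw [pow_succ']
  exact h1.trans (mul_le_mul_of_nonneg_right h2 (by positivity))

/-- The estimate with exponent `n + 1` leaves one factor `ρ` to absorb its constant, which may
depend on `n`. -/
theorem coe_mem_negligibleNum_of_le {z : I → ℂ}
    (h : ∀ n : ℕ, ∃ C : ℝ, ∀ᶠ i in (U : Filter I), ‖z i‖ ≤ C * ρ.rep i ^ n) :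
    (z : Star U ℂ) ∈ NegligibleNum ρ := by
  refine (coe_mem_negligibleNum ρ).2 fun n => ?_
  obtain ⟨C, hC⟩ := h (n + 1)
  filter_upwards [hC, ρ.eventually_le_inv_rep C] with i h1 h2
  have := ρ.rep_pos i
  refine h1.trans ((mul_le_mul_of_nonneg_right h2 (by positivity)).trans_eq ?_)
  rw [pow_succ]
  field_simp

end Rep

theorem eval_of (F : I → Smooth Ω) (x : I → Vec d) :
    eval (StarE.of U F) (x : Star U (Vec d)) = ((fun i => extZero (F i).1 (x i) : I → ℂ) : Star U ℂ) :=
  rfl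

theorem eval_sub (f g : StarE U Ω) {x : Star U (Vec d)} (hx : x ∈ starSet U (Ω : Set (Vec d))) :
    eval (f - g) x = eval f x - eval g x := by
  rw [eq_sub_iff_add_eq, ← eval_add _ _ hx, sub_add_cancel]

theorem multiDeriv_of (α : Fin d → ℕ) (F : I → Smooth Ω) :
    multiDeriv starPderiv α (StarE.of U F) =
      StarE.of U fun i => multiDeriv Smooth.pderiv α (F i) := by
  induction α using multiIndex_induction with
  | h0 => simp only [multiDeriv_zero, Module.End.one_apply]
  | hs α j ih =>
    rw [multiDeriv_add_single _ starPderiv_commute,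
      multiDeriv_add_single _ Smooth.pderiv_commute, Module.End.mul_apply, ih]
    rfl

/-! ### Locally equal families of functions -/

/-- Locally, almost all members of the families `F` and `G` coincide. -/
def LocEq (U : Ultrafilter I) (F G : I → Smooth Ω) : Prop :=
  ∀ x₀ ∈ Ω, ∀ᶠ z in (U : Filter I) ×ˢ nhds x₀, extZero (F z.1).1 z.2 = extZero (G z.1).1 z.2

/-- The product filter supplies a neighbourhood independent of the index. At its interior points
equality of functions is equality of germs, hence of derivatives. -/
theorem LocEq.pderiv {F G : I → Smooth Ω} (h : LocEq U F G) (j : Fin d) :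
    LocEq U (fun i => Smooth.pderiv j (F i)) fun i => Smooth.pderiv j (G i) := by
  intro x₀ hx₀
  obtain ⟨A, hA, B, hB, hAB⟩ := eventually_prod_iff.1 (h x₀ hx₀)
  refine eventually_prod_iff.2 ⟨A, hA, fun x => (∀ᶠ y in nhds x, B y) ∧ x ∈ Ω,
    hB.eventually_nhds.and (Ω.isOpen.mem_nhds hx₀), fun {i} hi {x} hx => ?_⟩
  change extZero _ x = extZero _ x
  rw [extZero_mem _ hx.2, extZero_mem _ hx.2, Smooth.pderiv_apply, Smooth.pderiv_apply,
    EventuallyEq.fderiv_eq (f := extZero (G i).1) (hx.1.mono fun y hy => hAB hi hy)]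

theorem LocEq.multiDeriv {F G : I → Smooth Ω} (h : LocEq U F G) (α : Fin d → ℕ) :
    LocEq U (fun i => multiDeriv Smooth.pderiv α (F i)) fun i => multiDeriv Smooth.pderiv α (G i) := by
  induction α using multiIndex_induction with
  | h0 => simpa only [multiDeriv_zero, Module.End.one_apply] using h
  | hs α j ih =>
    simp only [multiDeriv_add_single _ Smooth.pderiv_commute, Module.End.mul_apply]
    exact ih.pderiv j

theorem LocEq.eval_multiDeriv {F G : I → Smooth Ω} (h : LocEq U F G) (α : Fin d → ℕ)
    {x : Star U (Vec d)} (hx : x ∈ monad U (Ω : Set (Vec d))) :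
    eval (RhoAsymptotic.multiDeriv starPderiv α (StarE.of U F)) x =
      eval (RhoAsymptotic.multiDeriv starPderiv α (StarE.of U G)) x := by
  induction x using Germ.inductionOn with | _ x =>
  obtain ⟨x₀, hx₀, ht⟩ := coe_mem_monad.1 hx
  rw [multiDeriv_of, multiDeriv_of, eval_of, eval_of]
  exact Germ.coe_eq.2 ((tendsto_id.prodMk ht).eventually (h.multiDeriv α x₀ hx₀))

theorem LocEq.isNegligible_sub (ρ : PosInfinitesimal U) {F G : I → Smooth Ω} (h : LocEq U F G) :
    IsNegligible ρ (StarE.of U F - StarE.of U G) := by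
  intro α x hx
  rw [map_sub, eval_sub _ _ (monad_subset_starSet Ω hx), h.eval_multiDeriv α hx, sub_self]
  exact NegligibleNum.zero ρ

/-! ### The cut-off and delta functions -/

open Classical in
/-- The members of the net of cut-off functions. -/
def cutoff (Ω : Opens (Vec d)) (r : ℝ) : 𝓓(Ω, ℂ) :=
  if hr : 0 < r then (exists_cutoff Ω hr).choose else 0

theorem cutoff_eq_one {r : ℝ} (hr : 0 < r) {x : Vec d} (hx : ‖x‖ ≤ r⁻¹)
    (h : ∀ y ∉ Ω, 3 * r ≤ dist x y) : cutoff Ω r x = 1 := by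
  rw [cutoff, dif_pos hr]
  exact (exists_cutoff Ω hr).choose_spec.1 x hx h

theorem le_norm_sub_of_mem_tsupport_cutoff {r : ℝ} (hr : 0 < r) {x y : Vec d}
    (hx : x ∈ tsupport (cutoff Ω r)) (hy : y ∈ frontier (Ω : Set (Vec d))) : r ≤ ‖x - y‖ := by
  rw [cutoff, dif_pos hr] at hx
  exact (exists_cutoff Ω hr).choose_spec.2 x hx y hy

theorem eventually_cutoff_eq_one (ρ : PosInfinitesimal U) {L : Set (Vec d)} (hL : IsCompact L)
    (h : L ⊆ Ω) : ∀ᶠ i in (U : Filter I), ∀ x ∈ L, cutoff Ω (ρ.rep i) x = 1 := by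
  obtain ⟨δ, hδ, hb⟩ := exists_forall_isCompact_le_dist hL h
  filter_upwards [ρ.eventually_rep_le hδ] with i hi x hx
  have := hb _ (ρ.rep_pos i) hi x hx
  exact cutoff_eq_one (ρ.rep_pos i) this.1 this.2

theorem exists_closedBall_subset {x₀ : Vec d} (h : x₀ ∈ Ω) :
    ∃ ε > 0, Metric.closedBall x₀ ε ⊆ (Ω : Set (Vec d)) :=
  Metric.nhds_basis_closedBall.mem_iff.1 (Ω.isOpen.mem_nhds h)

/-- The radius `2ρ` leaves the strict margin over the support radius `ρ` of the delta function that
`pderiv_apply_cutTranslate` needs. The balls fit because `ε / 2 + 2 * (ε / 4) = ε`. -/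
theorem eventually_isOneNear (ρ : PosInfinitesimal U) {x₀ : Vec d} {ε : ℝ} (hε : 0 < ε)
    (h : Metric.closedBall x₀ ε ⊆ (Ω : Set (Vec d))) : ∀ᶠ i in (U : Filter I),
      ∀ x ∈ Metric.ball x₀ (ε / 2), IsOneNear (cutoff Ω (ρ.rep i)) x (2 * ρ.rep i) := by
  filter_upwards [eventually_cutoff_eq_one ρ (isCompact_closedBall x₀ ε) h,
    ρ.eventually_rep_le (ε := ε / 4) (by linarith)] with i h1 h2 x hx ξ hξ
  refine h1 ξ ?_
  rw [Metric.mem_ball] at hx hξ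
  have := dist_triangle ξ x x₀
  rw [Metric.mem_closedBall]
  linarith

theorem eventually_prod_isOneNear (ρ : PosInfinitesimal U) {x₀ : Vec d} (h : x₀ ∈ Ω) :
    ∀ᶠ z in (U : Filter I) ×ˢ nhds x₀,
      z.2 ∈ Ω ∧ IsOneNear (cutoff Ω (ρ.rep z.1)) z.2 (2 * ρ.rep z.1) := by
  obtain ⟨ε, hε, hb⟩ := exists_closedBall_subset h
  refine (Eventually.prod_inr (p := fun x => x ∈ Ω) (Ω.isOpen.mem_nhds h) _).and ?_
  exact eventually_prod_iff.2 ⟨_, eventually_isOneNear ρ hε hb, fun x => x ∈ Metric.ball x₀ (ε / 2),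
    Metric.ball_mem_nhds x₀ (by linarith), fun hi _ hx => hi _ hx⟩

/-- The `ρ`-cut-off function. -/
def starCutoff (ρ : PosInfinitesimal U) (Ω : Opens (Vec d)) : Star U 𝓓(Ω, ℂ) :=
  ((fun i => cutoff Ω (ρ.rep i) : I → 𝓓(Ω, ℂ)) : Star U 𝓓(Ω, ℂ))

theorem isRhoCutoff_starCutoff (ρ : PosInfinitesimal U) (Ω : Opens (Vec d)) :
    IsRhoCutoff ρ (starCutoff ρ Ω) where
  eq_one x hx := by
    induction x using Germ.inductionOn with | _ x =>
    obtain ⟨x₀, hx₀, ht⟩ := coe_mem_monad.1 hx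
    refine Germ.coe_eq.2 (((tendsto_id.prodMk ht).eventually
      (eventually_prod_isOneNear ρ hx₀)).mono fun i hi => ?_)
    exact hi.2 (x i) (Metric.mem_ball_self (mul_pos two_pos (ρ.rep_pos i)))
  support x hx y hy := by
    induction x using Germ.inductionOn with | _ x =>
    induction y using Germ.inductionOn with | _ y =>
    rw [ρ.coe_rep]
    have hx' : ∀ᶠ i in (U : Filter I), x i ∈ tsupport (cutoff Ω (ρ.rep i)) := hx
    have hy' : ∀ᶠ i in (U : Filter I), y i ∈ frontier (Ω : Set (Vec d)) := hy
    refine Germ.coe_le.2 ((hx'.and hy').mono fun i hi => ?_)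
    exact le_norm_sub_of_mem_tsupport_cutoff (ρ.rep_pos i) hi.1 hi.2

/-- The `ρ`-delta function. -/
def starDelta (ρ : PosInfinitesimal U) (d : ℕ) : StarE U (⊤ : Opens (Vec d)) :=
  StarE.of U fun i => delta d (ρ.rep i)

theorem setIntegral_delta_mul {r : ℝ} (hr : 0 < r) (g : Vec d → ℂ) :
    ∫ x in Metric.closedBall (0 : Vec d) r, extZero (delta d r).1 x * g x =
      ∫ x, mollifier d (order r) r x * g x := by
  rw [extZero_delta, setIntegral_eq_integral_of_forall_compl_eq_zero]
  intro x hx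
  rw [Metric.mem_closedBall, dist_zero_right, not_le] at hx
  rw [mollifier_eq_zero hr hx.le, zero_mul]

theorem setIntegral_delta {r : ℝ} (hr : 0 < r) :
    ∫ x in Metric.closedBall (0 : Vec d) r, extZero (delta d r).1 x = 1 := by
  have h := setIntegral_delta_mul (d := d) hr fun _ => 1
  rw [integral_mollifier_mul_homogeneous (Nat.zero_le _) hr continuous_const (by simp)] at h
  simpa [integral_ofReal_bump] using h

/-- The monomial is homogeneous of degree `∑ i, α i > 0`, so its moment vanishes exactly once the
order has reached that degree. -/
theorem setIntegral_delta_mul_monomial {r : ℝ} (hr : 0 < r) {α : Fin d → ℕ} (hα : α ≠ 0)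
    (ho : ∑ i, α i ≤ order r) :
    ∫ x in Metric.closedBall (0 : Vec d) r, extZero (delta d r).1 x * ∏ i, (x i : ℂ) ^ α i = 0 := by
  rw [setIntegral_delta_mul hr, integral_mollifier_mul_homogeneous ho hr, zero_pow, zero_mul]
  · contrapose! hα
    ext i
    simpa using (Finset.sum_eq_zero_iff.1 hα) i (Finset.mem_univ i)
  · fun_prop
  · intro t y
    simp [mul_pow, Finset.prod_mul_distrib, Finset.prod_pow_eq_pow_sum]

theorem norm_unitVec_le (j : Fin d) : ‖unitVec j‖ ≤ 1 := by
  simp [unitVec]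

/-- The induction produces `n = |α|`; evaluating derivatives at unit vectors does not increase their
norm. -/
theorem exists_norm_multiDeriv_le (α : Fin d → ℕ) : ∃ n : ℕ,
    ∀ (f : Smooth (⊤ : Opens (Vec d))) (B : ℝ), (∀ y, ‖iteratedFDeriv ℝ n (extZero f.1) y‖ ≤ B) →
      ∀ x, ‖extZero (multiDeriv Smooth.pderiv α f).1 x‖ ≤ B := by
  induction α using multiIndex_induction with
  | h0 =>
    refine ⟨0, fun f B h x => ?_⟩
    simpa only [multiDeriv_zero, Module.End.one_apply, norm_iteratedFDeriv_zero] using h x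
  | hs α j ih =>
    obtain ⟨n, hn⟩ := ih
    refine ⟨n + 1, fun f B h x => ?_⟩
    rw [multiDeriv_add_single _ Smooth.pderiv_commute,
      (commute_multiDeriv _ Smooth.pderiv_commute α j).eq, Module.End.mul_apply]
    refine hn _ B (fun y => ?_) x
    have he : extZero (Smooth.pderiv j f).1 = fun x => fderiv ℝ (extZero f.1) x (unitVec j) :=
      funext fun x => Smooth.extZero_pderiv_top f j x
    rw [he]
    refine le_trans ?_ (h y)
    rw [← norm_iteratedFDeriv_fderiv]
    have hf : ContDiff ℝ ∞ (fderiv ℝ (extZero f.1)) :=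
      (Smooth.contDiff_extZero f).fderiv_right (by simp)
    refine (norm_iteratedFDeriv_clm_apply_const hf.contDiffAt (by norm_cast; exact le_top)).trans ?_
    exact mul_le_of_le_one_left (norm_nonneg _) (norm_unitVec_le j)

theorem isModerate_starDelta (ρ : PosInfinitesimal U) : IsModerate ρ (starDelta ρ d) := by
  intro α x _
  induction x using Germ.inductionOn with | _ x =>
  obtain ⟨n, hn⟩ := exists_norm_multiDeriv_le α
  obtain ⟨M, -, hM⟩ := exists_norm_iteratedFDeriv_delta_le d n
  rw [starDelta, multiDeriv_of, eval_of]
  exact coe_mem_moderateNum_of_le ρ M _ (.of_forall fun i =>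
    hn _ _ (hM _ (ρ.rep_pos i) (ρ.rep_le i)) _)

theorem isRhoDelta_starDelta (ρ : PosInfinitesimal U) : IsRhoDelta ρ (starDelta ρ d) where
  eq_zero x hx := by
    induction x using Germ.inductionOn with | _ x =>
    rw [ρ.coe_rep] at hx
    refine Germ.coe_eq.2 ((Germ.coe_le.1 hx).mono fun i hi => ?_)
    exact vanishesOff_delta d (ρ.rep_pos i) _ hi
  integral := by
    rw [ρ.coe_rep]
    have h : Germ.map₂ (fun (f : Smooth (⊤ : Opens (Vec d))) (r : ℝ) =>
        ∫ x in Metric.closedBall (0 : Vec d) r, extZero f.1 x) (starDelta ρ d)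
          (ρ.rep : Star U ℝ) = 1 :=
      Germ.coe_eq.2 (.of_forall fun i => setIntegral_delta (ρ.rep_pos i))
    rw [h, sub_self]
    exact NegligibleNum.zero ρ
  moment α hα := by
    rw [ρ.coe_rep]
    have h : Germ.map₂ (fun (f : Smooth (⊤ : Opens (Vec d))) (r : ℝ) =>
        ∫ x in Metric.closedBall (0 : Vec d) r, extZero f.1 x * ∏ i, (x i : ℂ) ^ α i)
          (starDelta ρ d) (ρ.rep : Star U ℝ) = 0 :=
      Germ.coe_eq.2 ((ρ.eventually_le_order (∑ i, α i)).mono fun i hi =>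
        setIntegral_delta_mul_monomial (ρ.rep_pos i) hα hi)
    rw [h]
    exact NegligibleNum.zero ρ
  moderate := isModerate_starDelta ρ

end

section

variable {I : Type*} {U : Ultrafilter I} {d : ℕ} {Ω : Opens (Vec d)}

/-! ### The embedding -/

/-- The members of the net `(T Π_Ω) ⋆ D`. -/
def regNet (ρ : PosInfinitesimal U) (T : Distr Ω) (i : I) : Smooth Ω :=
  regularize T (cutoff Ω (ρ.rep i)) (delta d (ρ.rep i))

/-- The convolution `(T Π_Ω) ⋆ D`. -/
def starReg (ρ : PosInfinitesimal U) (T : Distr Ω) : StarE U Ω := StarE.of U (regNet ρ T)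

theorem isConvolution_starReg (ρ : PosInfinitesimal U) (T : Distr Ω) :
    IsConvolution T (starCutoff ρ Ω) (starDelta ρ d) (starReg ρ T) := by
  intro x hx
  induction x using Germ.inductionOn with | _ x =>
  have hx' : ∀ᶠ i in (U : Filter I), x i ∈ Ω := hx
  exact Germ.coe_eq.2 (hx'.mono fun i hi => extZero_regularize T _ _ hi)

/-- Differentiating the convolution puts the derivative on the delta function; integration by parts
does the same for the derivative of `T`, wherever the cut-off is 1. -/
theorem locEq_pderiv_regNet (ρ : PosInfinitesimal U) (j : Fin d) (T : Distr Ω) :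
    LocEq U (fun i => Smooth.pderiv j (regNet ρ T i)) (regNet ρ (Distr.pderiv j T)) := by
  intro x₀ hx₀
  filter_upwards [eventually_prod_isOneNear ρ hx₀] with z hz
  have hr := ρ.rep_pos z.1
  simp only [regNet]
  rw [pderiv_regularize, extZero_regularize _ _ _ hz.1, extZero_regularize _ _ _ hz.1,
    pderiv_apply_cutTranslate T (by linarith) hz.2 (vanishesOff_delta d hr)]

theorem locEq_restrict_regNet (ρ : PosInfinitesimal U) {O : Opens (Vec d)} (h : O ≤ Ω)
    (T : Distr Ω) :
    LocEq U (fun i => Smooth.restrict h (regNet ρ T i)) (regNet ρ (Distr.restrict h T)) := by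
  intro x₀ hx₀
  filter_upwards [eventually_prod_isOneNear ρ hx₀, eventually_prod_isOneNear ρ (h hx₀)] with z hz hz'
  have hr := ρ.rep_pos z.1
  simp only [regNet]
  rw [Smooth.extZero_restrict h _ hz.1, extZero_regularize _ _ _ hz.1,
    extZero_regularize _ _ _ hz'.1, restrict_apply_cutTranslate h T (hz'.2.mono (by linarith))
      (hz.2.mono (by linarith)) (vanishesOff_delta d hr)]

theorem eval_starReg_mem_moderateNum (ρ : PosInfinitesimal U) (T : Distr Ω) {x : Star U (Vec d)}
    (hx : x ∈ monad U (Ω : Set (Vec d))) : eval (starReg ρ T) x ∈ ModerateNum ρ := by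
  induction x using Germ.inductionOn with | _ x =>
  obtain ⟨x₀, hx₀, ht⟩ := coe_mem_monad.1 hx
  obtain ⟨ε, hε, hb⟩ := exists_closedBall_subset hx₀
  obtain ⟨N, C, hC, hT⟩ := norm_apply_cutTranslate_le T hb
  choose M hM0 hM using exists_norm_iteratedFDeriv_delta_le d
  rw [starReg, eval_of]
  -- The sum of the `M k` and the exponent belonging to `k = N` bound the derivatives of all orders
  -- `k ≤ N` at once, since `1 ≤ ρ⁻¹`.
  refine coe_mem_moderateNum_of_le ρ (C * ∑ k ∈ Finset.range (N + 1), M k) (2 * (d + N) + 1) ?_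
  filter_upwards [eventually_isOneNear ρ hε hb, ρ.eventually_rep_le (half_pos hε),
    ht.eventually (Metric.ball_mem_nhds x₀ (half_pos hε))] with i h1 h2 h3
  have hr := ρ.rep_pos i
  have hr1 : 1 ≤ (ρ.rep i)⁻¹ := (one_le_inv₀ hr).2 ((ρ.rep_le i).trans (by norm_num))
  have hxi : x i ∈ Ω := hb (Metric.ball_subset_closedBall
    (Metric.ball_subset_ball (by linarith) h3))
  rw [regNet, extZero_regularize _ _ _ hxi, mul_assoc]
  refine hT _ _ (x i) (ρ.rep i) _ h3 h2 ((h1 _ h3).mono (by linarith)) (vanishesOff_delta d hr)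
    (mul_nonneg (Finset.sum_nonneg fun k _ => hM0 k) (by positivity)) fun k hk y => ?_
  refine (hM k _ hr (ρ.rep_le i) y).trans ?_
  refine mul_le_mul (Finset.single_le_sum (fun k _ => hM0 k) (Finset.mem_range.2 (by omega)))
    (pow_le_pow_right₀ hr1 (by omega)) (by positivity) (Finset.sum_nonneg fun k _ => hM0 k)

theorem starPderiv_of (j : Fin d) (F : I → Smooth Ω) :
    starPderiv j (StarE.of U F) = StarE.of U fun i => Smooth.pderiv j (F i) := rfl

/-- Trades a derivative of the net for a derivative of `T`, which reduces estimates of all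
derivatives to estimates of values for all distributions. -/
theorem eval_multiDeriv_starReg (ρ : PosInfinitesimal U) (T : Distr Ω) (α : Fin d → ℕ) (j : Fin d)
    {x : Star U (Vec d)} (hx : x ∈ monad U (Ω : Set (Vec d))) :
    eval (multiDeriv starPderiv (α + Pi.single j 1) (starReg ρ T)) x =
      eval (multiDeriv starPderiv α (starReg ρ (Distr.pderiv j T))) x := by
  rw [multiDeriv_starPderiv, starReg, starPderiv_of,
    (locEq_pderiv_regNet ρ j T).eval_multiDeriv α hx, starReg]

theorem isModerate_starReg (ρ : PosInfinitesimal U) (T : Distr Ω) : IsModerate ρ (starReg ρ T) := by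
  intro α x hx
  induction α using multiIndex_induction generalizing T with
  | h0 =>
    rw [multiDeriv_zero, Module.End.one_apply]
    exact eval_starReg_mem_moderateNum ρ T hx
  | hs α j ih =>
    rw [eval_multiDeriv_starReg ρ T α j hx]
    exact ih _

/-- The embedding `D'(Ω) → ^ρE(Ω)`. -/
def embed (ρ : PosInfinitesimal U) (Ω : Opens (Vec d)) : Distr Ω →ₗ[ℂ] RhoE ρ Ω where
  toFun T := RhoE.mk ρ (starReg ρ T) (isModerate_starReg ρ T)
  -- `T` enters the convolution linearly, so linearity already holds for representatives.
  map_add' _ _ := rfl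
  map_smul' _ _ := rfl

theorem embed_apply (ρ : PosInfinitesimal U) (T : Distr Ω) :
    embed ρ Ω T = RhoE.mk ρ (starReg ρ T) (isModerate_starReg ρ T) := rfl

theorem embed_pderiv (ρ : PosInfinitesimal U) (j : Fin d) (T : Distr Ω) :
    embed ρ Ω (Distr.pderiv j T) = RhoE.pderiv j (embed ρ Ω T) := by
  rw [embed_apply, embed_apply, RhoE.pderiv_mk]
  exact (RhoE.mk_eq_mk.2 ((locEq_pderiv_regNet ρ j T).isNegligible_sub ρ)).symm

theorem embed_restrict (ρ : PosInfinitesimal U) {O : Opens (Vec d)} (h : O ≤ Ω) (T : Distr Ω) :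
    embed ρ O (Distr.restrict h T) = RhoE.restrict ρ h (embed ρ Ω T) := by
  rw [embed_apply, embed_apply, RhoE.restrict_mk]
  exact (RhoE.mk_eq_mk.2 ((locEq_restrict_regNet ρ h T).isNegligible_sub ρ)).symm

/-- For each `n` the error is at most `C * ρ ^ n` as soon as the order of the mollifier reaches `n`,
which happens for almost all indices. -/
theorem eval_starReg_ofSmooth_sub (ρ : PosInfinitesimal U) (f : Smooth Ω) {x : Star U (Vec d)}
    (hx : x ∈ monad U (Ω : Set (Vec d))) :
    eval (starReg ρ (Distr.ofSmooth f)) x - eval (StarE.standard U f) x ∈ NegligibleNum ρ := by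
  induction x using Germ.inductionOn with | _ x =>
  obtain ⟨x₀, hx₀, ht⟩ := coe_mem_monad.1 hx
  obtain ⟨ε, hε, hb⟩ := exists_closedBall_subset hx₀
  refine coe_mem_negligibleNum_of_le (z := fun i => extZero (regNet ρ (Distr.ofSmooth f) i).1 (x i) -
    extZero f.1 (x i)) ρ fun n => ?_
  obtain ⟨C, hC⟩ := exists_norm_ofSmooth_sub_le f hε hb n
  refine ⟨C, ?_⟩
  filter_upwards [eventually_isOneNear ρ hε hb, ρ.eventually_rep_le (ε := ε / 4) (by linarith),
    ht.eventually (Metric.ball_mem_nhds x₀ (by linarith : 0 < ε / 4)),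
    ρ.eventually_le_order n] with i h1 h2 h3 h4
  have hr := ρ.rep_pos i
  have h5 : x i ∈ Metric.ball x₀ (ε / 2) := Metric.ball_subset_ball (by linarith) h3
  have hxi : x i ∈ Ω := hb (Metric.ball_subset_closedBall
    (Metric.ball_subset_ball (by linarith) h3))
  rw [regNet, extZero_regularize _ _ _ hxi]
  exact hC _ _ _ hr (ρ.rep_le i) h4 h2 h3 ((h1 _ h5).mono (by linarith))

/-- Since the distributional derivative of `f` is given by the classical one, the value estimate for
the derivatives of `f` covers all multi-indices. -/
theorem isNegligible_starReg_ofSmooth_sub (ρ : PosInfinitesimal U) (f : Smooth Ω) :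
    IsNegligible ρ (starReg ρ (Distr.ofSmooth f) - StarE.standard U f) := by
  intro α x hx
  have hx' := monad_subset_starSet Ω hx
  rw [map_sub, eval_sub _ _ hx']
  induction α using multiIndex_induction generalizing f with
  | h0 =>
    rw [multiDeriv_zero, Module.End.one_apply, Module.End.one_apply]
    exact eval_starReg_ofSmooth_sub ρ f hx
  | hs α j ih =>
    rw [eval_multiDeriv_starReg ρ _ α j hx, pderiv_ofSmooth, multiDeriv_starPderiv]
    exact ih (Smooth.pderiv j f)

theorem embed_ofSmooth (ρ : PosInfinitesimal U) (f : Smooth Ω) :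
    embed ρ Ω (Distr.ofSmooth f) = RhoE.ofSmooth ρ f :=
  RhoE.mk_eq_mk.2 (isNegligible_starReg_ofSmooth_sub ρ f)

/-! ### Injectivity -/

theorem PosInfinitesimal.eq_zero_of_eventually_norm_le (ρ : PosInfinitesimal U) {z : ℂ} (C : ℝ)
    (h : ∀ᶠ i in (U : Filter I), ‖z‖ ≤ C * ρ.rep i) : z = 0 := by
  have ht : Tendsto (fun i => C * ρ.rep i) U (nhds 0) := by
    simpa using ρ.tendsto_rep.const_mul C
  exact norm_le_zero_iff.1 (ge_of_tendsto ht h)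

/-- At a standard point the difference of values is a standard number bounded by ρ, hence 0. -/
theorem ofSmooth_injective (ρ : PosInfinitesimal U) (Ω : Opens (Vec d)) :
    Function.Injective (RhoE.ofSmooth ρ (Ω := Ω)) := by
  intro f g hfg
  have h : IsNegligible ρ (StarE.standard U f - StarE.standard U g) := RhoE.mk_eq_mk.1 hfg
  refine Subtype.ext (funext fun x => ?_)
  have hx : ((fun _ => x.1 : I → Vec d) : Star U (Vec d)) ∈ monad U (Ω : Set (Vec d)) :=
    coe_mem_monad.2 ⟨x.1, x.2, tendsto_const_nhds⟩
  have h0 := h 0 _ hx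
  rw [multiDeriv_zero, Module.End.one_apply, eval_sub _ _ (monad_subset_starSet Ω hx)] at h0
  have h1 := (coe_mem_negligibleNum ρ (z := fun _ => extZero f.1 x - extZero g.1 x)).1 h0 1
  rw [← extZero_coe f.1, ← extZero_coe g.1, ← sub_eq_zero]
  exact ρ.eq_zero_of_eventually_norm_le 1 (h1.mono fun i hi => by simpa using hi)

/-- Negligible functions are uniformly small on compact sets. -/
theorem IsNegligible.eventually_norm_le {ρ : PosInfinitesimal U} {F : I → Smooth Ω}
    (h : IsNegligible ρ (StarE.of U F)) {K : Set (Vec d)} (hK : IsCompact K) (hKΩ : K ⊆ Ω) :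
    ∀ᶠ i in (U : Filter I), ∀ x ∈ K, ‖extZero (F i).1 x‖ ≤ ρ.rep i := by
  by_contra hn
  rw [← Ultrafilter.frequently_iff_eventually, not_frequently] at hn
  have hn' : ∀ᶠ i in (U : Filter I), ∃ x ∈ K, ρ.rep i < ‖extZero (F i).1 x‖ :=
    hn.mono fun i hi => by simpa using hi
  obtain ⟨x, hx⟩ := hn'.choice
  -- By compactness the bad points converge along `U` to some `x₀` in `K`. They thus represent a
  -- point of the monad of `Ω`, where negligibility with exponent 1 contradicts their choice.
  obtain ⟨x₀, hx₀, ht⟩ := hK.ultrafilter_le_nhds (U.map x)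
    (le_principal_iff.2 (hx.mono fun i hi => hi.1))
  have h0 := h 0 _ (coe_mem_monad.2 ⟨x₀, hKΩ hx₀, ht⟩)
  rw [multiDeriv_zero, Module.End.one_apply, eval_of] at h0
  have h1 := (coe_mem_negligibleNum ρ).1 h0 1
  obtain ⟨i, hi, hi'⟩ := (h1.and hx).exists
  rw [pow_one] at hi
  exact absurd hi (not_le.2 hi'.2)

/-- `T φ` differs from the pairing of the regularization with `φ` by at most `C * ρ`, and the
pairing itself is at most `ρ` times the supremum of `φ` and the volume of its support. A standard
number of size O(ρ) is 0. -/
theorem eq_zero_of_isNegligible_starReg (ρ : PosInfinitesimal U) {T : Distr Ω}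
    (h : IsNegligible ρ (starReg ρ T)) : T = 0 := by
  ext φ
  change T φ = 0
  have hK : IsCompact (tsupport φ) := φ.hasCompactSupport
  obtain ⟨ε, hε, hεΩ⟩ := hK.exists_cthickening_subset_open Ω.isOpen φ.tsupport_subset
  obtain ⟨C, hC⟩ := exists_norm_integral_mul_regularize_sub_le T φ hε hεΩ
  obtain ⟨B, hB⟩ := φ.hasCompactSupport.exists_bound_of_continuous φ.contDiff.continuous
  have hB0 : 0 ≤ B := (norm_nonneg _).trans (hB 0)
  refine ρ.eq_zero_of_eventually_norm_le (C + B * volume.real (tsupport φ)) ?_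
  filter_upwards [h.eventually_norm_le hK φ.tsupport_subset, ρ.eventually_le_order 1,
    ρ.eventually_rep_le (half_pos hε), eventually_cutoff_eq_one ρ hK.cthickening hεΩ]
    with i h1 h2 h3 h4
  have h5 := hC _ _ (ρ.rep_pos i) (ρ.rep_le i) h2 h3 h4
  have h6 := norm_setIntegral_le_of_norm_le_const (μ := volume) (C := B * ρ.rep i)
    (f := fun x => φ x * T (cutTranslate (cutoff Ω (ρ.rep i)) (delta d (ρ.rep i)) x))
    hK.measure_lt_top fun x hx => by
      rw [norm_mul, ← extZero_regularize _ _ _ (φ.tsupport_subset hx)]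
      exact mul_le_mul (hB x) (h1 x hx) (norm_nonneg _) hB0
  have h7 := norm_le_norm_add_norm_sub' (T φ)
    (∫ x in tsupport φ, φ x * T (cutTranslate (cutoff Ω (ρ.rep i)) (delta d (ρ.rep i)) x))
  rw [norm_sub_rev] at h7
  linarith

theorem embed_injective (ρ : PosInfinitesimal U) (Ω : Opens (Vec d)) :
    Function.Injective (embed ρ Ω) := by
  refine (injective_iff_map_eq_zero _).2 fun T hT => eq_zero_of_isNegligible_starReg ρ ?_
  have h : IsNegligible ρ (starReg ρ T - 0) :=
    RhoE.mk_eq_mk (hg := (Moderate ρ Ω).zero_mem).1 hT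
  rwa [sub_zero] at h

end

end

end RhoAsymptotic

/-! ### The embedding theorem -/

open RhoAsymptotic in
theorem mainTheorem12 {I : Type*} (U : Ultrafilter I) (hU : CountablyIncomplete U) (d : ℕ)
    (ρ : PosInfinitesimal U) :
    ∃ (D : StarE U (⊤ : Opens (Vec d)))
      (P : ∀ Ω : Opens (Vec d), Star U 𝓓(Ω, ℂ))
      (σ : ∀ Ω : Opens (Vec d), Distr Ω →ₗ[ℂ] RhoE ρ Ω),
      -- `D` is a `ρ`-delta function and every `P Ω` is a `ρ`-cut-off function for `Ω`
      IsRhoDelta ρ D ∧ (∀ Ω, IsRhoCutoff ρ (P Ω)) ∧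
      -- `σ Ω T` is the class of `(*T Π_Ω) ⋆ D`
      (∀ Ω (T : Distr Ω), ∃ (F : StarE U Ω) (hF : IsModerate ρ F),
        IsConvolution T (P Ω) D F ∧ σ Ω T = RhoE.mk ρ F hF) ∧
      -- `E(Ω) → D'(Ω) → ^ρE(Ω)` are embeddings
      (∀ Ω, Function.Injective (Distr.ofSmooth (Ω := Ω)) ∧ Function.Injective (σ Ω)) ∧
      -- `σ Ω` preserves partial differentiation
      (∀ Ω (α : Fin d → ℕ) (T : Distr Ω),
        σ Ω (multiDeriv Distr.pderiv α T) = multiDeriv RhoE.pderiv α (σ Ω T)) ∧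
      -- `σ` is a morphism of sheaves, and preserves and reflects vanishing on open subsets
      (∀ (O Ω : Opens (Vec d)) (h : O ≤ Ω) (T : Distr Ω),
        σ O (Distr.restrict h T) = RhoE.restrict ρ h (σ Ω T) ∧
        (RhoE.restrict ρ h (σ Ω T) = 0 ↔ Distr.restrict h T = 0)) ∧
      -- on smooth functions, `σ Ω` is `f ↦` the class of `*f`
      (∀ Ω (f : Smooth Ω), σ Ω (Distr.ofSmooth f) = RhoE.ofSmooth ρ f) ∧
      -- the product of `^ρE(Ω)` extends the pointwise product of `E(Ω)`
      (∀ Ω (f g : Smooth Ω),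
        σ Ω (Distr.ofSmooth f) * σ Ω (Distr.ofSmooth g) = σ Ω (Distr.ofSmooth (f * g))) :=
  ⟨starDelta ρ d, starCutoff ρ, embed ρ, isRhoDelta_starDelta ρ, isRhoCutoff_starCutoff ρ,
    fun _ T => ⟨starReg ρ T, isModerate_starReg ρ T, isConvolution_starReg ρ T, rfl⟩,
    -- The composite `f ↦` class of `*f` is injective, hence so is its first factor.
    fun Ω => ⟨fun f g h => ofSmooth_injective ρ Ω (by
      rw [← embed_ofSmooth, ← embed_ofSmooth, h]), embed_injective ρ Ω⟩,
    fun Ω α T => map_multiDeriv _ _ (embed ρ Ω) (embed_pderiv ρ) α T,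
    -- Restricting the image of `T` gives the image of its restriction, and `embed ρ O` is
    -- injective.
    fun O Ω h T => ⟨embed_restrict ρ h T, by
      rw [← embed_restrict, map_eq_zero_iff _ (embed_injective ρ O)]⟩,
    fun _ f => embed_ofSmooth ρ f,
    fun _ f g => by rw [embed_ofSmooth, embed_ofSmooth, embed_ofSmooth, map_mul]⟩
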